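/- Let $d\ge 2$, let $\chi:\mathbb R^d\to\mathbb R$ be smooth and radial, supported in $\{|\xi|\le 4/3\}$ and equal to $1$ on $\{|\xi|<3/4\}$, and let $\varphi(\xi)=\chi(\xi/2)-\chi(\xi)$, $\dot S_j=\chi(2^{-j}D)$, $\dot\Delta_j=\varphi(2^{-j}D)$ for $j\in\mathbb Z$. Let $\mathcal S'_h$ be the set of tempered distributions $u$ on $\mathbb R^d$ with $\|\dot S_ju\|_{L^\infty}\to0$ as $j\to-\infty$. Put $\|u\|_{\dot B^s_{p,1}}=\sum_{j\in\mathbb Z}2^{js}\|\dot\Delta_ju\|_{L^p}$ and, for a fixed $k_0\in\mathbb Z$, $\|u\|^\ell_{\dot B^s_{p,1}}=\sum_{j\le k_0}2^{js}\|\dot\Delta_ju\|_{L^p}$; the space $\dot B^s_{p,1}$ consists of the $u\in\mathcal S'_h$ with $\|u\|_{\dot B^s_{p,1}}<\infty$. Let $\Lambda_1$ be the Fourier multiplier with symbol $|\xi|_1=\sum_{i=1}^d|\xi_i|$. Let $T_fg=\sum_{j}\dot S_{j-1}f\,\dot\Delta_jg$ and $R(f,g)=\sum_j\sum_{|j'-j|\le1}\dot\Delta_jf\,\dot\Delta_{j'}g$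 (convergence in $\mathcal S'$, unconditionally), and $fg=\lim_{n\to+\infty}\dot S_nf\,\dot S_ng$ in $\mathcal S'$. For $c_0>0$ and $t\ge0$, and for $f,g,h\in\mathcal S'_h$, a statement about $F=e^{\sqrt{c_0t}\Lambda_1}f$, $G=e^{\sqrt{c_0t}\Lambda_1}g$ or $e^{\sqrt{c_0t}\Lambda_1}h$ includes that these are elements of $\mathcal S'_h$ whose dyadic blocks are bounded functions. Let $2\le p\le4$. Below, the constants $C>0$ may depend on $d,\chi,p$ and on the parameters $s,s_1,s_2,k_0$ of the respective part, but not on $c_0,t,f,g$. 1. (Paraproduct.) Assume $p\le\frac{2d}{d-2}$ (no condition if $d=2$) and let $s\in\mathbb R$. There is $C$ such that, whenever $F\in\dot B^{\frac dp-1}_{p,1}$ and $G\in\dot B^{s+1-\frac d2+\frac dp}_{p,1}$, the series $T_fg$ converges to an element of $\mathcal S'_h$, $e^{\sqrt{c_0t}\Lambda_1}T_fg$ exists, and $$\|e^{\sqrt{c_0t}\Lambda_1}T_fg\|_{\dot B^s_{2,1}}\le C\|F\|_{\dot B^{\frac dp-1}_{p,1}}\|G\|_{\dot B^{s+1-\frac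 d2+\frac dp}_{p,1}}.$$ 2. (Remainder.) Let $s_1+s_2>d(\frac12-\frac2p)$. There is $C$ such that, for $F\in\dot B^{s_1+d(\frac2p-\frac12)}_{p,1}$ and $G\in\dot B^{s_2}_{p,1}$, whenever the series $R(f,g)$ converges to an element of $\mathcal S'_h$, $e^{\sqrt{c_0t}\Lambda_1}R(f,g)$ exists and $$\|e^{\sqrt{c_0t}\Lambda_1}R(f,g)\|_{\dot B^{s_1+s_2}_{2,1}}\le C\|F\|_{\dot B^{s_1+d(\frac2p-\frac12)}_{p,1}}\|G\|_{\dot B^{s_2}_{p,1}}.$$ Moreover the series does converge to an element of $\mathcal S'_h$ if $s_1+d(\frac2p-\frac12)\le\frac dp$ or $s_2\le\frac dp$. 3. (Low frequencies of the product.) Assume $p\le\frac{2d}{d-2}$ (no condition if $d=2$) and $p<2d$. For every $k_0\in\mathbb Z$ there is $C$ such that, whenever $F$ and $G$ belong to the Besov spaces whose norms are applied to them on the right-hand side, $fg$ exists in $\mathcal S'_h$, $e^{\sqrt{c_0t}\Lambda_1}(fg)$ exists, and $$\|e^{\sqrt{c_0t}\Lambda_1}(fg)\|^\ell_{\dot B^{d/2}_{2,1}}\le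 C\big(\|F\|_{\dot B^{\frac dp-1}_{p,1}}\|G\|_{\dot B^{\frac dp+1}_{p,1}}+\|F\|_{\dot B^{\frac dp+1}_{p,1}}\|G\|_{\dot B^{\frac dp-1}_{p,1}}\big),$$ $$\|e^{\sqrt{c_0t}\Lambda_1}(fg)\|^\ell_{\dot B^{d/2-1}_{2,1}}\le C\big(\|F\|_{\dot B^{\frac dp-1}_{p,1}}\|G\|_{\dot B^{\frac dp}_{p,1}}+\|F\|_{\dot B^{\frac dp}_{p,1}}\|G\|_{\dot B^{\frac dp-1}_{p,1}}\big),$$ $$\|e^{\sqrt{c_0t}\Lambda_1}(fg)\|^\ell_{\dot B^{d/2-1}_{2,1}}\le C\big(\|F\|_{\dot B^{\frac dp-1}_{p,1}}+\|F\|_{\dot B^{\frac dp}_{p,1}}\big)\|G\|_{\dot B^{\frac dp-1}_{p,1}}.$$ -/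

import Mathlib

open MeasureTheory Filter Topology
open scoped ENNReal SchwartzMap FourierTransform

noncomputable section

namespace GevreyBesov

/-- The space `ℝ^d` with its Euclidean norm. -/
abbrev Sp (d : ℕ) : Type := EuclideanSpace ℝ (Fin d)

/-- Tempered (complex valued) distributions on `ℝ^d`. -/
abbrev TDist (d : ℕ) : Type := 𝓢'(Sp d, ℂ)

variable {d : ℕ}

/-! ### Functions as tempered distributions -/

/-- The tempered distribution `u` is the function `w`. It is only used together with
`MemLp w q volume` for some `q ≥ 1`, so that the integrals converge. -/
def Represents (w : Sp d → ℂ) (u : TDist d) : Prop :=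
  ∀ φ : 𝓢(Sp d, ℂ), u φ = ∫ x, φ x • w x

/-- The `L^p` norm of a tempered distribution, with value `∞` if it is not an `L^p` function
(the infimum is over the at most one class of functions that represents `u`). -/
def distLpNorm (p : ℝ≥0∞) (u : TDist d) : ℝ≥0∞ :=
  ⨅ (w : Sp d → ℂ) (_ : MemLp w p volume ∧ Represents w u), eLpNorm w p volume

open Classical in
/-- The bounded function that represents `u` (and `0` if `u` is not a bounded function). -/
def bddFun (u : TDist d) : Sp d → ℂ :=
  if h : ∃ w : Sp d → ℂ, MemLp w ∞ volume ∧ Represents w u then h.choose else 0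

theorem memLp_bddFun (u : TDist d) : MemLp (bddFun u) ∞ volume := by
  unfold bddFun
  split_ifs with h
  · exact h.choose_spec.1
  · exact MemLp.zero

/-- The pointwise product of two tempered distributions that are bounded functions. -/
def mulBdd (u v : TDist d) : TDist d :=
  Lp.toTemperedDistribution
    (((memLp_bddFun v).mul (r := ∞) (memLp_bddFun u)).toLp (bddFun u * bddFun v))

/-! ### Littlewood-Paley decomposition

The Fourier transform of Mathlib is `∫ e^{-2πi x·ξ} f(x) dx`. The operator `m(D)`, with `D = -i∇`,
is therefore the Fourier multiplier with symbol `ξ ↦ m(2πξ)` in Mathlib's normalization. -/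

/-- A smooth radial function supported in the ball of radius `4/3`, equal to `1` on the ball of
radius `3/4`. -/
structure IsCutoff (χ : Sp d → ℝ) : Prop where
  smooth : ContDiff ℝ (⊤ : ℕ∞) χ
  radial : ∀ ξ η : Sp d, ‖ξ‖ = ‖η‖ → χ ξ = χ η
  eq_zero : ∀ ξ : Sp d, 4 / 3 < ‖ξ‖ → χ ξ = 0
  eq_one : ∀ ξ : Sp d, ‖ξ‖ < 3 / 4 → χ ξ = 1

/-- The function `φ(ξ) = χ(ξ/2) - χ(ξ)`. -/
def annulus (χ : Sp d → ℝ) (ξ : Sp d) : ℝ := χ ((2 : ℝ)⁻¹ • ξ) - χ ξ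

/-- The Fourier multiplier `m(2^{-j} D)` on tempered distributions. -/
def dyadic (m : Sp d → ℝ) (j : ℤ) (u : TDist d) : TDist d :=
  TemperedDistribution.fourierMultiplierCLM ℂ
    (fun ξ : Sp d => ((m ((2 : ℝ) ^ (-j) • ((2 * Real.pi) • ξ)) : ℝ) : ℂ)) u

/-- The low frequency cut-off `Ṡ_j = χ(2^{-j} D)`. -/
def lowCut (χ : Sp d → ℝ) (j : ℤ) (u : TDist d) : TDist d := dyadic χ j u

/-- The dyadic block `Δ̇_j = φ(2^{-j} D)`. -/
def block (χ : Sp d → ℝ) (j : ℤ) (u : TDist d) : TDist d := dyadic (annulus χ) j u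

/-- The space `𝓢'_h` of tempered distributions with `‖Ṡ_j u‖_{L^∞} → 0` as `j → -∞`. -/
def IsSh (χ : Sp d → ℝ) (u : TDist d) : Prop :=
  Tendsto (fun j : ℤ => distLpNorm ∞ (lowCut χ j u)) atBot (𝓝 0)

/-- The norm of the homogeneous Besov space `Ḃ^s_{p,1}`. -/
def besovNorm (χ : Sp d → ℝ) (s p : ℝ) (u : TDist d) : ℝ≥0∞ :=
  ∑' j : ℤ, ENNReal.ofReal ((2 : ℝ) ^ ((j : ℝ) * s)) * distLpNorm (ENNReal.ofReal p) (block χ j u)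

/-- The low frequency part `∑_{j ≤ k₀} 2^{js} ‖Δ̇_j u‖_{L^p}` of the Besov norm. -/
def besovNormLow (χ : Sp d → ℝ) (k₀ : ℤ) (s p : ℝ) (u : TDist d) : ℝ≥0∞ :=
  ∑' j : {j : ℤ // j ≤ k₀},
    ENNReal.ofReal ((2 : ℝ) ^ (((j : ℤ) : ℝ) * s)) * distLpNorm (ENNReal.ofReal p) (block χ j u)

/-- The homogeneous Besov space `Ḃ^s_{p,1}`. -/
def MemBesov (χ : Sp d → ℝ) (s p : ℝ) (u : TDist d) : Prop :=
  IsSh χ u ∧ besovNorm χ s p u < ∞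

/-! ### The operator `e^{aΛ₁}` -/

/-- The symbol `e^{-a|ξ|₁}` of `e^{-aΛ₁}`, where `|ξ|₁ = ∑ |ξ_i|`. -/
def expSymbol (a : ℝ) (ξ : Sp d) : ℂ :=
  ((Real.exp (-a * ∑ i, |((2 * Real.pi) • ξ) i|) : ℝ) : ℂ)

/-- The function `𝓕(e^{-a|·|₁} 𝓕⁻¹ φ)`, for a Schwartz function `φ`. It is integrable for `a ≥ 0`,
but need not be a Schwartz function, since the symbol is not smooth. -/
def expTranspose (a : ℝ) (φ : 𝓢(Sp d, ℂ)) : Sp d → ℂ :=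
  𝓕 (fun ξ : Sp d => expSymbol a ξ * (𝓕⁻ φ : 𝓢(Sp d, ℂ)) ξ)

/-- `v = e^{-aΛ₁} w` for a bounded function `w`. This is the usual formula
`⟨m(D)w, φ⟩ = ⟨w, 𝓕(m 𝓕⁻¹ φ)⟩` for a Fourier multiplier. -/
def IsExpNeg (a : ℝ) (w : Sp d → ℂ) (v : TDist d) : Prop :=
  ∀ φ : 𝓢(Sp d, ℂ), v φ = ∫ x, expTranspose a φ x * w x

/-- `F = e^{aΛ₁} f` (for `a ≥ 0`), where `f` and `F` belong to `𝓢'_h`: every block `Δ̇_j F` is a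
bounded function, and `Δ̇_j f = e^{-aΛ₁} Δ̇_j F`. -/
def IsExp (χ : Sp d → ℝ) (a : ℝ) (f F : TDist d) : Prop :=
  IsSh χ f ∧ IsSh χ F ∧ ∀ j : ℤ, ∃ w : Sp d → ℂ,
    MemLp w ∞ volume ∧ Represents w (block χ j F) ∧ IsExpNeg a w (block χ j f)

/-! ### Paraproduct, remainder and product -/

/-- `h = T_f g = ∑_j Ṡ_{j-1} f Δ̇_j g`, with convergence in the space of tempered distributions. -/
def IsParaproduct (χ : Sp d → ℝ) (f g h : TDist d) : Prop :=
  HasSum (fun j : ℤ => mulBdd (lowCut χ (j - 1) f) (block χ j g)) h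

/-- `h = R(f,g) = ∑_j ∑_{|j'-j| ≤ 1} Δ̇_j f Δ̇_{j'} g`, with convergence in the space of tempered
distributions. -/
def IsRemainder (χ : Sp d → ℝ) (f g h : TDist d) : Prop :=
  HasSum (fun j : ℤ => ∑ i ∈ Finset.Icc (j - 1) (j + 1), mulBdd (block χ j f) (block χ i g)) h

/-- `h = fg`: the product of two tempered distributions, as the limit of the products of their
regularizations `Ṡ_n f` and `Ṡ_n g`. -/
def IsProduct (χ : Sp d → ℝ) (f g h : TDist d) : Prop :=
  Tendsto (fun n : ℕ => mulBdd (lowCut χ n f) (lowCut χ n g)) atTop (𝓝 h)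

end GevreyBesov

end

open GevreyBesov

open MeasureTheory Filter Topology
open scoped ENNReal SchwartzMap FourierTransform

noncomputable section

namespace GevreyBesov

variable {d : ℕ}

/-! Put `a = √(c₀t)`. Everything rests on the bilinear operator `B(U, V) = e^{aΛ₁}(e^{-aΛ₁}U ·
e^{-aΛ₁}V)`, whose symbol is `e^{a(|ξ+η|₁ - |ξ|₁ - |η|₁)}`. Once `B` is bounded from `L^p × L^p`
into `L²` with the Hölder and Bernstein losses of an ordinary product, uniformly in `a`, the
estimates are those of Littlewood-Paley theory, applied to the blocks of `F` and `G`.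

The norm `|·|₁` splits over coordinates. In one coordinate, with the signs of `s`, `t` and `s + t`
fixed, `|s| + |t| - |s+t|` is either `0` or twice the modulus of the summand whose sign differs from
that of the sum. Hence `B` is a sum of `8^d` operators `C(D)(A(D)U · A'(D)V)`, where `C` is the
indicator of an orthant and `A`, `A'` are of the form `1_Q e^{-∑ ℓ_i|ξ_i|}` with `ℓ_i ≥ 0`
(`esym_mul_esym`, `isBil_sum`). As the target is `L²`, Plancherel settles `C`. The multipliers `A`,
`A'` are bounded on `L^p` for `2 ≤ p ≤ 4`, uniformly in `ℓ` (`exists_eLpNorm_fm_osym_le`). For `p =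
2` this is Plancherel. For `p = 4` one squares: M. Riesz's identity `P² - M² = (P - M)(P + M)` gives
the projections to half spaces, hence to orthants. On an orthant the exponential is multiplicative,
so it factors out of the transform of the square. Marcinkiewicz interpolation covers the exponents
in between. Density of Schwartz functions then defines `B` on `L^p × L^p` (`exists_bilinear`).

For the paraproduct, Bernstein is applied to the low-frequency factor, from `L^p` to `L^{p*}` with
`1/p* + 1/p = 1/2` (`IsCutoff.exists_mul_L2`); summing over its blocks needs `d/p - d/2 + 1 ≥ 0`,
that is `p ≤ 2d/(d-2)`. For the remainder, it is applied to the output, from `L^{p/2}` to `L²`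
(`IsCutoff.exists_block_mul_L2`); summing over the output frequencies needs `s₁ + s₂ > d(1/2 -
2/p)`.

These bounds yield `L²` functions `H_j` with `e^{-aΛ₁}H_j = Δ̇_j h`, and it remains to assemble them
into an element of `𝓢'_h` (`IsDec.exists_isExp`). The high frequencies converge in `𝓢'` because the
norms grow at most exponentially. The low frequencies converge in `L^∞`: there `e^{-aΛ₁}` has an
inverse bounded on `L^∞`, since `e^{|t|} = 2 cosh t - e^{-|t|}` splits the symbol into smooth
factors and Poisson factors (`IsTest.exists_eLpNorm_top_le`), and `Ṡ_j h` tends to `0` uniformly.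

The product is the sum of two paraproducts and a remainder, by Bony's telescoping identity
(`Blocks.isProduct`). -/

/-! ### Convolution with complex measures of the form `k ν` -/

/-- Convolution of `w` with the complex measure `k ν`. -/
def cv (ν : Measure (Sp d)) (k w : Sp d → ℂ) (x : Sp d) : ℂ := ∫ y, k y * w (x - y) ∂ν

/-- Translation invariance of Lebesgue measure alone makes `w (x - y)` independent of the
representative of `w`. No density of `ν` is needed, so `ν` may be the Poisson measure even when it
degenerates to a Dirac mass. -/
theorem qmp_sub (ν : Measure (Sp d)) [SFinite ν] :
    Measure.QuasiMeasurePreserving (fun z : Sp d × Sp d => z.1 - z.2)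
      ((volume : Measure (Sp d)).prod ν) volume :=
  quasiMeasurePreserving_sub_of_right_invariant volume ν

theorem aesm_cv {ν : Measure (Sp d)} [SFinite ν] {k w : Sp d → ℂ}
    (hk : AEStronglyMeasurable k ν) (hw : AEStronglyMeasurable w volume) :
    AEStronglyMeasurable (cv ν k w) volume := by
  have h1 : AEStronglyMeasurable (fun z : Sp d × Sp d => k z.2 * w (z.1 - z.2))
      ((volume : Measure (Sp d)).prod ν) :=
    hk.comp_snd.mul (hw.comp_quasiMeasurePreserving (qmp_sub ν))
  exact h1.integral_prod_right'

theorem cv_congr_ae {ν : Measure (Sp d)} [SFinite ν] {k w w' : Sp d → ℂ} (h : w =ᵐ[volume] w') :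
    cv ν k w =ᵐ[volume] cv ν k w' := by
  have h1 : ∀ᵐ z ∂((volume : Measure (Sp d)).prod ν), w (z.1 - z.2) = w' (z.1 - z.2) :=
    (qmp_sub ν).ae h
  filter_upwards [Measure.ae_ae_of_ae_prod h1] with x hx
  exact integral_congr_ae (hx.mono fun y hy => by simp only [hy])

/-- Jensen's inequality for averages with respect to a finite measure. -/
theorem lintegral_rpow_le_of_finite {α : Type*} [MeasurableSpace α] (κ : Measure α)
    {g : α → ℝ≥0∞} (hg : AEMeasurable g κ) {q : ℝ} (hq : 1 ≤ q) :
    (∫⁻ y, g y ∂κ) ^ q ≤ κ Set.univ ^ (q - 1) * ∫⁻ y, g y ^ q ∂κ := by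
  have hq0 : 0 < q := by linarith
  have h := eLpNorm'_le_eLpNorm'_mul_rpow_measure_univ (μ := κ) (f := g) one_pos hq
    hg.aestronglyMeasurable
  simp only [eLpNorm', enorm_eq_self, ENNReal.rpow_one, div_one, one_div] at h
  have h2 := ENNReal.rpow_le_rpow h hq0.le
  rw [ENNReal.mul_rpow_of_nonneg _ _ hq0.le, ← ENNReal.rpow_mul, ← ENNReal.rpow_mul,
    inv_mul_cancel₀ hq0.ne', ENNReal.rpow_one] at h2
  have : (1 - q⁻¹) * q = q - 1 := by field_simp
  rwa [this, mul_comm] at h2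

theorem enorm_cv_le {ν : Measure (Sp d)} {k w : Sp d → ℂ} (x : Sp d) :
    ‖cv ν k w x‖ₑ ≤ ∫⁻ y, ‖k y‖ₑ * ‖w (x - y)‖ₑ ∂ν := by
  refine (enorm_integral_le_lintegral_enorm _).trans (le_of_eq ?_)
  simp [enorm_mul]

theorem enorm_cv_rpow_le {ν : Measure (Sp d)} [SFinite ν] {k w : Sp d → ℂ} (hk : Measurable k)
    (hw : Measurable w) {q : ℝ} (hq : 1 ≤ q) (x : Sp d) :
    ‖cv ν k w x‖ₑ ^ q ≤
      (∫⁻ y, ‖k y‖ₑ ∂ν) ^ (q - 1) * ∫⁻ y, ‖k y‖ₑ * ‖w (x - y)‖ₑ ^ q ∂ν := by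
  have hq0 : 0 < q := by linarith
  have hm : Measurable fun y => ‖w (x - y)‖ₑ := (hw.comp (measurable_const.sub measurable_id)).enorm
  -- Jensen for the measure `|k| ν`, whose total mass is the `L^1` norm of `k`.
  have h := lintegral_rpow_le_of_finite (ν.withDensity fun y => ‖k y‖ₑ) hm.aemeasurable hq
  rw [lintegral_withDensity_eq_lintegral_mul _ hk.enorm hm,
    lintegral_withDensity_eq_lintegral_mul _ hk.enorm (hm.pow_const q)] at h
  simp only [withDensity_apply _ MeasurableSet.univ, Measure.restrict_univ] at h
  exact (ENNReal.rpow_le_rpow (enorm_cv_le x) hq0.le).trans h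

/-- Young's inequality `L^1 * L^q ⊆ L^q`. -/
theorem eLpNorm_cv_le {ν : Measure (Sp d)} [SFinite ν] {k w : Sp d → ℂ} (hk : Measurable k)
    (hw : AEStronglyMeasurable w volume) {q : ℝ≥0∞} (hq : 1 ≤ q) :
    eLpNorm (cv ν k w) q volume ≤ (∫⁻ y, ‖k y‖ₑ ∂ν) * eLpNorm w q volume := by
  -- Tonelli below is applied to a Borel representative of `w`.
  wlog hwm : Measurable w generalizing w
  · rw [eLpNorm_congr_ae (cv_congr_ae hw.ae_eq_mk), eLpNorm_congr_ae hw.ae_eq_mk]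
    exact this hw.stronglyMeasurable_mk.aestronglyMeasurable hw.stronglyMeasurable_mk.measurable
  rcases eq_or_ne q ∞ with rfl | hqt
  · simp only [eLpNorm_exponent_top]
    have h1 : ∀ᵐ z ∂((volume : Measure (Sp d)).prod ν),
        ‖w (z.1 - z.2)‖ₑ ≤ eLpNormEssSup w volume :=
      (qmp_sub ν).ae (ae_le_eLpNormEssSup (f := w))
    refine essSup_le_of_ae_le _ ?_
    filter_upwards [Measure.ae_ae_of_ae_prod h1] with x hx
    refine (enorm_cv_le x).trans ?_
    rw [← lintegral_mul_const _ hk.enorm]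
    refine lintegral_mono_ae (hx.mono fun y hy => ?_)
    gcongr
  · set r := q.toReal with hr
    have hr1 : 1 ≤ r := by
      rw [hr, ← ENNReal.toReal_one]; exact (ENNReal.toReal_le_toReal (by simp) hqt).2 hq
    have hr0 : 0 < r := by linarith
    have hq0 : q ≠ 0 := by rintro rfl; simp at hq
    rw [eLpNorm_eq_eLpNorm' hq0 hqt, eLpNorm_eq_eLpNorm' hq0 hqt, ← hr]
    simp only [eLpNorm', one_div]
    set A := ∫⁻ y, ‖k y‖ₑ ∂ν with hA
    have key : ∫⁻ x, ‖cv ν k w x‖ₑ ^ r ≤ A ^ r * ∫⁻ x, ‖w x‖ₑ ^ r := by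
      calc ∫⁻ x, ‖cv ν k w x‖ₑ ^ r
          ≤ ∫⁻ x, A ^ (r - 1) * ∫⁻ y, ‖k y‖ₑ * ‖w (x - y)‖ₑ ^ r ∂ν :=
            lintegral_mono fun x => enorm_cv_rpow_le hk hwm hr1 x
        _ = A ^ (r - 1) * ∫⁻ x, ∫⁻ y, ‖k y‖ₑ * ‖w (x - y)‖ₑ ^ r ∂ν := by
            rw [lintegral_const_mul]
            exact Measurable.lintegral_prod_right'
              (f := fun z : Sp d × Sp d => ‖k z.2‖ₑ * ‖w (z.1 - z.2)‖ₑ ^ r) (by fun_prop)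
        _ = A ^ (r - 1) * ∫⁻ y, (∫⁻ x, ‖k y‖ₑ * ‖w (x - y)‖ₑ ^ r) ∂ν := by
            rw [lintegral_lintegral_swap]
            exact Measurable.aemeasurable (by fun_prop)
        _ = A ^ (r - 1) * ∫⁻ y, (‖k y‖ₑ * ∫⁻ x, ‖w x‖ₑ ^ r) ∂ν := by
            congr 1
            refine lintegral_congr fun y => ?_
            rw [lintegral_const_mul _ (by fun_prop)]
            congr 1
            exact lintegral_sub_right_eq_self (fun x => ‖w x‖ₑ ^ r) y
        _ = A ^ r * ∫⁻ x, ‖w x‖ₑ ^ r := by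
            rw [lintegral_mul_const _ hk.enorm, ← hA, ← mul_assoc]
            congr 1
            -- `A^(r-1) * A = A^r` is the addition rule for exponents, which in `ℝ≥0∞` requires `A`
            -- to be neither `0` nor `∞`.
            rcases eq_or_ne A 0 with h0 | h0
            · rw [h0, mul_zero, ENNReal.zero_rpow_of_pos hr0]
            rcases eq_or_ne A ∞ with ht | ht
            · rw [ht, ENNReal.top_rpow_of_pos hr0, ENNReal.mul_top]
              rcases hr1.eq_or_lt with h1 | h1
              · simp [← h1]
              · simp [ENNReal.top_rpow_of_pos (sub_pos.2 h1)]
            · nth_rewrite 2 [← ENNReal.rpow_one A]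
              rw [← ENNReal.rpow_add _ _ h0 ht, sub_add_cancel]
    calc (∫⁻ x, ‖cv ν k w x‖ₑ ^ r) ^ r⁻¹ ≤ (A ^ r * ∫⁻ x, ‖w x‖ₑ ^ r) ^ r⁻¹ := by gcongr
      _ = A * (∫⁻ x, ‖w x‖ₑ ^ r) ^ r⁻¹ := by
        rw [ENNReal.mul_rpow_of_nonneg _ _ (by positivity), ← ENNReal.rpow_mul,
          mul_inv_cancel₀ hr0.ne', ENNReal.rpow_one]

theorem MemLp.cv {ν : Measure (Sp d)} [SFinite ν] {k w : Sp d → ℂ} (hk : Measurable k)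
    (hki : Integrable k ν) {q : ℝ≥0∞} (hq : 1 ≤ q) (hw : MemLp w q volume) :
    MemLp (cv ν k w) q volume :=
  ⟨aesm_cv hki.1 hw.1, (eLpNorm_cv_le hk hw.1 hq).trans_lt
    (ENNReal.mul_lt_top hki.2 hw.2)⟩

/-- The convolution is defined by a Bochner integral, which is `0` when the integrand is not
integrable; additivity in `w` therefore requires integrability at almost every `x`. -/
theorem ae_integrable_cv {ν : Measure (Sp d)} [SFinite ν] {k w : Sp d → ℂ} (hk : Measurable k)
    (hki : Integrable k ν) {q : ℝ≥0∞} (hq : 1 ≤ q) (hw : MemLp w q volume) :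
    ∀ᵐ x, Integrable (fun y => k y * w (x - y)) ν := by
  have h1 : AEStronglyMeasurable (fun z : Sp d × Sp d => k z.2 * w (z.1 - z.2))
      ((volume : Measure (Sp d)).prod ν) :=
    hki.1.comp_snd.mul (hw.1.comp_quasiMeasurePreserving (qmp_sub ν))
  have h3 : ∫⁻ y, ‖k y‖ₑ ∂ν < ∞ := hki.2
  wlog hwm : Measurable w generalizing w
  · have := this (w := hw.1.mk w) (hw.ae_eq hw.1.ae_eq_mk)
      (hki.1.comp_snd.mul (hw.1.stronglyMeasurable_mk.aestronglyMeasurable.comp_quasiMeasurePreserving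
        (qmp_sub ν)))
      hw.1.stronglyMeasurable_mk.measurable
    have h5 : ∀ᵐ z ∂((volume : Measure (Sp d)).prod ν), w (z.1 - z.2) = hw.1.mk w (z.1 - z.2) :=
      (qmp_sub ν).ae hw.1.ae_eq_mk
    filter_upwards [this, Measure.ae_ae_of_ae_prod h5] with x hx hx2
    exact hx.congr (hx2.mono fun y hy => by simp only [hy])
  have hfin : ∀ᵐ x, ∫⁻ y, ‖k y‖ₑ * ‖w (x - y)‖ₑ ∂ν < ∞ := by
    rcases eq_or_ne q ∞ with rfl | hqt
    · have h1 : ∀ᵐ z ∂((volume : Measure (Sp d)).prod ν),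
          ‖w (z.1 - z.2)‖ₑ ≤ eLpNormEssSup w volume :=
        (qmp_sub ν).ae (ae_le_eLpNormEssSup (f := w))
      filter_upwards [Measure.ae_ae_of_ae_prod h1] with x hx
      have : ∫⁻ y, ‖k y‖ₑ * ‖w (x - y)‖ₑ ∂ν ≤ ∫⁻ y, ‖k y‖ₑ * eLpNormEssSup w volume ∂ν :=
        lintegral_mono_ae (hx.mono fun y hy => by gcongr)
      refine this.trans_lt ?_
      rw [lintegral_mul_const _ hk.enorm]
      exact ENNReal.mul_lt_top h3 (by simpa [eLpNorm_exponent_top] using hw.2)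
    · set r := q.toReal with hr
      have hr1 : 1 ≤ r := by
        rw [hr, ← ENNReal.toReal_one]; exact (ENNReal.toReal_le_toReal (by simp) hqt).2 hq
      have hr0 : 0 < r := by linarith
      have hq0 : q ≠ 0 := by rintro rfl; simp at hq
      have hI : ∫⁻ x, ∫⁻ y, ‖k y‖ₑ * ‖w (x - y)‖ₑ ^ r ∂ν ≠ ∞ := by
        rw [lintegral_lintegral_swap (Measurable.aemeasurable (by fun_prop))]
        have : ∀ y, ∫⁻ x, ‖k y‖ₑ * ‖w (x - y)‖ₑ ^ r = ‖k y‖ₑ * ∫⁻ x, ‖w x‖ₑ ^ r := fun y => by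
          rw [lintegral_const_mul _ (by fun_prop)]
          congr 1
          exact lintegral_sub_right_eq_self (fun x => ‖w x‖ₑ ^ r) y
        simp_rw [this]
        rw [lintegral_mul_const _ hk.enorm]
        exact (ENNReal.mul_lt_top h3
          (lintegral_rpow_enorm_lt_top_of_eLpNorm_lt_top hq0 hqt hw.2)).ne
      have hm : Measurable fun x => ∫⁻ y, ‖k y‖ₑ * ‖w (x - y)‖ₑ ^ r ∂ν :=
        Measurable.lintegral_prod_right'
          (f := fun z : Sp d × Sp d => ‖k z.2‖ₑ * ‖w (z.1 - z.2)‖ₑ ^ r) (by fun_prop)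
      filter_upwards [ae_lt_top hm hI] with x hx
      have hmx : Measurable fun y => ‖w (x - y)‖ₑ :=
        (hwm.comp (measurable_const.sub measurable_id)).enorm
      have h := lintegral_rpow_le_of_finite (ν.withDensity fun y => ‖k y‖ₑ) hmx.aemeasurable hr1
      rw [lintegral_withDensity_eq_lintegral_mul _ hk.enorm hmx,
        lintegral_withDensity_eq_lintegral_mul _ hk.enorm (hmx.pow_const r)] at h
      simp only [withDensity_apply _ MeasurableSet.univ, Measure.restrict_univ] at h
      have h6 : (∫⁻ y, ‖k y‖ₑ * ‖w (x - y)‖ₑ ∂ν) ^ r < ∞ := h.trans_lt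
        (ENNReal.mul_lt_top (ENNReal.rpow_lt_top_of_nonneg (by linarith) h3.ne) hx)
      exact (ENNReal.rpow_lt_top_iff_of_pos hr0).1 h6
  filter_upwards [hfin] with x hx
  refine ⟨(hk.mul (hwm.comp (measurable_const.sub measurable_id))).aestronglyMeasurable, ?_⟩
  simpa [HasFiniteIntegral, enorm_mul] using hx

theorem cv_add_ae {ν : Measure (Sp d)} [SFinite ν] {k w w' : Sp d → ℂ} (hk : Measurable k)
    (hki : Integrable k ν) {q : ℝ≥0∞} (hq : 1 ≤ q) (hw : MemLp w q volume)
    (hw' : MemLp w' q volume) : cv ν k (w + w') =ᵐ[volume] cv ν k w + cv ν k w' := by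
  filter_upwards [ae_integrable_cv hk hki hq hw, ae_integrable_cv hk hki hq hw'] with x h1 h2
  simp only [cv, Pi.add_apply, mul_add]
  exact integral_add h1 h2

theorem cv_sub_ae {ν : Measure (Sp d)} [SFinite ν] {k w w' : Sp d → ℂ} (hk : Measurable k)
    (hki : Integrable k ν) {q : ℝ≥0∞} (hq : 1 ≤ q) (hw : MemLp w q volume)
    (hw' : MemLp w' q volume) : cv ν k (w - w') =ᵐ[volume] cv ν k w - cv ν k w' := by
  filter_upwards [ae_integrable_cv hk hki hq hw, ae_integrable_cv hk hki hq hw'] with x h1 h2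
  simp only [cv, Pi.sub_apply, mul_sub]
  exact integral_sub h1 h2

/-- The pairing of Schwartz functions with `L^q` functions, with a bound that does not change
under translation. -/
theorem integrable_mul_of_memLp {q : ℝ≥0∞} (hq : 1 ≤ q) (φ : 𝓢(Sp d, ℂ)) {w : Sp d → ℂ}
    (hw : MemLp w q volume) : Integrable (fun x => φ x * w x) volume := by
  have := ENNReal.HolderConjugate.inv_one_sub_inv' hq
  have := ENNReal.HolderConjugate.symm (p := q) (q := (1 - q⁻¹)⁻¹)
  exact MemLp.integrable_mul (φ.memLp (1 - q⁻¹)⁻¹ volume) hw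

theorem exists_lintegral_mul_le {q : ℝ≥0∞} (hq : 1 ≤ q) (φ : 𝓢(Sp d, ℂ)) :
    ∃ C : ℝ≥0∞, C < ∞ ∧ ∀ w : Sp d → ℂ, AEStronglyMeasurable w volume →
      ∫⁻ x, ‖φ x * w x‖ₑ ≤ C * eLpNorm w q volume := by
  have := ENNReal.HolderConjugate.inv_one_sub_inv' hq
  have := ENNReal.HolderConjugate.symm (p := q) (q := (1 - q⁻¹)⁻¹)
  refine ⟨eLpNorm φ (1 - q⁻¹)⁻¹ volume, φ.eLpNorm_lt_top _ volume, fun w hw => ?_⟩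
  have := eLpNorm_smul_le_mul_eLpNorm (p := (1 - q⁻¹)⁻¹) (q := q) (r := 1) (μ := volume) hw
    (φ.continuous.aestronglyMeasurable)
  simpa [eLpNorm_one_eq_lintegral_enorm, enorm_mul] using this

/-- Fubini's theorem: the transpose of a convolution. -/
theorem integral_mul_cv {ν : Measure (Sp d)} [SFinite ν] {k w : Sp d → ℂ}
    (hki : Integrable k ν) {q : ℝ≥0∞} (hq : 1 ≤ q) (hw : MemLp w q volume) (φ : 𝓢(Sp d, ℂ)) :
    ∫ x, φ x * cv ν k w x = ∫ x, (∫ y, k y * φ (x + y) ∂ν) * w x := by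
  obtain ⟨C, hC, hCb⟩ := exists_lintegral_mul_le hq φ
  have hF : AEStronglyMeasurable (fun z : Sp d × Sp d => φ z.1 * (k z.2 * w (z.1 - z.2)))
      ((volume : Measure (Sp d)).prod ν) :=
    (φ.continuous.aestronglyMeasurable.comp_fst).mul
      (hki.1.comp_snd.mul (hw.1.comp_quasiMeasurePreserving (qmp_sub ν)))
  have hint : Integrable (fun z : Sp d × Sp d => φ z.1 * (k z.2 * w (z.1 - z.2)))
      ((volume : Measure (Sp d)).prod ν) := by
    refine ⟨hF, ?_⟩
    rw [HasFiniteIntegral, lintegral_prod_symm _ hF.enorm]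
    have hb : ∀ y, ∫⁻ x, ‖φ x * (k y * w (x - y))‖ₑ ≤ ‖k y‖ₑ * (C * eLpNorm w q volume) := by
      intro y
      have hmp := measurePreserving_sub_right (volume : Measure (Sp d)) y
      have h1 := hCb (fun x => w (x - y)) (hw.1.comp_measurePreserving hmp)
      rw [show eLpNorm (fun x => w (x - y)) q volume = eLpNorm w q volume from
        eLpNorm_comp_measurePreserving hw.1 hmp] at h1
      calc ∫⁻ x, ‖φ x * (k y * w (x - y))‖ₑ = ∫⁻ x, ‖k y‖ₑ * ‖φ x * w (x - y)‖ₑ := by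
            refine lintegral_congr fun x => ?_
            simp only [enorm_mul]; ring
        _ = ‖k y‖ₑ * ∫⁻ x, ‖φ x * w (x - y)‖ₑ := lintegral_const_mul' _ _ (by simp)
        _ ≤ _ := by gcongr
    refine (lintegral_mono hb).trans_lt ?_
    rw [lintegral_mul_const'' _ hki.1.enorm]
    exact ENNReal.mul_lt_top hki.2 (ENNReal.mul_lt_top hC hw.2)
  calc ∫ x, φ x * cv ν k w x = ∫ x, ∫ y, φ x * (k y * w (x - y)) ∂ν := by
        simp only [cv, integral_const_mul]
    _ = ∫ y, (∫ x, φ x * (k y * w (x - y))) ∂ν := integral_integral_swap hint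
    _ = ∫ y, (∫ x, φ (x + y) * (k y * w x)) ∂ν := by
        refine integral_congr_ae (ae_of_all _ fun y => ?_)
        have := integral_sub_right_eq_self (μ := (volume : Measure (Sp d)))
          (fun x => φ (x + y) * (k y * w x)) y
        simpa using this
    _ = ∫ x, ∫ y, φ (x + y) * (k y * w x) ∂ν := by
        refine (integral_integral_swap ?_).symm
        -- The shear `(x, y) ↦ (x + y, y)` preserves `volume × ν` and carries the integrable
        -- function found above to the one that is needed here.
        have hmp : MeasurePreserving (fun z : Sp d × Sp d => (z.1 + z.2, z.2))
            ((volume : Measure (Sp d)).prod ν) ((volume : Measure (Sp d)).prod ν) := by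
          have := (MeasurePreserving.id ν).skew_product (μc := (volume : Measure (Sp d)))
            (μd := (volume : Measure (Sp d))) (g := fun y x => x + y) (by fun_prop)
            (ae_of_all _ fun y => (measurePreserving_add_right (volume : Measure (Sp d)) y).map_eq)
          have h2 := (Measure.measurePreserving_swap (μ := ν) (ν := (volume : Measure (Sp d)))).comp
            (this.comp (Measure.measurePreserving_swap (μ := (volume : Measure (Sp d))) (ν := ν)))
          exact h2
        have := hmp.integrable_comp_of_integrable hint
        simpa [Function.comp_def, Function.uncurry_def] using this
    _ = ∫ x, (∫ y, k y * φ (x + y) ∂ν) * w x := by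
        refine integral_congr_ae (ae_of_all _ fun x => ?_)
        simp only
        rw [← integral_mul_const]
        refine integral_congr_ae (ae_of_all _ fun y => ?_)
        simp only; ring

/-! ### Bernstein inequalities for convolutions -/

/-- Pointwise `|f|^r ≤ |f|^q ‖f‖_∞^(r-q)`, integrated. -/
theorem eLpNorm_le_interpolate {f : Sp d → ℂ} (hf : AEStronglyMeasurable f volume) {q r : ℝ≥0∞} (hq : 1 ≤ q) (hqr : q ≤ r)
    {A B : ℝ≥0∞} (hA : eLpNorm f q volume ≤ A) (hB : eLpNorm f ∞ volume ≤ B) :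
    eLpNorm f r volume ≤ A ^ (q.toReal / r.toReal) * B ^ (1 - q.toReal / r.toReal) := by
  rcases eq_or_ne r ∞ with rfl | hrt
  · simpa using hB
  have hqt : q ≠ ∞ := ne_top_of_le_ne_top hrt hqr
  have hq0 : q ≠ 0 := by rintro rfl; simp at hq
  have hr0 : r ≠ 0 := by rintro rfl; simp at hqr; exact hq0 hqr
  have hqp : 0 < q.toReal := ENNReal.toReal_pos hq0 hqt
  have hrp : 0 < r.toReal := ENNReal.toReal_pos hr0 hrt
  have hle : q.toReal ≤ r.toReal := (ENNReal.toReal_le_toReal hqt hrt).2 hqr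
  refine le_trans ?_ (mul_le_mul' (ENNReal.rpow_le_rpow hA (by positivity))
    (ENNReal.rpow_le_rpow hB (by rw [sub_nonneg]; exact (div_le_one hrp).2 hle)))
  rw [eLpNorm_eq_eLpNorm' hr0 hrt, eLpNorm_eq_eLpNorm' hq0 hqt]
  simp only [eLpNorm', eLpNorm_exponent_top, one_div]
  set M := eLpNormEssSup f volume
  have h1 : ∫⁻ x, ‖f x‖ₑ ^ r.toReal ≤
      (∫⁻ x, ‖f x‖ₑ ^ q.toReal) * M ^ (r.toReal - q.toReal) := by
    rw [← lintegral_mul_const'' _ (hf.enorm.pow_const _)]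
    refine lintegral_mono_ae ?_
    filter_upwards [ae_le_eLpNormEssSup (f := f) (μ := volume)] with x hx
    calc ‖f x‖ₑ ^ r.toReal = ‖f x‖ₑ ^ q.toReal * ‖f x‖ₑ ^ (r.toReal - q.toReal) := by
          rw [← ENNReal.rpow_add_of_nonneg _ _ hqp.le (sub_nonneg.2 hle), add_sub_cancel]
      _ ≤ _ := by gcongr
  calc (∫⁻ x, ‖f x‖ₑ ^ r.toReal) ^ r.toReal⁻¹
      ≤ ((∫⁻ x, ‖f x‖ₑ ^ q.toReal) * M ^ (r.toReal - q.toReal)) ^ r.toReal⁻¹ := by gcongr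
    _ = _ := by
      rw [ENNReal.mul_rpow_of_nonneg _ _ (by positivity), ← ENNReal.rpow_mul,
        ← ENNReal.rpow_mul]
      congr 2
      · field_simp
      · field_simp

/-- Jensen for `|k| dy` leaves one factor `|k|` under the integral, and this factor is bounded by
`M`. -/
theorem eLpNorm_top_cv_le {k w : Sp d → ℂ} (hk : Measurable k)
    (hw : AEStronglyMeasurable w volume) {q : ℝ≥0∞} (hq : 1 ≤ q) {M : ℝ≥0∞}
    (hM : ∀ y, ‖k y‖ₑ ≤ M) :
    eLpNorm (cv volume k w) ∞ volume ≤
      (∫⁻ y, ‖k y‖ₑ) ^ (1 - 1 / q.toReal) * M ^ (1 / q.toReal) * eLpNorm w q volume := by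
  rcases eq_or_ne q ∞ with rfl | hqt
  · simpa using eLpNorm_cv_le hk hw le_top
  wlog hwm : Measurable w generalizing w
  · rw [eLpNorm_congr_ae (cv_congr_ae hw.ae_eq_mk), eLpNorm_congr_ae hw.ae_eq_mk]
    exact this hw.stronglyMeasurable_mk.aestronglyMeasurable hw.stronglyMeasurable_mk.measurable
  set r := q.toReal with hr
  have hr1 : 1 ≤ r := by
    rw [hr, ← ENNReal.toReal_one]; exact (ENNReal.toReal_le_toReal (by simp) hqt).2 hq
  have hr0 : 0 < r := by linarith
  have hq0 : q ≠ 0 := by rintro rfl; simp at hq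
  rw [eLpNorm_exponent_top]
  refine essSup_le_of_ae_le _ (ae_of_all _ fun x => ?_)
  have h1 := enorm_cv_rpow_le (ν := volume) hk hwm hr1 x
  have h2 : ∫⁻ y, ‖k y‖ₑ * ‖w (x - y)‖ₑ ^ r ≤ M * ∫⁻ y, ‖w y‖ₑ ^ r := by
    rw [← lintegral_sub_left_eq_self (fun y => ‖w y‖ₑ ^ r) x,
      ← lintegral_const_mul _ (by fun_prop)]
    exact lintegral_mono fun y => by gcongr; exact hM y
  have h3 := ENNReal.rpow_le_rpow (h1.trans (mul_le_mul_right h2 _)) (inv_nonneg.2 hr0.le)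
  rw [← ENNReal.rpow_mul, mul_inv_cancel₀ hr0.ne', ENNReal.rpow_one,
    ENNReal.mul_rpow_of_nonneg _ _ (inv_nonneg.2 hr0.le),
    ENNReal.mul_rpow_of_nonneg _ _ (inv_nonneg.2 hr0.le), ← ENNReal.rpow_mul] at h3
  refine h3.trans (le_of_eq ?_)
  rw [eLpNorm_eq_eLpNorm' hq0 hqt, ← hr, eLpNorm', one_div, mul_assoc]
  congr 2
  field_simp

/-- Bernstein's inequality: convolution with a kernel of `L^1` norm `≤ C` and `L^∞` norm
`≤ C S`, where `S` is the `d`-th power of the frequency scale. -/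
theorem bernstein {k w : Sp d → ℂ} (hk : Measurable k) {C S : ℝ≥0∞}
    (h1 : ∫⁻ y, ‖k y‖ₑ ≤ C) (hM : ∀ y, ‖k y‖ₑ ≤ C * S)
    (hw : AEStronglyMeasurable w volume) {q r : ℝ≥0∞} (hq : 1 ≤ q) (hqr : q ≤ r) (hC : C < ∞) :
    eLpNorm (cv volume k w) r volume ≤
      C * S ^ (1 / q.toReal - 1 / r.toReal) * eLpNorm w q volume := by
  have hki : Integrable k volume := ⟨hk.aestronglyMeasurable, h1.trans_lt hC⟩
  have hA : eLpNorm (cv volume k w) q volume ≤ C * eLpNorm w q volume :=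
    (eLpNorm_cv_le hk hw hq).trans (by gcongr)
  have hx0 : 0 ≤ 1 / q.toReal := by positivity
  have hx1 : 0 ≤ 1 - 1 / q.toReal := by
    rcases eq_or_ne q ∞ with rfl | hqt
    · simp
    · rw [sub_nonneg, div_le_one (ENNReal.toReal_pos (by rintro rfl; simp at hq) hqt),
        ← ENNReal.toReal_one]
      exact (ENNReal.toReal_le_toReal (by simp) hqt).2 hq
  have hB : eLpNorm (cv volume k w) ∞ volume ≤ C * S ^ (1 / q.toReal) * eLpNorm w q volume := by
    refine (eLpNorm_top_cv_le hk hw hq hM).trans (mul_le_mul_left ?_ _)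
    calc (∫⁻ y, ‖k y‖ₑ) ^ (1 - 1 / q.toReal) * (C * S) ^ (1 / q.toReal)
        ≤ C ^ (1 - 1 / q.toReal) * (C * S) ^ (1 / q.toReal) := by gcongr
      _ = C ^ (1 - 1 / q.toReal) * C ^ (1 / q.toReal) * S ^ (1 / q.toReal) := by
          rw [ENNReal.mul_rpow_of_nonneg _ _ hx0, mul_assoc]
      _ = _ := by
          rw [← ENNReal.rpow_add_of_nonneg _ _ hx1 hx0, sub_add_cancel, ENNReal.rpow_one]
  have h := eLpNorm_le_interpolate (aesm_cv hki.1 hw) hq hqr hA hB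
  have hy0 : 0 ≤ q.toReal / r.toReal := by positivity
  have hy1 : 0 ≤ 1 - q.toReal / r.toReal := by
    rcases eq_or_ne r ∞ with rfl | hrt
    · simp
    · have hqt := ne_top_of_le_ne_top hrt hqr
      rw [sub_nonneg, div_le_one (ENNReal.toReal_pos (by rintro rfl; simp at hqr; simp [hqr] at hq)
        hrt)]
      exact (ENNReal.toReal_le_toReal hqt hrt).2 hqr
  refine h.trans (le_of_eq ?_)
  -- The sup bound carries `S^(1/q)` and enters the interpolation with exponent `1 - q/r`, which
  -- produces the Bernstein exponent `1/q - 1/r`.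
  have hexp : 1 / q.toReal * (1 - q.toReal / r.toReal) = 1 / q.toReal - 1 / r.toReal := by
    rcases eq_or_ne q ∞ with rfl | hqt
    · have : r = ∞ := by simpa using hqr
      simp [this]
    · have := (ENNReal.toReal_pos (a := q) (by rintro rfl; simp at hq) hqt).ne'
      field_simp
  rw [mul_assoc C, mul_comm (S ^ _) (eLpNorm w q volume), ← mul_assoc C,
    ENNReal.mul_rpow_of_nonneg (C * eLpNorm w q volume) _ hy1, ← mul_assoc,
    ← ENNReal.rpow_add_of_nonneg _ _ hy0 hy1, add_sub_cancel, ENNReal.rpow_one,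
    ← ENNReal.rpow_mul, hexp]
  ring

/-! ### The Poisson kernel -/

open ProbabilityTheory in
theorem fourier_exp_neg_abs {γ : ℝ} (hγ : 0 < γ) (y : ℝ) :
    𝓕 (fun x : ℝ => (Real.exp (-(2 * Real.pi * γ) * |x|) : ℂ)) y =
      (cauchyPDFReal 0 ⟨γ, hγ.le⟩ y : ℂ) := by
  have hπ := Real.pi_pos
  rw [Real.fourier_real_eq_integral_exp_smul]
  set a : ℂ := (2 * Real.pi * γ : ℝ) - (2 * Real.pi * y : ℝ) * Complex.I with ha
  set b : ℂ := -(2 * Real.pi * γ : ℝ) - (2 * Real.pi * y : ℝ) * Complex.I with hb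
  have hare : 0 < a.re := by simp [ha]; positivity
  have hbre : b.re < 0 := by simp [hb]; positivity
  have e1 : Set.EqOn (fun v : ℝ => Complex.exp (↑(-2 * Real.pi * v * y) * Complex.I) •
      (Real.exp (-(2 * Real.pi * γ) * |v|) : ℂ)) (fun v => Complex.exp (a * v)) (Set.Iic 0) := by
    intro v hv
    simp only [smul_eq_mul, Complex.ofReal_exp, ← Complex.exp_add, abs_of_nonpos (Set.mem_Iic.1 hv)]
    congr 1
    simp only [ha]; push_cast; ring
  have e2 : Set.EqOn (fun v : ℝ => Complex.exp (↑(-2 * Real.pi * v * y) * Complex.I) •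
      (Real.exp (-(2 * Real.pi * γ) * |v|) : ℂ)) (fun v => Complex.exp (b * v)) (Set.Ioi 0) := by
    intro v hv
    simp only [smul_eq_mul, Complex.ofReal_exp, ← Complex.exp_add, abs_of_pos (Set.mem_Ioi.1 hv)]
    congr 1
    simp only [hb]; push_cast; ring
  rw [← intervalIntegral.integral_Iic_add_Ioi
    ((integrableOn_congr_fun e1 measurableSet_Iic).2 (integrableOn_exp_mul_complex_Iic hare 0))
    ((integrableOn_congr_fun e2 measurableSet_Ioi).2 (integrableOn_exp_mul_complex_Ioi hbre 0)),
    setIntegral_congr_fun measurableSet_Iic e1, setIntegral_congr_fun measurableSet_Ioi e2,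
    integral_exp_mul_complex_Iic hare, integral_exp_mul_complex_Ioi hbre]
  have ha0 : a ≠ 0 := fun h => by simp [h] at hare
  have hb0 : b ≠ 0 := fun h => by simp [h] at hbre
  have hprod : a * b = -((4 * Real.pi ^ 2 * (y ^ 2 + γ ^ 2) : ℝ) : ℂ) := by
    simp only [ha, hb]
    push_cast
    linear_combination (4 * Real.pi ^ 2 * y ^ 2 : ℂ) * Complex.I_sq
  have hsum : b - a = -((4 * Real.pi * γ : ℝ) : ℂ) := by
    simp only [ha, hb]; push_cast; ring
  have hden : (y ^ 2 + γ ^ 2) ≠ 0 := by positivity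
  -- The two half lines contribute `1/a` and `-1/b`; their sum `(b - a)/(ab)` is the Cauchy density.
  calc Complex.exp (a * (0 : ℝ)) / a + -Complex.exp (b * (0 : ℝ)) / b = (b - a) / (a * b) := by
        simp; field_simp; ring
    _ = _ := by
        rw [hsum, hprod, neg_div_neg_eq, ← Complex.ofReal_div]
        congr 1
        simp only [cauchyPDFReal, sub_zero]
        change _ = Real.pi⁻¹ * γ * (y ^ 2 + γ ^ 2)⁻¹
        field_simp

theorem integrable_exp_neg_abs {c : ℝ} (hc : 0 < c) :
    Integrable (fun x : ℝ => (Real.exp (-c * |x|) : ℂ)) := by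
  have h : Integrable (fun x : ℝ => Real.exp (-c * |x|)) := by
    rw [← integrableOn_univ, ← Set.Iic_union_Ioi (a := (0 : ℝ))]
    refine IntegrableOn.union ?_ ?_
    · refine (integrableOn_congr_fun (fun v hv => ?_) measurableSet_Iic).2
        (integrableOn_exp_mul_Iic hc 0)
      simp [abs_of_nonpos (Set.mem_Iic.1 hv)]
    · refine (integrableOn_congr_fun (fun v hv => ?_) measurableSet_Ioi).2
        (integrableOn_exp_mul_Ioi (neg_lt_zero.2 hc) 0)
      simp [abs_of_pos (Set.mem_Ioi.1 hv)]
  exact h.ofReal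

open ProbabilityTheory in
-- Fourier inversion applied to `fourier_exp_neg_abs`; the evenness of the exponential absorbs the
-- sign. For `γ = 0` the measure is a Dirac mass and is treated apart.
theorem integral_cauchyMeasure (γ : NNReal) (ξ : ℝ) :
    ∫ y, (Real.fourierChar (-(y * ξ)) : ℂ) ∂(cauchyMeasure 0 γ) =
      (Real.exp (-(2 * Real.pi * γ) * |ξ|) : ℂ) := by
  rcases eq_or_ne γ 0 with rfl | hγ
  · simp
  have hγ' : 0 < (γ : ℝ) := by positivity
  set f : ℝ → ℂ := fun x => (Real.exp (-(2 * Real.pi * γ) * |x|) : ℂ) with hf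
  have hF : 𝓕 f = fun y => (cauchyPDFReal 0 γ y : ℂ) := by
    ext y; exact fourier_exp_neg_abs hγ' y
  have hfi : Integrable f := integrable_exp_neg_abs (by positivity)
  have hFi : Integrable (𝓕 f) := by rw [hF]; exact (integrable_cauchyPDFReal 0).ofReal
  have hinv := Continuous.fourierInv_fourier_eq (f := f) (by fun_prop) hfi hFi
  have h2 := congrFun hinv (-ξ)
  rw [Real.fourierInv_eq_fourier_neg, neg_neg, hF, Real.fourier_real_eq] at h2
  rw [cauchyMeasure_of_scale_ne_zero 0 hγ,
    integral_withDensity_eq_integral_toReal_smul (f := cauchyPDF 0 γ) (by fun_prop)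
      (ae_of_all _ fun x => ENNReal.ofReal_lt_top)]
  have : f (-ξ) = f ξ := by simp [hf]
  change _ = f ξ
  rw [← this, ← h2]
  refine integral_congr_ae (ae_of_all _ fun y => ?_)
  simp only [cauchyPDF, ENNReal.toReal_ofReal (cauchyPDF_pos 0 hγ y).le, Circle.smul_def,
    smul_eq_mul, Complex.real_smul]
  ring

/-- The probability measure with Fourier transform `e^{-2π ∑ b_i |ξ_i|}`. -/
def poisson (b : Fin d → NNReal) : Measure (Sp d) :=
  (Measure.pi fun i => ProbabilityTheory.cauchyMeasure 0 (b i)).map (WithLp.toLp 2)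

instance (b : Fin d → NNReal) : IsProbabilityMeasure (poisson b) :=
  Measure.isProbabilityMeasure_map (by fun_prop)

theorem integral_poisson (b : Fin d → NNReal) (ξ : Sp d) :
    ∫ y, (Real.fourierChar (-(inner ℝ y ξ)) : ℂ) ∂(poisson b) =
      (Real.exp (-(2 * Real.pi) * ∑ i, b i * |ξ i|) : ℂ) := by
  rw [poisson, integral_map (by fun_prop)]
  swap
  · apply Continuous.aestronglyMeasurable
    fun_prop
  have : ∀ y : Fin d → ℝ, (Real.fourierChar (-(inner ℝ (WithLp.toLp 2 y) ξ)) : ℂ) =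
      ∏ i, (Real.fourierChar (-(y i * ξ i)) : ℂ) := fun y => by
    rw [PiLp.inner_apply]
    simp only [RCLike.inner_apply, conj_trivial]
    simp only [Real.fourierChar_apply, ← Complex.exp_sum]
    congr 1
    push_cast
    rw [← Finset.sum_mul, ← Finset.mul_sum, Finset.sum_neg_distrib]
    congr 3
    exact Finset.sum_congr rfl fun i _ => by ring
  simp_rw [this]
  rw [integral_fintype_prod_eq_prod (f := fun i (x : ℝ) => (Real.fourierChar (-(x * ξ i)) : ℂ))]
  simp_rw [integral_cauchyMeasure]
  rw [← Complex.ofReal_prod, ← Real.exp_sum]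
  congr 2
  rw [Finset.mul_sum]
  exact Finset.sum_congr rfl fun i _ => by ring

/-! ### Representation of distributions by functions -/

/-- `u` is the `L^q` function `w`. -/
def Rep (q : ℝ≥0∞) (w : Sp d → ℂ) (u : TDist d) : Prop := MemLp w q volume ∧ Represents w u

theorem Represents.congr {w w' : Sp d → ℂ} {u : TDist d} (h : Represents w u)
    (hww : w =ᵐ[volume] w') : Represents w' u := fun φ => by
  rw [h φ]; exact integral_congr_ae (hww.mono fun x hx => by simp only [hx])

theorem Rep.congr {q : ℝ≥0∞} {w w' : Sp d → ℂ} {u : TDist d} (h : Rep q w u)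
    (hww : w =ᵐ[volume] w') : Rep q w' u := ⟨h.1.ae_eq hww, h.2.congr hww⟩

/-- The two exponents may differ. This lets a function known to be in `L²` be identified with one
known to be bounded, through the distribution they both represent. -/
theorem Rep.unique {q q' : ℝ≥0∞} (hq : 1 ≤ q) (hq' : 1 ≤ q') {w w' : Sp d → ℂ} {u : TDist d}
    (h : Rep q w u) (h' : Rep q' w' u) : w =ᵐ[volume] w' := by
  refine ae_eq_of_integral_contDiff_smul_eq (h.1.locallyIntegrable hq)
    (h'.1.locallyIntegrable hq') fun g hg1 hg2 => ?_
  have hg₁ : HasCompactSupport (Complex.ofRealCLM ∘ g) := hg2.comp_left rfl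
  have hg₂ : ContDiff ℝ (⊤ : ℕ∞) (Complex.ofRealCLM ∘ g) := by fun_prop
  have h1 := (h.2 (hg₁.toSchwartzMap hg₂)).symm.trans (h'.2 (hg₁.toSchwartzMap hg₂))
  simpa using h1

theorem rep_toLp {q : ℝ≥0∞} [Fact (1 ≤ q)] (f : Lp (α := Sp d) ℂ q volume) :
    Rep q f (Lp.toTemperedDistribution f) :=
  ⟨Lp.memLp f, fun φ => Lp.toTemperedDistribution_apply f φ⟩

theorem exists_rep {q : ℝ≥0∞} (hq : 1 ≤ q) {w : Sp d → ℂ} (hw : MemLp w q volume) :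
    ∃ u : TDist d, Rep q w u := by
  have : Fact (1 ≤ q) := ⟨hq⟩
  exact ⟨_, (rep_toLp (hw.toLp w)).congr hw.coeFn_toLp⟩

open Classical in
/-- The tempered distribution given by the function `w` (and `0` if there is none). -/
def tdist (w : Sp d → ℂ) : TDist d := if h : ∃ u : TDist d, Represents w u then h.choose else 0

theorem Represents.ext {w : Sp d → ℂ} {u v : TDist d} (hu : Represents w u)
    (hv : Represents w v) : u = v := by
  ext φ; rw [hu, hv]

theorem Represents.tdist_eq {w : Sp d → ℂ} {u : TDist d} (hu : Represents w u) : tdist w = u := by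
  have h : ∃ u : TDist d, Represents w u := ⟨u, hu⟩
  rw [tdist, dif_pos h]
  exact h.choose_spec.ext hu

theorem rep_tdist {q : ℝ≥0∞} (hq : 1 ≤ q) {w : Sp d → ℂ} (hw : MemLp w q volume) :
    Rep q w (tdist w) := by
  obtain ⟨u, hu⟩ := exists_rep hq hw
  rwa [hu.2.tdist_eq]

theorem tdist_congr {w w' : Sp d → ℂ} (h : w =ᵐ[volume] w') : tdist w = tdist w' := by
  by_cases h1 : ∃ u : TDist d, Represents w u
  · obtain ⟨u, hu⟩ := h1
    rw [hu.tdist_eq, (hu.congr h).tdist_eq]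
  · have h2 : ¬ ∃ u : TDist d, Represents w' u := fun ⟨u, hu⟩ => h1 ⟨u, hu.congr h.symm⟩
    rw [tdist, tdist, dif_neg h1, dif_neg h2]

theorem tdist_apply {q : ℝ≥0∞} (hq : 1 ≤ q) {w : Sp d → ℂ} (hw : MemLp w q volume)
    (φ : 𝓢(Sp d, ℂ)) : tdist w φ = ∫ x, φ x * w x := by
  exact (rep_tdist hq hw).2 φ

theorem tdist_coe {q : ℝ≥0∞} [Fact (1 ≤ q)] (f : Lp (α := Sp d) ℂ q volume) :
    tdist f = Lp.toTemperedDistribution f := (rep_toLp f).2.tdist_eq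

theorem tdist_add {q q' : ℝ≥0∞} (hq : 1 ≤ q) (hq' : 1 ≤ q') {w w' : Sp d → ℂ}
    (hw : MemLp w q volume) (hw' : MemLp w' q' volume) :
    tdist (w + w') = tdist w + tdist w' := by
  refine Represents.tdist_eq fun φ => ?_
  rw [_root_.add_apply, tdist_apply hq hw, tdist_apply hq' hw', ← integral_add (integrable_mul_of_memLp hq φ hw)
    (integrable_mul_of_memLp hq' φ hw')]
  simp [mul_add]

theorem tdist_sub {q q' : ℝ≥0∞} (hq : 1 ≤ q) (hq' : 1 ≤ q') {w w' : Sp d → ℂ}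
    (hw : MemLp w q volume) (hw' : MemLp w' q' volume) :
    tdist (w - w') = tdist w - tdist w' := by
  refine Represents.tdist_eq fun φ => ?_
  rw [_root_.sub_apply, tdist_apply hq hw, tdist_apply hq' hw', ← integral_sub (integrable_mul_of_memLp hq φ hw)
    (integrable_mul_of_memLp hq' φ hw')]
  simp [mul_sub]

theorem tdist_zero : tdist (0 : Sp d → ℂ) = 0 := Represents.tdist_eq fun φ => by simp

theorem tdist_sum {ι : Type*} (s : Finset ι) {q : ℝ≥0∞} (hq : 1 ≤ q) {w : ι → Sp d → ℂ}
    (hw : ∀ i ∈ s, MemLp (w i) q volume) :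
    tdist (∑ i ∈ s, w i) = ∑ i ∈ s, tdist (w i) := by
  classical
  induction s using Finset.induction_on with
  | empty => simp [tdist_zero]
  | insert a s ha ih =>
    rw [Finset.sum_insert ha, Finset.sum_insert ha, tdist_add hq hq (hw a (by simp))
      (memLp_finsetSum' s fun i hi => hw i (by simp [hi])), ih fun i hi => hw i (by simp [hi])]

theorem tendsto_tdist {q : ℝ≥0∞} (hq : 1 ≤ q) {ι : Type*} {l : Filter ι} {w : ι → Sp d → ℂ}
    {w₀ : Sp d → ℂ} (hw : ∀ i, MemLp (w i) q volume) (hw₀ : MemLp w₀ q volume)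
    (h : Tendsto (fun i => eLpNorm (w i - w₀) q volume) l (𝓝 0)) :
    Tendsto (fun i => tdist (w i)) l (𝓝 (tdist w₀)) := by
  have : Fact (1 ≤ q) := ⟨hq⟩
  have h1 : Tendsto (fun i => (hw i).toLp (w i)) l (𝓝 (hw₀.toLp w₀)) := by
    rw [Lp.tendsto_Lp_iff_tendsto_eLpNorm'']
    exact h
  have h2 := ((Lp.toTemperedDistributionCLM ℂ (volume : Measure (Sp d)) q).continuous.tendsto
    (hw₀.toLp w₀)).comp h1
  have h3 : ∀ {f : Sp d → ℂ} (hf : MemLp f q volume), tdist f =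
      Lp.toTemperedDistributionCLM ℂ (volume : Measure (Sp d)) q (hf.toLp f) := fun hf => by
    rw [Lp.toTemperedDistributionCLM_apply, ← tdist_coe]
    exact tdist_congr hf.coeFn_toLp.symm
  rw [h3 hw₀]
  exact h2.congr fun i => (h3 (hw i)).symm

theorem distLpNorm_le {q : ℝ≥0∞} {w : Sp d → ℂ} {u : TDist d} (h : Rep q w u) :
    distLpNorm q u ≤ eLpNorm w q volume := iInf₂_le w h

theorem distLpNorm_eq {q : ℝ≥0∞} (hq : 1 ≤ q) {w : Sp d → ℂ} {u : TDist d} (h : Rep q w u) :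
    distLpNorm q u = eLpNorm w q volume := by
  refine le_antisymm (distLpNorm_le h) (le_iInf₂ fun w' h' => ?_)
  rw [eLpNorm_congr_ae (Rep.unique hq hq h h')]

theorem exists_rep_of_distLpNorm_lt {q : ℝ≥0∞} {u : TDist d} (h : distLpNorm q u < ∞) :
    ∃ w, Rep q w u := by
  simp only [distLpNorm, iInf_lt_iff] at h
  obtain ⟨w, hw, -⟩ := h
  exact ⟨w, hw⟩

theorem bddFun_ae_eq {w : Sp d → ℂ} {u : TDist d} (h : Rep ∞ w u) : bddFun u =ᵐ[volume] w := by
  have h1 : ∃ w : Sp d → ℂ, MemLp w ∞ volume ∧ Represents w u := ⟨w, h⟩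
  rw [bddFun, dif_pos h1]
  exact Rep.unique le_top le_top h1.choose_spec h

/-- Removes the choice hidden in `bddFun`: any bounded representatives compute the product. -/
theorem mulBdd_eq {w w' : Sp d → ℂ} {u u' : TDist d} (h : Rep ∞ w u) (h' : Rep ∞ w' u') :
    mulBdd u u' = tdist (w * w') := by
  rw [mulBdd, ← tdist_coe]
  refine tdist_congr ((MemLp.coeFn_toLp _).trans ?_)
  filter_upwards [bddFun_ae_eq h, bddFun_ae_eq h'] with x h1 h2
  simp [h1, h2]

/-! ### Fourier multipliers given by complex measures -/

/-- `m` is the Fourier transform of the complex measure `k ν`. -/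
structure IsKer (ν : Measure (Sp d)) (k m : Sp d → ℂ) : Prop where
  meas : Measurable k
  int : Integrable k ν
  eq : ∀ ξ, m ξ = ∫ y, (Real.fourierChar (-(inner ℝ y ξ)) : ℂ) * k y ∂ν

theorem IsKer.continuous {ν : Measure (Sp d)} {k m : Sp d → ℂ} (h : IsKer ν k m) :
    Continuous m := by
  rw [show m = fun ξ => ∫ y, (Real.fourierChar (-(inner ℝ y ξ)) : ℂ) * k y ∂ν from funext h.eq]
  refine continuous_of_dominated (bound := fun y => ‖k y‖) (fun ξ => ?_) (fun ξ => ?_) h.int.norm ?_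
  · exact (Continuous.aestronglyMeasurable (by fun_prop)).mul h.int.1
  · exact ae_of_all _ fun y => by simp [Circle.norm_coe]
  · exact ae_of_all _ fun y => by fun_prop

theorem IsKer.norm_le {ν : Measure (Sp d)} {k m : Sp d → ℂ} (h : IsKer ν k m) (ξ : Sp d) :
    ‖m ξ‖ ≤ ∫ y, ‖k y‖ ∂ν := by
  rw [h.eq]
  refine (norm_integral_le_integral_norm _).trans (le_of_eq ?_)
  simp [Circle.norm_coe]

theorem IsKer.memLp {ν : Measure (Sp d)} {k m : Sp d → ℂ} (h : IsKer ν k m) :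
    MemLp m ∞ volume :=
  memLp_top_of_bound h.continuous.aestronglyMeasurable _ (ae_of_all _ h.norm_le)

theorem isKer_schwartz (m : 𝓢(Sp d, ℂ)) : IsKer volume (𝓕⁻ m : 𝓢(Sp d, ℂ)) m where
  meas := (𝓕⁻ m : 𝓢(Sp d, ℂ)).continuous.measurable
  int := (𝓕⁻ m : 𝓢(Sp d, ℂ)).integrable
  eq ξ := by
    have : m ξ = 𝓕 (𝓕⁻ m : 𝓢(Sp d, ℂ)) ξ := by simp
    rw [this, SchwartzMap.fourier_coe, Real.fourier_eq]
    simp [Circle.smul_def]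

/-- The symbol of `e^{-Λ_b}`, with `Λ_b = ∑ b_i |D_i|`. -/
def esym (b : Fin d → NNReal) (ξ : Sp d) : ℂ := (Real.exp (-(2 * Real.pi) * ∑ i, b i * |ξ i|) : ℝ)

theorem isKer_poisson (b : Fin d → NNReal) : IsKer (poisson b) (fun _ => 1) (esym b) where
  meas := measurable_const
  int := integrable_const 1
  eq ξ := by simp only [mul_one]; exact (integral_poisson b ξ).symm

/-- Fubini: multiplication by `m` is an average of modulations against `k ν`, and a modulation on
the Fourier side is a translation of `φ`. -/
theorem IsKer.transpose {ν : Measure (Sp d)} [SFinite ν] {k m : Sp d → ℂ} (h : IsKer ν k m)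
    (φ : 𝓢(Sp d, ℂ)) (x : Sp d) :
    𝓕 (fun ξ => m ξ * (𝓕⁻ φ : 𝓢(Sp d, ℂ)) ξ) x = ∫ y, k y * φ (x + y) ∂ν := by
  have hφ : ∀ z, φ z = ∫ ξ, (Real.fourierChar (-(inner ℝ ξ z)) : ℂ) * (𝓕⁻ φ : 𝓢(Sp d, ℂ)) ξ :=
    fun z => by
      have : φ z = 𝓕 (𝓕⁻ φ : 𝓢(Sp d, ℂ)) z := by simp
      rw [this, SchwartzMap.fourier_coe, Real.fourier_eq]
      simp [Circle.smul_def]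
  rw [Real.fourier_eq]
  simp_rw [Circle.smul_def, smul_eq_mul, hφ (_ + _), h.eq, ← integral_mul_const,
    ← integral_const_mul]
  rw [integral_integral_swap]
  · refine integral_congr_ae (ae_of_all _ fun y => integral_congr_ae (ae_of_all _ fun ξ => ?_))
    simp only
    rw [inner_add_right, neg_add, AddChar.map_add_eq_mul, Circle.coe_mul, real_inner_comm ξ y]
    ring
  · have h1 := ((𝓕⁻ φ : 𝓢(Sp d, ℂ)).integrable (μ := volume)).mul_prod h.int
    have h2 : Integrable (fun z : Sp d × Sp d => ((Real.fourierChar (-(inner ℝ z.1 x)) : ℂ) *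
        (Real.fourierChar (-(inner ℝ z.2 z.1)) : ℂ)) * ((𝓕⁻ φ : 𝓢(Sp d, ℂ)) z.1 * k z.2))
        (volume.prod ν) := by
      refine h1.bdd_mul (c := 1) (Continuous.aestronglyMeasurable (by fun_prop))
        (ae_of_all _ fun z => by simp [Circle.norm_coe])
    refine h2.congr (ae_of_all _ fun z => ?_)
    simp only [Function.uncurry]
    ring

/-- A Fourier multiplier acts on `L^q` functions by convolution. -/
theorem IsKer.represents {ν : Measure (Sp d)} [SFinite ν] {k m : Sp d → ℂ} (h : IsKer ν k m)
    (hm : m.HasTemperateGrowth) {q : ℝ≥0∞} (hq : 1 ≤ q) {w : Sp d → ℂ} {u : TDist d}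
    (hw : Rep q w u) :
    Rep q (cv ν k w) (TemperedDistribution.fourierMultiplierCLM ℂ m u) := by
  refine ⟨MemLp.cv h.meas h.int hq hw.1, fun φ => ?_⟩
  rw [TemperedDistribution.fourierMultiplierCLM_apply_apply, hw.2]
  simp only [smul_eq_mul]
  rw [integral_mul_cv h.int hq hw.1]
  refine integral_congr_ae (ae_of_all _ fun x => ?_)
  simp only
  rw [← h.transpose φ x, SchwartzMap.fourier_coe]
  congr 2
  refine congrFun (congrArg (fun F : Sp d → ℂ => 𝓕 F) (funext fun ξ => ?_)) x
  simp [SchwartzMap.smulLeftCLM_apply_apply hm]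

/-- The operator `e^{-aΛ₁}` acts on bounded functions by convolution with the Poisson kernel. -/
theorem isExpNeg_iff {a : NNReal} {q : ℝ≥0∞} (hq : 1 ≤ q) {w : Sp d → ℂ} (hw : MemLp w q volume)
    (v : TDist d) :
    IsExpNeg a w v ↔ Rep q (cv (poisson fun _ => a) (fun _ => 1) w) v := by
  have h1 : ∀ φ x, expTranspose (d := d) a φ x =
      ∫ y, (fun _ => (1 : ℂ)) y * φ (x + y) ∂(poisson fun _ => a) := fun φ x => by
    rw [← (isKer_poisson fun _ => a).transpose φ x, expTranspose]
    refine congrFun (congrArg (fun F : Sp d → ℂ => 𝓕 F) (funext fun ξ => ?_)) x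
    simp only [expSymbol, esym]
    congr 3
    simp only [PiLp.smul_apply, smul_eq_mul, abs_mul, abs_of_pos Real.two_pi_pos, ← Finset.mul_sum]
    ring
  have h2 : ∀ φ : 𝓢(Sp d, ℂ), ∫ x, expTranspose a φ x * w x =
      ∫ x, φ x * cv (poisson fun _ => a) (fun _ => 1) w x := fun φ => by
    rw [integral_mul_cv (isKer_poisson fun _ => a).int hq hw]
    simp only [h1]
  have h3 := MemLp.cv (isKer_poisson (d := d) fun _ => a).meas (isKer_poisson fun _ => a).int hq hw
  simp only [IsExpNeg, Rep, h3, true_and, Represents, h2, smul_eq_mul]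

/-! ### Fourier multipliers on `L^2` -/

/-- The space `L^2(ℝ^d)`. -/
abbrev L2 (d : ℕ) := Lp (α := Sp d) ℂ 2 volume

open Classical in
/-- Multiplication by the bounded function `m`. -/
def mulOp (m : Sp d → ℂ) : L2 d →L[ℂ] L2 d :=
  if h : MemLp m ∞ volume then
    (ContinuousLinearMap.mul ℂ ℂ).holderL (volume : Measure (Sp d)) ∞ 2 2 (h.toLp m) else 0

/-- The Fourier multiplier with bounded symbol `m` on `L^2`. -/
def fm (m : Sp d → ℂ) : L2 d →L[ℂ] L2 d :=
  FourierTransform.fourierInvCLM ℂ (L2 d) ∘L mulOp m ∘L FourierTransform.fourierCLM ℂ (L2 d)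

theorem coeFn_mulOp {m : Sp d → ℂ} (hm : MemLp m ∞ volume) (b : L2 d) :
    mulOp m b =ᵐ[volume] fun ξ => m ξ * b ξ := by
  rw [mulOp, dif_pos hm, ContinuousLinearMap.holderL_apply_apply]
  filter_upwards [ContinuousLinearMap.coeFn_holder (B := ContinuousLinearMap.mul ℂ ℂ) (r := 2)
    (hm.toLp m) b, hm.coeFn_toLp] with x h1 h2
  rw [h1, h2]; rfl

theorem fourier_fm_eq (m : Sp d → ℂ) (b : L2 d) : 𝓕 (fm m b) = mulOp m (𝓕 b) := by
  simp [fm]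

theorem fourier_fm {m : Sp d → ℂ} (hm : MemLp m ∞ volume) (b : L2 d) :
    (𝓕 (fm m b) : L2 d) =ᵐ[volume] fun ξ => m ξ * (𝓕 b : L2 d) ξ := by
  rw [fourier_fm_eq]; exact coeFn_mulOp hm _

theorem fourier_injective : Function.Injective (fun b : L2 d => (𝓕 b : L2 d)) :=
  fun b b' h => by
    have := congrArg (fun z : L2 d => (𝓕⁻ z : L2 d)) h
    simpa using this

theorem fourier_ext {b b' : L2 d} (h : (𝓕 b : L2 d) =ᵐ[volume] (𝓕 b' : L2 d)) : b = b' :=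
  fourier_injective (Lp.ext h)

theorem memLp_mul_top {m n : Sp d → ℂ} (hm : MemLp m ∞ volume) (hn : MemLp n ∞ volume) :
    MemLp (m * n) ∞ volume := hn.mul hm

theorem fm_fm {m n : Sp d → ℂ} (hm : MemLp m ∞ volume) (hn : MemLp n ∞ volume) (b : L2 d) :
    fm m (fm n b) = fm (m * n) b := by
  refine fourier_ext ?_
  filter_upwards [fourier_fm hm (fm n b), fourier_fm hn b, fourier_fm (memLp_mul_top hm hn) b]
    with ξ h1 h2 h3
  rw [h1, h2, h3, Pi.mul_apply, mul_assoc]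

theorem fm_comm {m n : Sp d → ℂ} (hm : MemLp m ∞ volume) (hn : MemLp n ∞ volume) (b : L2 d) :
    fm m (fm n b) = fm n (fm m b) := by
  rw [fm_fm hm hn, fm_fm hn hm, mul_comm]

theorem fm_sum_symbol {ι : Type*} (s : Finset ι) {m : ι → Sp d → ℂ}
    (hm : ∀ i ∈ s, MemLp (m i) ∞ volume) (b : L2 d) :
    fm (∑ i ∈ s, m i) b = ∑ i ∈ s, fm (m i) b := by
  classical
  induction s using Finset.induction_on with
  | empty =>
    refine fourier_ext ?_
    have h0 : MemLp (0 : Sp d → ℂ) ∞ volume := MemLp.zero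
    simp only [Finset.sum_empty]
    filter_upwards [fourier_fm h0 b, Lp.coeFn_zero ℂ 2 (volume : Measure (Sp d))] with ξ h1 h2
    have h3 : (𝓕 (0 : L2 d) : L2 d) = 0 := (FourierTransform.fourierCLM ℂ (L2 d)).map_zero
    rw [h1, h3, h2]; simp
  | insert a s ha ih =>
    rw [Finset.sum_insert ha, Finset.sum_insert ha, ← ih fun i hi => hm i (by simp [hi])]
    refine fourier_ext ?_
    have hs : MemLp (∑ i ∈ s, m i) ∞ volume := memLp_finsetSum' s fun i hi => hm i (by simp [hi])
    have ha' := hm a (by simp)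
    rw [FourierTransform.fourier_add]
    filter_upwards [fourier_fm (ha'.add hs) b, fourier_fm ha' b, fourier_fm hs b,
      Lp.coeFn_add (𝓕 (fm (m a) b) : L2 d) (𝓕 (fm (∑ i ∈ s, m i) b) : L2 d)] with ξ h1 h2 h3 h4
    rw [h1, h4, Pi.add_apply, Pi.add_apply, h2, h3, add_mul]

theorem fm_one (b : L2 d) : fm (fun _ => 1) b = b := by
  refine fourier_ext ?_
  filter_upwards [fourier_fm (memLp_top_const (1 : ℂ)) b] with ξ h1
  rw [h1, one_mul]

/-- Used for the symbol of `e^{-aΛ₁}`, which never vanishes. Identities that involve the unbounded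
operator `e^{aΛ₁}` on `L²` are proved after applying `e^{-aΛ₁}`. -/
theorem fm_injective {m : Sp d → ℂ} (hm : MemLp m ∞ volume) (h0 : ∀ ξ, m ξ ≠ 0) {b b' : L2 d}
    (h : fm m b = fm m b') : b = b' := by
  refine fourier_ext ?_
  filter_upwards [fourier_fm hm b, fourier_fm hm b'] with ξ h1 h2
  rw [h, h2] at h1
  exact (mul_left_cancel₀ (h0 ξ) h1).symm

theorem norm_fm_le {m : Sp d → ℂ} (hm : MemLp m ∞ volume) {C : ℝ} (hC : ∀ ξ, ‖m ξ‖ ≤ C)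
    (b : L2 d) : ‖fm m b‖ ≤ C * ‖b‖ := by
  rw [← Lp.norm_fourier_eq (fm m b), ← Lp.norm_fourier_eq b]
  refine Lp.norm_le_mul_norm_of_ae_le_mul ?_
  filter_upwards [fourier_fm hm b] with ξ h
  rw [h, norm_mul]
  exact mul_le_mul_of_nonneg_right (hC ξ) (norm_nonneg _)

/-- The Fourier transforms on `L^1` and on `L^2` agree. -/
theorem fourier_toLp {ψ : Sp d → ℂ} (h1 : Integrable ψ volume) (h2 : MemLp ψ 2 volume) :
    (𝓕 (h2.toLp ψ) : L2 d) =ᵐ[volume] 𝓕 ψ := by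
  have hb : MemLp (𝓕 ψ) ∞ volume := by
    have hc : Continuous (𝓕 ψ) :=
      VectorFourier.fourierIntegral_continuous Real.continuous_fourierChar
        (by exact continuous_inner) h1
    exact memLp_top_of_bound hc.aestronglyMeasurable (∫ x, ‖ψ x‖)
      (ae_of_all _ fun ξ => VectorFourier.norm_fourierIntegral_le_integral_norm _ _ _ _ _)
  -- Both functions represent the distributional Fourier transform of `ψ`, the `L^1` one by the
  -- multiplication formula.
  refine Rep.unique (q := 2) (q' := ∞) (by norm_num) le_top
    (rep_toLp (𝓕 (h2.toLp ψ) : L2 d)) ⟨hb, fun φ => ?_⟩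
  rw [← Lp.fourier_toTemperedDistribution_eq, TemperedDistribution.fourier_apply,
    Lp.toTemperedDistribution_apply]
  have := VectorFourier.integral_fourierIntegral_smul_eq_flip (L := innerₗ (Sp d))
    (μ := volume) (ν := volume) (f := φ) (g := ψ) Real.continuous_fourierChar continuous_inner
    φ.integrable h1
  rw [flip_innerₗ] at this
  refine Eq.trans ?_ this
  refine integral_congr_ae (h2.coeFn_toLp.mono fun x hx => ?_)
  simp only [hx]
  rfl

theorem fourierInv_toLp {ψ : Sp d → ℂ} (h1 : Integrable ψ volume) (h2 : MemLp ψ 2 volume) :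
    (𝓕⁻ (h2.toLp ψ) : L2 d) =ᵐ[volume] 𝓕⁻ ψ := by
  have hb : MemLp (𝓕⁻ ψ) ∞ volume := by
    have hc : Continuous (𝓕⁻ ψ) :=
      VectorFourier.fourierIntegral_continuous Real.continuous_fourierChar
        (L := -innerₗ (Sp d)) (by simpa using! continuous_inner.neg) h1
    exact memLp_top_of_bound hc.aestronglyMeasurable (∫ x, ‖ψ x‖)
      (ae_of_all _ fun ξ => VectorFourier.norm_fourierIntegral_le_integral_norm _ _ _ _ _)
  refine Rep.unique (q := 2) (q' := ∞) (by norm_num) le_top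
    (rep_toLp (𝓕⁻ (h2.toLp ψ) : L2 d)) ⟨hb, fun φ => ?_⟩
  rw [← Lp.fourierInv_toTemperedDistribution_eq, TemperedDistribution.fourierInv_apply,
    Lp.toTemperedDistribution_apply]
  have := VectorFourier.integral_fourierIntegral_smul_eq_flip (L := -innerₗ (Sp d))
    (μ := volume) (ν := volume) (f := φ) (g := ψ) Real.continuous_fourierChar
    (by simpa using! continuous_inner.neg) φ.integrable h1
  rw [show (-innerₗ (Sp d)).flip = -innerₗ (Sp d) by ext; simp [real_inner_comm]] at this
  refine Eq.trans ?_ this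
  refine integral_congr_ae (h2.coeFn_toLp.mono fun x hx => ?_)
  simp only [hx, SchwartzMap.fourierInv_coe]
  rfl

/-- Both sides are continuous in `g`, and for Schwartz `g` the identity is the definition of the
Fourier transform of a distribution. -/
theorem integral_fourier_mul (f g : L2 d) :
    ∫ x, (𝓕 f : L2 d) x * g x = ∫ x, f x * (𝓕 g : L2 d) x := by
  have key : ∀ f g : L2 d, ∫ x, f x * g x =
      (ContinuousLinearMap.mul ℂ ℂ).lpPairing (volume : Measure (Sp d)) 2 2 f g := fun f g => by
    rw [ContinuousLinearMap.lpPairing_eq_integral]; rfl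
  rw [key, key]
  refine DenseRange.induction_on (p := fun g : L2 d =>
    (ContinuousLinearMap.mul ℂ ℂ).lpPairing (volume : Measure (Sp d)) 2 2 (𝓕 f : L2 d) g =
    (ContinuousLinearMap.mul ℂ ℂ).lpPairing (volume : Measure (Sp d)) 2 2 f (𝓕 g : L2 d))
    (SchwartzMap.denseRange_toLpCLM (p := 2) ENNReal.ofNat_ne_top) g ?_ ?_
  · exact isClosed_eq (ContinuousLinearMap.continuous _)
      ((ContinuousLinearMap.continuous _).comp (FourierTransform.fourierCLM ℂ (L2 d)).continuous)
  · intro φ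
    rw [← key, ← key]
    have h1 := congrArg (fun u : TDist d => u φ) (Lp.fourier_toTemperedDistribution_eq f)
    simp only [TemperedDistribution.fourier_apply, Lp.toTemperedDistribution_apply] at h1
    have e1 : (SchwartzMap.toLpCLM ℝ ℂ 2 (volume : Measure (Sp d)) φ : L2 d) = φ.toLp 2 := rfl
    rw [e1, SchwartzMap.toLp_fourier_eq]
    calc ∫ x, (𝓕 f : L2 d) x * (φ.toLp 2 : L2 d) x = ∫ x, φ x • (𝓕 f : L2 d) x := by
          refine integral_congr_ae ?_
          filter_upwards [φ.coeFn_toLp 2 volume] with x hx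
          rw [hx, smul_eq_mul, mul_comm]
      _ = ∫ x, (𝓕 φ : 𝓢(Sp d, ℂ)) x • f x := h1.symm
      _ = ∫ x, f x * ((𝓕 φ : 𝓢(Sp d, ℂ)).toLp 2 : L2 d) x := by
          refine integral_congr_ae ?_
          filter_upwards [(𝓕 φ : 𝓢(Sp d, ℂ)).coeFn_toLp 2 volume] with x hx
          rw [hx, smul_eq_mul, mul_comm]

theorem integral_mul_fm {m : Sp d → ℂ} (hm : MemLp m ∞ volume) (b : L2 d) (φ : 𝓢(Sp d, ℂ)) :
    ∫ x, φ x * fm m b x = ∫ ξ, m ξ * (𝓕⁻ φ : 𝓢(Sp d, ℂ)) ξ * (𝓕 b : L2 d) ξ := by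
  have h1 := integral_fourier_mul ((𝓕⁻ φ : 𝓢(Sp d, ℂ)).toLp 2) (fm m b)
  rw [SchwartzMap.toLp_fourier_eq, FourierTransform.fourier_fourierInv_eq] at h1
  calc ∫ x, φ x * fm m b x = ∫ x, (φ.toLp 2 : L2 d) x * fm m b x := by
        refine integral_congr_ae ?_
        filter_upwards [φ.coeFn_toLp 2 volume] with x hx
        rw [hx]
    _ = _ := h1
    _ = _ := by
        refine integral_congr_ae ?_
        filter_upwards [(𝓕⁻ φ : 𝓢(Sp d, ℂ)).coeFn_toLp 2 volume, fourier_fm hm b] with x hx hx'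
        rw [hx, hx']; ring

/-- Ties the multiplier defined through Plancherel to the convolution that makes sense on every
`L^q`: the two have the same pairing with each Schwartz function. -/
theorem fm_eq_cv {ν : Measure (Sp d)} [SFinite ν] {k m : Sp d → ℂ} (h : IsKer ν k m) (b : L2 d) :
    fm m b =ᵐ[volume] cv ν k b := by
  have hm := h.memLp
  have hcv : MemLp (cv ν k b) 2 volume := MemLp.cv h.meas h.int (by norm_num) (Lp.memLp b)
  refine Rep.unique (q := 2) (q' := 2) (by norm_num) (by norm_num)
    (rep_toLp (fm m b)) ⟨hcv, fun φ => ?_⟩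
  rw [Lp.toTemperedDistribution_apply]
  simp only [smul_eq_mul]
  rw [integral_mul_fm hm, integral_mul_cv h.int (q := 2) (by norm_num) (Lp.memLp b)]
  simp_rw [← h.transpose φ]
  have h1 : Integrable (fun ξ => m ξ * (𝓕⁻ φ : 𝓢(Sp d, ℂ)) ξ) volume :=
    (𝓕⁻ φ : 𝓢(Sp d, ℂ)).integrable.bdd_mul h.continuous.aestronglyMeasurable
      (ae_of_all _ h.norm_le)
  have h2 : MemLp (fun ξ => m ξ * (𝓕⁻ φ : 𝓢(Sp d, ℂ)) ξ) 2 volume :=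
    ((𝓕⁻ φ : 𝓢(Sp d, ℂ)).memLp 2 volume).mul hm
  calc ∫ ξ, m ξ * (𝓕⁻ φ : 𝓢(Sp d, ℂ)) ξ * (𝓕 b : L2 d) ξ
      = ∫ ξ, (h2.toLp _ : L2 d) ξ * (𝓕 b : L2 d) ξ :=
        integral_congr_ae (h2.coeFn_toLp.mono fun x hx => by simp only [hx])
    _ = ∫ x, (𝓕 (h2.toLp _ : L2 d) : L2 d) x * b x := (integral_fourier_mul _ _).symm
    _ = _ := integral_congr_ae ((fourier_toLp h1 h2).mono fun x hx => by simp only [hx])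

theorem fourierMultiplierCLM_coe {m : Sp d → ℂ} (hm : MemLp m ∞ volume)
    (ht : m.HasTemperateGrowth) (b : L2 d) :
    TemperedDistribution.fourierMultiplierCLM ℂ m (Lp.toTemperedDistribution b) =
      Lp.toTemperedDistribution (fm m b) := by
  ext φ
  rw [TemperedDistribution.fourierMultiplierCLM_apply_apply, Lp.toTemperedDistribution_apply,
    Lp.toTemperedDistribution_apply]
  simp only [smul_eq_mul]
  rw [integral_mul_fm hm]
  set ψ : 𝓢(Sp d, ℂ) := SchwartzMap.smulLeftCLM ℂ m (𝓕⁻ φ) with hψ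
  have h1 := integral_fourier_mul (ψ.toLp 2) b
  rw [SchwartzMap.toLp_fourier_eq] at h1
  calc ∫ x, (𝓕 ψ : 𝓢(Sp d, ℂ)) x * b x = ∫ x, ((𝓕 ψ : 𝓢(Sp d, ℂ)).toLp 2 : L2 d) x * b x := by
        refine integral_congr_ae ?_
        filter_upwards [(𝓕 ψ : 𝓢(Sp d, ℂ)).coeFn_toLp 2 volume] with x hx
        rw [hx]
    _ = _ := h1
    _ = _ := by
        refine integral_congr_ae ?_
        filter_upwards [ψ.coeFn_toLp 2 volume] with x hx
        rw [hx, hψ, SchwartzMap.smulLeftCLM_apply_apply ht, smul_eq_mul]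

theorem tdist_fm {m : Sp d → ℂ} (hm : MemLp m ∞ volume)
    (ht : m.HasTemperateGrowth) (b : L2 d) :
    TemperedDistribution.fourierMultiplierCLM ℂ m (tdist b) = tdist (fm m b) := by
  rw [tdist_coe, tdist_coe, fourierMultiplierCLM_coe hm ht]

theorem tdist_L2_injective {b b' : L2 d} (h : tdist b = tdist b') : b = b' := by
  rw [tdist_coe, tdist_coe] at h
  exact Lp.ext (Rep.unique (q := 2) (q' := 2) (by norm_num) (by norm_num) (rep_toLp b)
    (h ▸ rep_toLp b'))

/-! ### Estimates in `L^4` -/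

/-- Measurable functions in `L^1 ∩ L^2`. -/
structure IsL12 (g : Sp d → ℂ) : Prop where
  meas : Measurable g
  int : Integrable g volume
  sq : MemLp g 2 volume

theorem eLpNorm_fourierInv {g : Sp d → ℂ} (h1 : Integrable g volume) (h2 : MemLp g 2 volume) :
    eLpNorm (𝓕⁻ g) 2 volume = eLpNorm g 2 volume := by
  rw [← eLpNorm_congr_ae (fourierInv_toLp h1 h2), ← eLpNorm_congr_ae h2.coeFn_toLp]
  have h := Lp.norm_fourier_eq (𝓕⁻ (h2.toLp g) : L2 d)
  rw [FourierTransform.fourier_fourierInv_eq, Lp.norm_def, Lp.norm_def] at h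
  exact ((ENNReal.toReal_eq_toReal_iff' (Lp.memLp _).2.ne (Lp.memLp _).2.ne).1 h).symm

theorem memLp_two_fourierInv {g : Sp d → ℂ} (h1 : Integrable g volume) (h2 : MemLp g 2 volume) :
    MemLp (𝓕⁻ g) 2 volume :=
  (Lp.memLp (𝓕⁻ (h2.toLp g) : L2 d)).ae_eq (fourierInv_toLp h1 h2)

theorem memLp_top_fourierInv {g : Sp d → ℂ} (h1 : Integrable g volume) :
    MemLp (𝓕⁻ g) ∞ volume := by
  have hc : Continuous (𝓕⁻ g) :=
    VectorFourier.fourierIntegral_continuous Real.continuous_fourierChar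
      (L := -innerₗ (Sp d)) (by simpa using! continuous_inner.neg) h1
  exact memLp_top_of_bound hc.aestronglyMeasurable (∫ x, ‖g x‖)
    (ae_of_all _ fun ξ => VectorFourier.norm_fourierIntegral_le_integral_norm _ _ _ _ _)

theorem memLp_of_memLp_of_top {f : Sp d → ℂ} {q r : ℝ≥0∞} (hq : 1 ≤ q) (hqr : q ≤ r)
    (h1 : MemLp f q volume) (h2 : MemLp f ∞ volume) : MemLp f r volume := by
  rcases eq_or_ne r ∞ with rfl | hrt
  · exact h2
  refine ⟨h1.1, (eLpNorm_le_interpolate h1.1 hq hqr le_rfl le_rfl).trans_lt ?_⟩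
  have hqt := ne_top_of_le_ne_top hrt hqr
  refine ENNReal.mul_lt_top (ENNReal.rpow_lt_top_of_nonneg (by positivity) h1.2.ne)
    (ENNReal.rpow_lt_top_of_nonneg ?_ h2.2.ne)
  rw [sub_nonneg]
  refine div_le_one_of_le₀ ((ENNReal.toReal_le_toReal hqt hrt).2 hqr) (by positivity)

theorem fourierInv_cv {g g' : Sp d → ℂ} (h : Integrable g volume) (h' : Integrable g' volume) :
    𝓕⁻ (cv volume g g') = fun x => 𝓕⁻ g x * 𝓕⁻ g' x := by
  ext x
  have h1 := Real.fourier_mul_convolution_eq h h' (-x)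
  rw [Real.fourierInv_eq_fourier_neg, Real.fourierInv_eq_fourier_neg,
    Real.fourierInv_eq_fourier_neg, ← h1]
  rfl

theorem integrable_cv {g g' : Sp d → ℂ} (h : IsL12 g) (h' : IsL12 g') :
    Integrable (cv volume g g') volume :=
  memLp_one_iff_integrable.1 (MemLp.cv h.meas h.int le_rfl (memLp_one_iff_integrable.2 h'.int))

theorem memLp_two_cv {g g' : Sp d → ℂ} (h : IsL12 g) (h' : IsL12 g') :
    MemLp (cv volume g g') 2 volume :=
  MemLp.cv h.meas h.int (by norm_num) h'.sq

/-- The Fourier transform of a product. -/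
theorem eLpNorm_mul_fourierInv {g g' : Sp d → ℂ} (h : IsL12 g) (h' : IsL12 g') :
    eLpNorm (fun x => 𝓕⁻ g x * 𝓕⁻ g' x) 2 volume = eLpNorm (cv volume g g') 2 volume := by
  rw [← fourierInv_cv h.int h'.int]
  exact eLpNorm_fourierInv (integrable_cv h h') (memLp_two_cv h h')

theorem eLpNorm_sq_two (G : Sp d → ℂ) :
    eLpNorm (fun x => G x * G x) 2 volume = eLpNorm G 4 volume ^ 2 := by
  rw [eLpNorm_eq_eLpNorm' (by norm_num) (by norm_num), eLpNorm_eq_eLpNorm' (by norm_num)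
    (by norm_num), eLpNorm', eLpNorm', ← ENNReal.rpow_natCast, ← ENNReal.rpow_mul]
  congr 1
  · refine lintegral_congr fun x => ?_
    rw [enorm_mul, ← pow_two, ← ENNReal.rpow_natCast, ← ENNReal.rpow_mul]
    norm_num
  · norm_num

theorem IsL12.indicator {g : Sp d → ℂ} (h : IsL12 g) {s : Set (Sp d)} (hs : MeasurableSet s) :
    IsL12 (s.indicator g) :=
  ⟨h.meas.indicator hs, h.int.indicator hs, h.sq.indicator hs⟩

/-- A nonzero integrand at `y` forces both `y` and `x - y` into `s`, hence `x` as well. -/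
theorem cv_indicator_eq_zero {g g' : Sp d → ℂ} {s : Set (Sp d)}
    (hs : ∀ x ∈ s, ∀ y ∈ s, x + y ∈ s) {x : Sp d} (hx : x ∉ s) :
    cv volume (s.indicator g) (s.indicator g') x = 0 := by
  rw [cv, ← integral_zero (Sp d) ℂ (μ := volume)]
  congr 1
  ext y
  by_cases hy : y ∈ s
  · have : x - y ∉ s := fun h => hx (by simpa using hs y hy _ h)
    simp [this]
  · simp [hy]

/-- The quadratic inequality gives `a ≤ (1 + √2) b`. Finiteness of `a` is indispensable, since `a =
∞` satisfies the second hypothesis whenever `b ≠ 0`. -/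
theorem ennreal_le_three_mul {a b : ℝ≥0∞} (ha : a ≠ ∞) (h : a ^ 2 ≤ (2 * a + b) * b) :
    a ≤ 3 * b := by
  rcases eq_or_ne b ∞ with rfl | hb
  · simp
  lift a to NNReal using ha
  lift b to NNReal using hb
  norm_cast at h ⊢
  have h' : (a : ℝ) ^ 2 ≤ (2 * a + b) * b := by exact_mod_cast h
  rw [← NNReal.coe_le_coe]
  push_cast
  by_contra! hlt
  nlinarith [a.2, b.2]

/-- M. Riesz's theorem in `L^4`: the projection to a half space of frequencies. -/
theorem eLpNorm_four_indicator_le {g : Sp d → ℂ} (h : IsL12 g) {s : Set (Sp d)}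
    (hsm : MeasurableSet s) (hs : ∀ x ∈ s, ∀ y ∈ s, x + y ∈ s)
    (hs' : ∀ x ∈ sᶜ, ∀ y ∈ sᶜ, x + y ∈ sᶜ) :
    eLpNorm (𝓕⁻ (s.indicator g)) 4 volume ≤ 3 * eLpNorm (𝓕⁻ g) 4 volume := by
  set gp := s.indicator g with hgp
  set gm := sᶜ.indicator g with hgm
  have hp : IsL12 gp := h.indicator hsm
  have hm : IsL12 gm := h.indicator hsm.compl
  set P := 𝓕⁻ gp
  set M := 𝓕⁻ gm
  set G := 𝓕⁻ g
  have hG : G = P + M := by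
    have : g = gp + gm := (Set.indicator_self_add_compl s g).symm
    ext x
    simp only [G, P, M, Pi.add_apply, Real.fourierInv_eq]
    rw [← integral_add, this]
    · simp
    · simpa using (Real.fourierIntegral_convergent_iff (-x)).2 hp.int
    · simpa using (Real.fourierIntegral_convergent_iff (-x)).2 hm.int
  have hP4 : MemLp P 4 volume := memLp_of_memLp_of_top (by norm_num) (by norm_num)
    (memLp_two_fourierInv hp.int hp.sq) (memLp_top_fourierInv hp.int)
  have hG4 : MemLp G 4 volume := memLp_of_memLp_of_top (by norm_num) (by norm_num)
    (memLp_two_fourierInv h.int h.sq) (memLp_top_fourierInv h.int)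
  -- With `G = P + M` one has `(2P - G) G = P² - M²`. The transforms of `P²` and `M²` live on `s`
  -- and on `sᶜ`, both closed under addition, so dropping `M²` does not increase the `L²` norm.
  have key : eLpNorm P 4 volume ^ 2 ≤ eLpNorm (fun x => ((2 : ℂ) • P - G) x * G x) 2 volume := by
    rw [← eLpNorm_sq_two, eLpNorm_mul_fourierInv hp hp]
    have e1 : (fun x => ((2 : ℂ) • P - G) x * G x) = 𝓕⁻ (cv volume gp gp - cv volume gm gm) := by
      ext x
      have : 𝓕⁻ (cv volume gp gp - cv volume gm gm) x =
          𝓕⁻ (cv volume gp gp) x - 𝓕⁻ (cv volume gm gm) x := by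
        simp only [Real.fourierInv_eq]
        rw [← integral_sub]
        · simp [smul_sub]
        · simpa using (Real.fourierIntegral_convergent_iff (-x)).2 (integrable_cv hp hp)
        · simpa using (Real.fourierIntegral_convergent_iff (-x)).2 (integrable_cv hm hm)
      rw [this, fourierInv_cv hp.int hp.int, fourierInv_cv hm.int hm.int, hG]
      simp only [Pi.sub_apply, Pi.smul_apply, Pi.add_apply, smul_eq_mul]
      ring
    rw [e1, eLpNorm_fourierInv ((integrable_cv hp hp).sub (integrable_cv hm hm))
      ((memLp_two_cv hp hp).sub (memLp_two_cv hm hm))]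
    refine eLpNorm_mono fun x => ?_
    by_cases hx : x ∈ s
    · rw [Pi.sub_apply, cv_indicator_eq_zero hs' (by simpa using hx), sub_zero]
    · rw [cv_indicator_eq_zero hs hx]; simp
  refine ennreal_le_three_mul hP4.2.ne (key.trans ?_)
  have : ENNReal.HolderTriple 4 4 2 := ⟨by
    rw [← ENNReal.toReal_eq_toReal_iff' (by simp) (by simp), ENNReal.toReal_add (by simp) (by simp)]
    simp; norm_num⟩
  have h2 := eLpNorm_smul_le_mul_eLpNorm (p := 4) (q := 4) (r := 2) (μ := volume) hG4.1
    ((hP4.const_smul (2 : ℂ)).sub hG4).1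
  refine h2.trans ?_
  gcongr
  refine (eLpNorm_sub_le (hP4.const_smul (2 : ℂ)).1 hG4.1 (by norm_num)).trans ?_
  rw [eLpNorm_const_smul]
  gcongr
  simp [enorm_eq_nnnorm]

/-! ### Damped orthant multipliers -/

/-- The symbol `1_{± t ≥ 0} e^{-c|t|}` of the real line, where `σ` gives the sign. -/
def hsym (σ : Bool) (c t : ℝ) : ℝ := if (0 ≤ t ↔ σ = true) then Real.exp (-c * |t|) else 0

theorem measurable_hsym (σ : Bool) (c : ℝ) : Measurable (hsym σ c) := by
  unfold hsym
  refine Measurable.ite ?_ (by fun_prop) measurable_const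
  cases σ
  · have : {t : ℝ | 0 ≤ t ↔ false = true} = Set.Iio 0 := by ext t; simp
    exact this ▸ measurableSet_Iio
  · have : {t : ℝ | 0 ≤ t ↔ true = true} = Set.Ici 0 := by ext t; simp
    exact this ▸ measurableSet_Ici

theorem hsym_nonneg (σ : Bool) (c t : ℝ) : 0 ≤ hsym σ c t := by
  unfold hsym; split_ifs <;> positivity

theorem hsym_le_one (σ : Bool) {c : ℝ} (hc : 0 ≤ c) (t : ℝ) : hsym σ c t ≤ 1 := by
  unfold hsym; split_ifs
  · exact Real.exp_le_one_iff.2 (by have := mul_nonneg hc (abs_nonneg t); linarith)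
  · exact zero_le_one

/-- `|s + t| = |s| + |t|` on a half line. The factors with `c = 0` are the indicators that make both
sides vanish unless `s` and `t` lie on the half line selected by `σ`. -/
theorem hsym_mul_hsym (σ : Bool) (c s t : ℝ) :
    hsym σ c s * hsym σ c t = hsym σ c (s + t) * (hsym σ 0 s * hsym σ 0 t) := by
  unfold hsym
  cases σ
  · by_cases h1 : 0 ≤ s <;> by_cases h2 : 0 ≤ t <;> simp [h1, h2]
    push Not at h1 h2
    rw [if_pos (by linarith), abs_of_neg h1, abs_of_neg h2, abs_of_neg (by linarith), ← Real.exp_add]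
    congr 1; ring
  · by_cases h1 : 0 ≤ s <;> by_cases h2 : 0 ≤ t <;> simp [h1, h2]
    rw [if_pos (by linarith), abs_of_nonneg h1, abs_of_nonneg h2, abs_of_nonneg (by linarith),
      ← Real.exp_add]
    congr 1; ring

/-- The symbol `1_Q e^{-∑ ℓ_i |ξ_i|}`, where the orthant `Q` is given by the signs `σ`. -/
def osym (σ : Fin d → Bool) (ℓ : Fin d → ℝ) (ξ : Sp d) : ℂ := ((∏ i, hsym (σ i) (ℓ i) (ξ i) : ℝ) : ℂ)

theorem measurable_osym (σ : Fin d → Bool) (ℓ : Fin d → ℝ) : Measurable (osym σ ℓ) := by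
  unfold osym
  refine Complex.measurable_ofReal.comp (Finset.measurable_fun_prod _ fun i _ => ?_)
  exact (measurable_hsym (σ i) (ℓ i)).comp (by fun_prop)

theorem norm_osym_le (σ : Fin d → Bool) {ℓ : Fin d → ℝ} (hℓ : ∀ i, 0 ≤ ℓ i) (ξ : Sp d) :
    ‖osym σ ℓ ξ‖ ≤ 1 := by
  rw [osym, Complex.norm_real, Real.norm_eq_abs,
    abs_of_nonneg (Finset.prod_nonneg fun i _ => hsym_nonneg _ _ _)]
  exact Finset.prod_le_one (fun i _ => hsym_nonneg _ _ _) fun i _ => hsym_le_one _ (hℓ i) _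

theorem memLp_osym (σ : Fin d → Bool) {ℓ : Fin d → ℝ} (hℓ : ∀ i, 0 ≤ ℓ i) :
    MemLp (osym σ ℓ) ∞ volume :=
  memLp_top_of_bound (measurable_osym σ ℓ).aestronglyMeasurable 1 (ae_of_all _ (norm_osym_le σ hℓ))

theorem IsL12.mul_bdd {g m : Sp d → ℂ} (h : IsL12 g) (hm : Measurable m) {C : ℝ}
    (hC : ∀ ξ, ‖m ξ‖ ≤ C) : IsL12 (fun ξ => m ξ * g ξ) where
  meas := hm.mul h.meas
  int := h.int.bdd_mul hm.aestronglyMeasurable (ae_of_all _ hC)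
  sq := h.sq.mul (memLp_top_of_bound hm.aestronglyMeasurable C (ae_of_all _ hC))

theorem osym_mul_osym (σ : Fin d → Bool) (ℓ : Fin d → ℝ) (ξ η : Sp d) :
    osym σ ℓ ξ * osym σ ℓ η = osym σ ℓ (ξ + η) * (osym σ 0 ξ * osym σ 0 η) := by
  simp only [osym, ← Complex.ofReal_mul, ← Finset.prod_mul_distrib, PiLp.add_apply,
    hsym_mul_hsym (σ _) (ℓ _), Pi.zero_apply]

/-- An orthant is an intersection of `d` half spaces, each of which costs a factor `3`. -/
theorem eLpNorm_four_orthant_le {g : Sp d → ℂ} (h : IsL12 g) (σ : Fin d → Bool) :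
    eLpNorm (𝓕⁻ (fun ξ => osym σ 0 ξ * g ξ)) 4 volume ≤ 3 ^ d * eLpNorm (𝓕⁻ g) 4 volume := by
  have key : ∀ S : Finset (Fin d),
      IsL12 (fun ξ => ((∏ i ∈ S, hsym (σ i) 0 (ξ i) : ℝ) : ℂ) * g ξ) ∧
      eLpNorm (𝓕⁻ (fun ξ => ((∏ i ∈ S, hsym (σ i) 0 (ξ i) : ℝ) : ℂ) * g ξ)) 4 volume ≤
        3 ^ S.card * eLpNorm (𝓕⁻ g) 4 volume := by
    intro S
    induction S using Finset.induction_on with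
    | empty => simpa using h
    | insert a S ha ih =>
      -- This half space is open or closed according to the sign; it and its complement are both
      -- stable under addition.
      set s : Set (Sp d) := {ξ | 0 ≤ ξ a ↔ σ a = true} with hs
      have hsm : MeasurableSet s := by
        cases h1 : σ a
        · simpa [hs, h1] using measurableSet_lt (by fun_prop : Measurable fun ξ : Sp d => ξ a)
            measurable_const
        · simpa [hs, h1] using measurableSet_le measurable_const
            (by fun_prop : Measurable fun ξ : Sp d => ξ a)
      have e : (fun ξ : Sp d => ((∏ i ∈ insert a S, hsym (σ i) 0 (ξ i) : ℝ) : ℂ) * g ξ) =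
          s.indicator (fun ξ => ((∏ i ∈ S, hsym (σ i) 0 (ξ i) : ℝ) : ℂ) * g ξ) := by
        ext ξ
        rw [Finset.prod_insert ha]
        by_cases hξ : ξ ∈ s
        · have : hsym (σ a) 0 (ξ a) = 1 := by
            have hξ' : 0 ≤ ξ a ↔ σ a = true := hξ
            rw [hsym, if_pos hξ']; simp
          rw [Set.indicator_of_mem hξ, this, one_mul]
        · have : hsym (σ a) 0 (ξ a) = 0 := by
            have hξ' : ¬(0 ≤ ξ a ↔ σ a = true) := hξ
            rw [hsym, if_neg hξ']
          rw [Set.indicator_of_notMem hξ, this]; simp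
      rw [e, Finset.card_insert_of_notMem ha]
      refine ⟨ih.1.indicator hsm, (eLpNorm_four_indicator_le ih.1 hsm ?_ ?_).trans ?_⟩
      · intro x hx y hy
        cases h1 : σ a <;> simp only [hs, h1, Set.mem_ofPred_eq, PiLp.add_apply] at hx hy ⊢ <;>
          simp at hx hy ⊢ <;> linarith
      · intro x hx y hy
        cases h1 : σ a <;> simp only [hs, h1, Set.mem_ofPred_eq, PiLp.add_apply,
          Set.mem_compl_iff] at hx hy ⊢ <;> simp at hx hy ⊢ <;> linarith
      · rw [pow_succ', mul_assoc]
        gcongr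
        exact ih.2
  simpa [osym] using (key Finset.univ).2

/-- The exponential is multiplicative on an orthant, so that Plancherel's theorem for the square
gives the estimate. -/
theorem eLpNorm_four_osym_le {g : Sp d → ℂ} (h : IsL12 g) (σ : Fin d → Bool) {ℓ : Fin d → ℝ}
    (hℓ : ∀ i, 0 ≤ ℓ i) :
    eLpNorm (𝓕⁻ (fun ξ => osym σ ℓ ξ * g ξ)) 4 volume ≤ 3 ^ d * eLpNorm (𝓕⁻ g) 4 volume := by
  refine le_trans ?_ (eLpNorm_four_orthant_le h σ)
  have h1 := h.mul_bdd (measurable_osym σ ℓ) (norm_osym_le σ hℓ)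
  have h0 := h.mul_bdd (measurable_osym σ 0) (norm_osym_le σ fun _ => le_rfl)
  have : eLpNorm (𝓕⁻ (fun ξ => osym σ ℓ ξ * g ξ)) 4 volume ^ 2 ≤
      eLpNorm (𝓕⁻ (fun ξ => osym σ 0 ξ * g ξ)) 4 volume ^ 2 := by
    rw [← eLpNorm_sq_two, ← eLpNorm_sq_two, eLpNorm_mul_fourierInv h1 h1,
      eLpNorm_mul_fourierInv h0 h0]
    refine eLpNorm_mono fun x => ?_
    -- The integrand carries `osym σ ℓ y * osym σ ℓ (x - y)`, out of which `osym σ ℓ x`, of modulus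
    -- at most `1`, can be factored.
    have : cv volume (fun ξ => osym σ ℓ ξ * g ξ) (fun ξ => osym σ ℓ ξ * g ξ) x =
        osym σ ℓ x * cv volume (fun ξ => osym σ 0 ξ * g ξ) (fun ξ => osym σ 0 ξ * g ξ) x := by
      rw [cv, cv, ← integral_const_mul]
      refine integral_congr_ae (ae_of_all _ fun y => ?_)
      have := osym_mul_osym σ ℓ y (x - y)
      rw [add_sub_cancel] at this
      simp only
      linear_combination (g y * g (x - y)) * this
    rw [this, norm_mul]
    exact mul_le_of_le_one_left (norm_nonneg _) (norm_osym_le σ hℓ x)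
  exact (ENNReal.pow_le_pow_left_iff (by norm_num)).1 this

/-! ### Extension of the `L^4` estimate -/

theorem tendsto_mulOp {m : ℕ → Sp d → ℂ} {m₀ : Sp d → ℂ} (hm : ∀ n, MemLp (m n) ∞ volume)
    (hm₀ : MemLp m₀ ∞ volume) {C : ℝ} (hC : ∀ n ξ, ‖m n ξ‖ ≤ C)
    (h : ∀ ξ, Tendsto (fun n => m n ξ) atTop (𝓝 (m₀ ξ))) (g : L2 d) :
    Tendsto (fun n => mulOp (m n) g) atTop (𝓝 (mulOp m₀ g)) := by
  rw [Lp.tendsto_Lp_iff_tendsto_eLpNorm']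
  have e : ∀ n, eLpNorm (mulOp (m n) g - mulOp m₀ g : Sp d → ℂ) 2 volume =
      (∫⁻ ξ, ‖(m n ξ - m₀ ξ) * g ξ‖ₑ ^ (2 : ℝ)) ^ (1 / 2 : ℝ) := fun n => by
    rw [eLpNorm_eq_lintegral_rpow_enorm_toReal (by norm_num) (by norm_num)]
    simp only [ENNReal.toReal_ofNat]
    congr 1
    refine lintegral_congr_ae ?_
    filter_upwards [coeFn_mulOp (hm n) g, coeFn_mulOp hm₀ g] with ξ h1 h2
    rw [Pi.sub_apply, h1, h2, sub_mul]
  simp_rw [e]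
  have h0 : (0 : ℝ≥0∞) = (∫⁻ _ : Sp d, 0) ^ (1 / 2 : ℝ) := by simp
  rw [h0]
  refine (ENNReal.continuous_rpow_const.tendsto _).comp ?_
  have hC' : ∀ ξ, ‖m₀ ξ‖ ≤ C := fun ξ =>
    le_of_tendsto (h ξ).norm (Eventually.of_forall fun n => hC n ξ)
  refine tendsto_lintegral_of_dominated_convergence'
    (fun ξ => ENNReal.ofReal (2 * C) ^ (2 : ℝ) * ‖g ξ‖ₑ ^ (2 : ℝ)) (fun n => ?_) (fun n => ?_) ?_ ?_
  · exact ((((hm n).1.sub hm₀.1).mul (Lp.aestronglyMeasurable g)).enorm).pow_const _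
  · refine ae_of_all _ fun ξ => ?_
    simp only
    rw [← ENNReal.mul_rpow_of_nonneg _ _ (by norm_num), enorm_mul]
    gcongr
    rw [← ofReal_norm]
    refine ENNReal.ofReal_le_ofReal ((norm_sub_le _ _).trans ?_)
    linarith [hC n ξ, hC' ξ]
  · have hCt : ENNReal.ofReal (2 * C) ^ (2 : ℝ) ≠ ∞ :=
      ENNReal.rpow_ne_top_of_nonneg (by norm_num) ENNReal.ofReal_ne_top
    rw [lintegral_const_mul' _ _ hCt]
    refine ENNReal.mul_ne_top hCt ?_
    have := (lintegral_rpow_enorm_lt_top_of_eLpNorm_lt_top (by norm_num) (by norm_num)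
      (Lp.memLp g).2).ne
    simpa using this
  · refine ae_of_all _ fun ξ => ?_
    have h1 : Tendsto (fun n => (m n ξ - m₀ ξ) * g ξ) atTop (𝓝 0) := by
      simpa using ((h ξ).sub_const (m₀ ξ)).mul_const (g ξ)
    have h2 := ((ENNReal.continuous_rpow_const (y := 2)).tendsto _).comp h1.enorm
    rw [enorm_zero, ENNReal.zero_rpow_of_pos (by norm_num)] at h2
    exact h2

theorem tendsto_fm {m : ℕ → Sp d → ℂ} {m₀ : Sp d → ℂ} (hm : ∀ n, MemLp (m n) ∞ volume)
    (hm₀ : MemLp m₀ ∞ volume) {C : ℝ} (hC : ∀ n ξ, ‖m n ξ‖ ≤ C)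
    (h : ∀ ξ, Tendsto (fun n => m n ξ) atTop (𝓝 (m₀ ξ))) (b : L2 d) :
    Tendsto (fun n => fm (m n) b) atTop (𝓝 (fm m₀ b)) :=
  ((FourierTransform.fourierInvCLM ℂ (L2 d)).continuous.tendsto _).comp
    (tendsto_mulOp hm hm₀ hC h (𝓕 b))

/-- Fatou's lemma for sequences that converge in `L^2`. -/
theorem eLpNorm_le_of_tendsto {x : ℕ → L2 d} {x₀ : L2 d} (h : Tendsto x atTop (𝓝 x₀))
    {q : ℝ≥0∞} {C : ℝ≥0∞} (hC : ∀ n, eLpNorm (x n) q volume ≤ C) : eLpNorm x₀ q volume ≤ C := by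
  obtain ⟨ns, -, hns⟩ := (tendstoInMeasure_of_tendsto_Lp h).exists_seq_tendsto_ae
  refine (Lp.eLpNorm_lim_le_liminf_eLpNorm (fun n => Lp.aestronglyMeasurable (x (ns n))) _
    hns).trans ?_
  refine liminf_le_of_frequently_le' (Frequently.of_forall fun n => hC (ns n))

theorem measurable_esym (b : Fin d → NNReal) : Measurable (esym b) :=
  (isKer_poisson b).continuous.measurable

theorem norm_esym_le (b : Fin d → NNReal) (ξ : Sp d) : ‖esym b ξ‖ ≤ 1 := by
  simpa using (isKer_poisson b).norm_le ξ

theorem esym_ne_zero (b : Fin d → NNReal) (ξ : Sp d) : esym b ξ ≠ 0 := by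
  rw [esym]; exact_mod_cast (Real.exp_pos _).ne'

theorem memLp_esym (b : Fin d → NNReal) : MemLp (esym b) ∞ volume := (isKer_poisson b).memLp

theorem integrable_esym {b : Fin d → NNReal} (hb : ∀ i, 0 < b i) : Integrable (esym b) volume := by
  have h1 : Integrable (fun x : Fin d → ℝ =>
      ∏ i, (Real.exp (-(2 * Real.pi * b i) * |x i|) : ℂ)) volume :=
    Integrable.fintype_prod (f := fun i (t : ℝ) => (Real.exp (-(2 * Real.pi * b i) * |t|) : ℂ))
      fun i => integrable_exp_neg_abs (by have := hb i; positivity)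
  have h2 := (EuclideanSpace.volume_preserving_symm_measurableEquiv_toLp
    (Fin d)).symm.integrable_comp_emb (MeasurableEquiv.measurableEmbedding _)
    (g := esym b)
  refine h2.1 (h1.congr (ae_of_all _ fun x => ?_))
  simp only [Function.comp, esym]
  rw [Finset.mul_sum, Real.exp_sum, Complex.ofReal_prod]
  refine Finset.prod_congr rfl fun i _ => ?_
  congr 2
  simp
  ring

/-- Every `L^2` function is the limit of functions with Fourier transform in `L^1`. -/
theorem exists_approx (b : L2 d) : ∃ x : ℕ → L2 d, Tendsto x atTop (𝓝 b) ∧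
    (∀ n q, 1 ≤ q → eLpNorm (x n) q volume ≤ eLpNorm b q volume) ∧
    ∀ n, ∃ g, IsL12 g ∧ (𝓕 (x n) : L2 d) =ᵐ[volume] g := by
  -- The regularization is `e^{-Λ_b}` with all `b_i = 1/(n+1)`: its symbol is integrable and tends
  -- to `1`, and its kernel is a probability measure, hence a contraction on each `L^q`.
  set ε : ℕ → Fin d → NNReal := fun n _ => 1 / ((n : NNReal) + 1) with hε
  refine ⟨fun n => fm (esym (ε n)) b, ?_, fun n q hq => ?_, fun n => ?_⟩
  · have := tendsto_fm (m := fun n => esym (ε n)) (m₀ := fun _ => 1) (fun n => memLp_esym _)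
      (memLp_top_const 1) (C := 1) (fun n ξ => norm_esym_le _ ξ) (fun ξ => ?_) b
    · rwa [fm_one] at this
    · have h1 : Tendsto (fun n : ℕ => ∑ i : Fin d, (1 / ((n : ℝ) + 1)) * |ξ i|) atTop (𝓝 0) := by
        rw [← Finset.sum_const_zero (s := (Finset.univ : Finset (Fin d))) (M := ℝ)]
        refine tendsto_finsetSum _ fun i _ => ?_
        simpa using tendsto_one_div_add_atTop_nhds_zero_nat.mul_const |ξ i|
      have h2 := (Complex.continuous_ofReal.tendsto _).comp ((Real.continuous_exp.tendsto _).comp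
        (h1.const_mul (-(2 * Real.pi))))
      simpa [esym, hε, Function.comp_def] using h2
  · rw [eLpNorm_congr_ae (fm_eq_cv (isKer_poisson (ε n)) b)]
    refine (eLpNorm_cv_le measurable_const (Lp.aestronglyMeasurable b) hq).trans (by simp)
  · have hg := (Lp.aestronglyMeasurable (𝓕 b : L2 d))
    have hε0 : ∀ i, 0 < ε n i := fun i => by simp only [hε]; positivity
    have hi := integrable_esym hε0
    have h2 : MemLp (esym (ε n)) 2 volume :=
      memLp_of_memLp_of_top (q := 1) le_rfl (by norm_num) (memLp_one_iff_integrable.2 hi)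
        (memLp_esym _)
    have hgm : MemLp (hg.mk _) 2 volume := (Lp.memLp (𝓕 b : L2 d)).ae_eq hg.ae_eq_mk
    refine ⟨fun ξ => esym (ε n) ξ * hg.mk _ ξ, ⟨?_, ?_, ?_⟩, ?_⟩
    · exact (measurable_esym _).mul hg.stronglyMeasurable_mk.measurable
    · exact MemLp.integrable_mul h2 hgm
    · exact hgm.mul (memLp_esym _)
    · filter_upwards [fourier_fm (memLp_esym (ε n)) b, hg.ae_eq_mk] with ξ h1 h3
      rw [h1, h3]

theorem eq_fourierInv_of {b : L2 d} {g : Sp d → ℂ} (hg : IsL12 g)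
    (h : (𝓕 b : L2 d) =ᵐ[volume] g) : b =ᵐ[volume] 𝓕⁻ g := by
  have h1 : b = 𝓕⁻ (hg.sq.toLp g) := by
    refine fourier_ext ?_
    rw [FourierTransform.fourier_fourierInv_eq]
    exact h.trans hg.sq.coeFn_toLp.symm
  conv_lhs => rw [h1]
  exact fourierInv_toLp hg.int hg.sq

/-- The bound is known when the Fourier transform is integrable; regularization and Fatou's lemma
carry it to all of `L²`. -/
theorem eLpNorm_four_fm_osym_le (σ : Fin d → Bool) {ℓ : Fin d → ℝ} (hℓ : ∀ i, 0 ≤ ℓ i) (b : L2 d) :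
    eLpNorm (fm (osym σ ℓ) b) 4 volume ≤ 3 ^ d * eLpNorm b 4 volume := by
  obtain ⟨x, hx, hxq, hg⟩ := exists_approx b
  refine eLpNorm_le_of_tendsto (((fm (osym σ ℓ)).continuous.tendsto b).comp hx) fun n => ?_
  obtain ⟨g, hg, hgx⟩ := hg n
  have hg' := hg.mul_bdd (measurable_osym σ ℓ) (norm_osym_le σ hℓ)
  have h1 : (𝓕 (fm (osym σ ℓ) (x n)) : L2 d) =ᵐ[volume] fun ξ => osym σ ℓ ξ * g ξ := by
    filter_upwards [fourier_fm (memLp_osym σ hℓ) (x n), hgx] with ξ h1 h2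
    rw [h1, h2]
  simp only [Function.comp]
  rw [eLpNorm_congr_ae (eq_fourierInv_of hg' h1)]
  refine (eLpNorm_four_osym_le hg σ hℓ).trans ?_
  rw [← eLpNorm_congr_ae (eq_fourierInv_of hg hgx)]
  gcongr
  exact hxq n 4 (by norm_num)

/-! ### Interpolation between `L^2` and `L^4` -/

/-- The inner integral of the layer-cake formula for the part of a function above height `t`; `p >
2` makes `t^(p-3)` integrable at `0`. -/
theorem lintegral_Ioi_low {p : ℝ} (hp : 2 < p) {y : ℝ} (hy : 0 ≤ y) :
    ∫⁻ t in Set.Ioi (0 : ℝ), (if t < y then ENNReal.ofReal (t ^ (p - 3) * y ^ 2) else 0) ≤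
      ENNReal.ofReal (y ^ p / (p - 2)) := by
  have h1 : ∫⁻ t in Set.Ioi (0 : ℝ), (if t < y then ENNReal.ofReal (t ^ (p - 3) * y ^ 2) else 0) =
      ∫⁻ t in Set.Ioo (0 : ℝ) y, ENNReal.ofReal (t ^ (p - 3) * y ^ 2) := by
    rw [← Set.Ioi_inter_Iio, Set.inter_comm, ← Measure.restrict_restrict measurableSet_Iio,
      ← lintegral_indicator measurableSet_Iio]
    refine lintegral_congr fun t => ?_
    simp [Set.indicator]
  rw [h1]
  have hint : IntegrableOn (fun t : ℝ => t ^ (p - 3) * y ^ 2) (Set.Ioo 0 y) := by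
    have := (intervalIntegral.intervalIntegrable_rpow' (a := 0) (b := y)
      (by linarith : -1 < p - 3)).mul_const (y ^ 2)
    rw [intervalIntegrable_iff_integrableOn_Ioo_of_le hy] at this
    exact this
  rw [← ofReal_integral_eq_lintegral_ofReal hint]
  · rw [← integral_Ioc_eq_integral_Ioo, ← intervalIntegral.integral_of_le hy,
      intervalIntegral.integral_mul_const, integral_rpow (Or.inl (by linarith)),
      Real.zero_rpow (by linarith)]
    refine ENNReal.ofReal_le_ofReal (le_of_eq ?_)
    rw [sub_zero, show p - 3 + 1 = p - 2 by ring, div_mul_eq_mul_div]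
    congr 1
    rcases hy.eq_or_lt with rfl | hy
    · rw [Real.zero_rpow (by linarith : p ≠ 0)]; simp
    · rw [← Real.rpow_natCast y 2, ← Real.rpow_add hy]; norm_num
  · filter_upwards [ae_restrict_mem measurableSet_Ioo] with t ht
    have := ht.1
    simp only [Pi.zero_apply]
    positivity

/-- The counterpart for the part below height `t`; `p < 4` makes `t^(p-5)` integrable at infinity.
-/
theorem lintegral_Ioi_high {p : ℝ} (hp : p < 4) {y : ℝ} (hy : 0 ≤ y) :
    ∫⁻ t in Set.Ioi (0 : ℝ), (if t < y then 0 else ENNReal.ofReal (t ^ (p - 5) * y ^ 4)) ≤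
      ENNReal.ofReal (y ^ p / (4 - p)) := by
  rcases hy.eq_or_lt with rfl | hy
  · simp
  have h1 : ∫⁻ t in Set.Ioi (0 : ℝ), (if t < y then 0 else ENNReal.ofReal (t ^ (p - 5) * y ^ 4)) =
      ∫⁻ t in Set.Ici y, ENNReal.ofReal (t ^ (p - 5) * y ^ 4) := by
    have : Set.Ici y = Set.Ici y ∩ Set.Ioi 0 := by
      ext t; simp only [Set.mem_Ici, Set.mem_inter_iff, Set.mem_Ioi]
      exact ⟨fun h => ⟨h, by linarith⟩, fun h => h.1⟩
    rw [this, ← Measure.restrict_restrict measurableSet_Ici,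
      ← lintegral_indicator measurableSet_Ici]
    refine lintegral_congr fun t => ?_
    by_cases h : t < y <;> simp [Set.indicator, h]
  rw [h1, setLIntegral_congr Ioi_ae_eq_Ici.symm]
  rw [← ofReal_integral_eq_lintegral_ofReal
    ((integrableOn_Ioi_rpow_of_lt (by linarith) hy).mul_const _)]
  · rw [integral_mul_const, integral_Ioi_rpow_of_lt (by linarith) hy]
    refine ENNReal.ofReal_le_ofReal (le_of_eq ?_)
    rw [show p - 5 + 1 = -(4 - p) by ring, neg_div_neg_eq, div_mul_eq_mul_div]
    congr 1
    rw [← Real.rpow_natCast y 4, ← Real.rpow_add hy]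
    norm_num
  · filter_upwards [ae_restrict_mem measurableSet_Ioi] with t ht
    have : 0 < t := hy.trans ht
    simp only [Pi.zero_apply]
    positivity

theorem meas_half_le {f : Sp d → ℂ} (hf : AEStronglyMeasurable f volume) {n : ℕ} (hn : n ≠ 0)
    {t : ℝ} (ht : 0 < t) :
    volume {x | t / 2 ≤ ‖f x‖} ≤
      ENNReal.ofReal ((2 / t) ^ n) * eLpNorm f n volume ^ n := by
  have h := meas_ge_le_mul_pow_eLpNorm_enorm (μ := volume) (p := (n : ℝ≥0∞)) (by simpa using hn)
    (by simp) hf (ε := ENNReal.ofReal (t / 2)) (by simp [ht]) (by simp)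
  refine le_trans (le_of_eq ?_) (h.trans (le_of_eq ?_))
  · congr 1
    ext x
    simp only [Set.mem_ofPred_eq]
    rw [← ofReal_norm, ENNReal.ofReal_le_ofReal_iff (norm_nonneg _)]
  · simp only [ENNReal.toReal_natCast, ENNReal.rpow_natCast]
    rw [← ENNReal.ofReal_inv_of_pos (by positivity), ← ENNReal.ofReal_pow (by positivity), inv_div]

theorem eLpNorm_pow_natCast (f : Sp d → ℂ) {n : ℕ} (hn : n ≠ 0) :
    eLpNorm f n volume ^ n = ∫⁻ x, ENNReal.ofReal (‖f x‖ ^ n) := by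
  rw [eLpNorm_eq_lintegral_rpow_enorm_toReal (by simpa using hn) (by simp), ← ENNReal.rpow_natCast,
    ← ENNReal.rpow_mul]
  simp only [ENNReal.toReal_natCast, ENNReal.rpow_natCast]
  rw [one_div, inv_mul_cancel₀ (by simpa using hn), ENNReal.rpow_one]
  simp_rw [ENNReal.ofReal_pow (norm_nonneg _), ofReal_norm]

/-- Marcinkiewicz interpolation theorem between `L^2` and `L^4`. -/
theorem eLpNorm_le_of_two_of_four {p : ℝ} (hp : 2 < p) (hp4 : p < 4) {A : ℝ≥0∞} (hA : A < ∞) :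
    ∃ C : ℝ≥0∞, C < ∞ ∧ ∀ T : L2 d →L[ℂ] L2 d,
      (∀ b, eLpNorm (T b) 2 volume ≤ A * eLpNorm b 2 volume) →
      (∀ b, eLpNorm (T b) 4 volume ≤ A * eLpNorm b 4 volume) →
      ∀ b, eLpNorm (T b) (ENNReal.ofReal p) volume ≤ C * eLpNorm b (ENNReal.ofReal p) volume := by
  have hp0 : 0 < p := by linarith
  -- The factor `p` is that of the layer-cake formula, `4 = 2²` and `16 = 2⁴` come from Chebyshev at
  -- height `t/2`, and the last factors are the two integrals in `t` above.
  set K : ℝ≥0∞ := ENNReal.ofReal p * (4 * A ^ 2 * ENNReal.ofReal (1 / (p - 2)) +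
    16 * A ^ 4 * ENNReal.ofReal (1 / (4 - p))) with hK
  have hKt : K < ∞ := by
    refine ENNReal.mul_lt_top ENNReal.ofReal_lt_top (ENNReal.add_lt_top.2 ⟨?_, ?_⟩)
    · exact ENNReal.mul_lt_top (ENNReal.mul_lt_top (by simp) (ENNReal.pow_lt_top hA))
        ENNReal.ofReal_lt_top
    · exact ENNReal.mul_lt_top (ENNReal.mul_lt_top (by simp) (ENNReal.pow_lt_top hA))
        ENNReal.ofReal_lt_top
  refine ⟨K ^ (1 / p), ENNReal.rpow_lt_top_of_nonneg (by positivity) hKt.ne, fun T h2 h4 b => ?_⟩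
  have hbm : Measurable b := (Lp.stronglyMeasurable b).measurable
  set k1 : ℝ → Sp d → ℝ≥0∞ := fun t x =>
    if t < ‖b x‖ then ENNReal.ofReal (t ^ (p - 3) * ‖b x‖ ^ 2) else 0 with hk1
  set k2 : ℝ → Sp d → ℝ≥0∞ := fun t x =>
    if t < ‖b x‖ then 0 else ENNReal.ofReal (t ^ (p - 5) * ‖b x‖ ^ 4) with hk2
  have hk1m : Measurable (Function.uncurry k1) := by
    refine Measurable.ite ?_ (by fun_prop) measurable_const
    exact measurableSet_lt measurable_fst (hbm.comp measurable_snd).norm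
  have hk2m : Measurable (Function.uncurry k2) := by
    refine Measurable.ite ?_ measurable_const (by fun_prop)
    exact measurableSet_lt measurable_fst (hbm.comp measurable_snd).norm
  have key : ∀ t ∈ Set.Ioi (0 : ℝ), volume {x | t < ‖T b x‖} * ENNReal.ofReal (t ^ (p - 1)) ≤
      4 * A ^ 2 * (∫⁻ x, k1 t x) + 16 * A ^ 4 * ∫⁻ x, k2 t x := by
    intro t ht
    have ht : 0 < t := ht
    -- Truncation at the running height `t`: the large part is estimated in `L²`, the small part in
    -- `L⁴`.
    set s : Set (Sp d) := {x | t < ‖b x‖} with hs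
    have hsm : MeasurableSet s := measurableSet_lt measurable_const hbm.norm
    have m1 : MemLp (s.indicator b) 2 volume := (Lp.memLp b).indicator hsm
    have m2 : MemLp (sᶜ.indicator b) 2 volume := (Lp.memLp b).indicator hsm.compl
    set b1 := m1.toLp _
    set b2 := m2.toLp _
    have hb : b = b1 + b2 := by
      refine Lp.ext ?_
      filter_upwards [m1.coeFn_toLp, m2.coeFn_toLp, Lp.coeFn_add b1 b2] with x e1 e2 e3
      rw [e3, Pi.add_apply, e1, e2]
      exact (congrFun (Set.indicator_self_add_compl s b) x).symm
    have hsub : volume {x | t < ‖T b x‖} ≤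
        volume {x | t / 2 ≤ ‖T b1 x‖} + volume {x | t / 2 ≤ ‖T b2 x‖} := by
      refine (measure_mono_ae ?_).trans (measure_union_le _ _)
      filter_upwards [Lp.coeFn_add (T b1) (T b2)] with x e hx
      have hx : t < ‖T b x‖ := hx
      rw [hb, map_add, e, Pi.add_apply] at hx
      have := norm_add_le (T b1 x) (T b2 x)
      by_cases h : t / 2 ≤ ‖T b1 x‖
      · exact Or.inl h
      · right
        show t / 2 ≤ ‖T b2 x‖
        linarith
    have i1 : eLpNorm b1 2 volume ^ 2 = ∫⁻ x, ENNReal.ofReal (‖s.indicator b x‖ ^ 2) := by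
      rw [eLpNorm_congr_ae m1.coeFn_toLp]
      exact eLpNorm_pow_natCast _ two_ne_zero
    have i2 : eLpNorm b2 4 volume ^ 4 = ∫⁻ x, ENNReal.ofReal (‖sᶜ.indicator b x‖ ^ 4) := by
      rw [eLpNorm_congr_ae m2.coeFn_toLp]
      exact eLpNorm_pow_natCast _ four_ne_zero
    have j1 := (meas_half_le (Lp.aestronglyMeasurable (T b1)) two_ne_zero ht).trans
      (mul_le_mul_right (pow_le_pow_left' (h2 b1) 2) _)
    have j2 := (meas_half_le (Lp.aestronglyMeasurable (T b2)) four_ne_zero ht).trans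
      (mul_le_mul_right (pow_le_pow_left' (h4 b2) 4) _)
    rw [mul_pow, i1] at j1
    rw [mul_pow, i2] at j2
    refine (mul_le_mul_left (hsub.trans (add_le_add j1 j2)) _).trans (le_of_eq ?_)
    rw [add_mul]
    congr 1
    · have e1 : ∫⁻ x, k1 t x = ENNReal.ofReal (t ^ (p - 3)) *
          ∫⁻ x, ENNReal.ofReal (‖s.indicator b x‖ ^ 2) := by
        rw [← lintegral_const_mul' _ _ ENNReal.ofReal_ne_top]
        refine lintegral_congr fun x => ?_
        by_cases hx : x ∈ s
        · have hx' : t < ‖b x‖ := hx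
          simp only [hk1, if_pos hx', Set.indicator_of_mem hx]
          rw [ENNReal.ofReal_mul (by positivity)]
        · have hx' : ¬ t < ‖b x‖ := hx
          simp only [hk1, if_neg hx', Set.indicator_of_notMem hx]
          simp
      have e2 : ENNReal.ofReal ((2 / t) ^ 2) * ENNReal.ofReal (t ^ (p - 1)) =
          4 * ENNReal.ofReal (t ^ (p - 3)) := by
        rw [← ENNReal.ofReal_mul (by positivity), show (4 : ℝ≥0∞) = ENNReal.ofReal 4 by norm_num,
          ← ENNReal.ofReal_mul (by positivity), show p - 1 = p - 3 + (2 : ℕ) by push_cast; ring,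
          Real.rpow_add ht, Real.rpow_natCast]
        congr 1
        field_simp
        norm_num
      rw [e1]
      calc _ = (ENNReal.ofReal ((2 / t) ^ 2) * ENNReal.ofReal (t ^ (p - 1))) * (A ^ 2 *
            ∫⁻ x, ENNReal.ofReal (‖s.indicator b x‖ ^ 2)) := by ring
        _ = _ := by rw [e2]; ring
    · have e1 : ∫⁻ x, k2 t x = ENNReal.ofReal (t ^ (p - 5)) *
          ∫⁻ x, ENNReal.ofReal (‖sᶜ.indicator b x‖ ^ 4) := by
        rw [← lintegral_const_mul' _ _ ENNReal.ofReal_ne_top]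
        refine lintegral_congr fun x => ?_
        by_cases hx : x ∈ s
        · have hx' : t < ‖b x‖ := hx
          have hx2 : x ∉ sᶜ := fun h => h hx
          simp only [hk2, if_pos hx', Set.indicator_of_notMem hx2]
          simp
        · have hx' : ¬ t < ‖b x‖ := hx
          have hx2 : x ∈ sᶜ := hx
          simp only [hk2, if_neg hx', Set.indicator_of_mem hx2]
          rw [ENNReal.ofReal_mul (by positivity)]
      have e2 : ENNReal.ofReal ((2 / t) ^ 4) * ENNReal.ofReal (t ^ (p - 1)) =
          16 * ENNReal.ofReal (t ^ (p - 5)) := by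
        rw [← ENNReal.ofReal_mul (by positivity), show (16 : ℝ≥0∞) = ENNReal.ofReal 16 by norm_num,
          ← ENNReal.ofReal_mul (by positivity), show p - 1 = p - 5 + (4 : ℕ) by push_cast; ring,
          Real.rpow_add ht, Real.rpow_natCast]
        congr 1
        field_simp
        norm_num
      rw [e1]
      calc _ = (ENNReal.ofReal ((2 / t) ^ 4) * ENNReal.ofReal (t ^ (p - 1))) * (A ^ 4 *
            ∫⁻ x, ENNReal.ofReal (‖sᶜ.indicator b x‖ ^ 4)) := by ring
        _ = _ := by rw [e2]; ring
  have main : ∫⁻ x, ENNReal.ofReal (‖T b x‖ ^ p) ≤ K * ∫⁻ x, ENNReal.ofReal (‖b x‖ ^ p) := by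
    rw [lintegral_rpow_eq_lintegral_meas_lt_mul volume (ae_of_all _ fun x => norm_nonneg _)
      (Lp.aestronglyMeasurable (T b)).norm.aemeasurable hp0, hK, mul_assoc]
    gcongr
    refine (setLIntegral_mono' measurableSet_Ioi key).trans ?_
    have mk1 : Measurable fun t => ∫⁻ x, k1 t x := hk1m.lintegral_prod_right'
    have mk2 : Measurable fun t => ∫⁻ x, k2 t x := hk2m.lintegral_prod_right'
    rw [lintegral_add_left (mk1.const_mul _), lintegral_const_mul _ mk1, lintegral_const_mul _ mk2,
      lintegral_lintegral_swap hk1m.aemeasurable, lintegral_lintegral_swap hk2m.aemeasurable,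
      add_mul, mul_assoc _ (ENNReal.ofReal (1 / (p - 2))), mul_assoc _ (ENNReal.ofReal (1 / (4 - p))),
      ← lintegral_const_mul' _ _ ENNReal.ofReal_ne_top,
      ← lintegral_const_mul' _ _ ENNReal.ofReal_ne_top]
    have hp2 : 0 < p - 2 := by linarith
    have hp4' : 0 < 4 - p := by linarith
    gcongr 4 * A ^ 2 * ?_ + 16 * A ^ 4 * ?_
    · refine lintegral_mono fun x => (lintegral_Ioi_low hp (norm_nonneg (b x))).trans (le_of_eq ?_)
      rw [← ENNReal.ofReal_mul (by positivity)]
      congr 1; ring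
    · refine lintegral_mono fun x => (lintegral_Ioi_high hp4 (norm_nonneg (b x))).trans (le_of_eq ?_)
      rw [← ENNReal.ofReal_mul (by positivity)]
      congr 1; ring
  have conv : ∀ f : Sp d → ℂ, eLpNorm f (ENNReal.ofReal p) volume =
      (∫⁻ x, ENNReal.ofReal (‖f x‖ ^ p)) ^ (1 / p) := fun f => by
    rw [eLpNorm_eq_lintegral_rpow_enorm_toReal (by simpa using hp0) (by simp),
      ENNReal.toReal_ofReal hp0.le]
    congr 1
    refine lintegral_congr fun x => ?_
    rw [← ofReal_norm, ENNReal.ofReal_rpow_of_nonneg (norm_nonneg _) hp0.le]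
  rw [conv, conv, ← ENNReal.mul_rpow_of_nonneg _ _ (by positivity)]
  gcongr

theorem eLpNorm_fm_le_of_norm_le {m : Sp d → ℂ} (hm : MemLp m ∞ volume) (hC : ∀ ξ, ‖m ξ‖ ≤ 1)
    (b : L2 d) : eLpNorm (fm m b) 2 volume ≤ eLpNorm b 2 volume := by
  have h := norm_fm_le hm hC b
  rw [one_mul, Lp.norm_def, Lp.norm_def] at h
  exact (ENNReal.toReal_le_toReal (Lp.memLp _).2.ne (Lp.memLp _).2.ne).1 h

/-- The multipliers `1_Q e^{-∑ ℓ_i |ξ_i|}` are bounded on `L^p`, uniformly in `ℓ`. -/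
theorem exists_eLpNorm_fm_osym_le {p : ℝ} (hp : 2 ≤ p) (hp4 : p ≤ 4) :
    ∃ C : ℝ≥0∞, C < ∞ ∧ ∀ (σ : Fin d → Bool) (ℓ : Fin d → ℝ), (∀ i, 0 ≤ ℓ i) → ∀ b : L2 d,
      eLpNorm (fm (osym σ ℓ) b) (ENNReal.ofReal p) volume ≤
        C * eLpNorm b (ENNReal.ofReal p) volume := by
  have h3 : (1 : ℝ≥0∞) ≤ 3 ^ d := one_le_pow₀ (by norm_num)
  have h3t : (3 : ℝ≥0∞) ^ d < ∞ := ENNReal.pow_lt_top (by simp)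
  have h2 : ∀ (σ : Fin d → Bool) (ℓ : Fin d → ℝ), (∀ i, 0 ≤ ℓ i) → ∀ b : L2 d,
      eLpNorm (fm (osym σ ℓ) b) 2 volume ≤ 3 ^ d * eLpNorm b 2 volume := fun σ ℓ hℓ b =>
    (eLpNorm_fm_le_of_norm_le (memLp_osym σ hℓ) (norm_osym_le σ hℓ) b).trans
      (le_mul_of_one_le_left' h3)
  rcases hp.eq_or_lt with rfl | hp
  · exact ⟨3 ^ d, h3t, by simpa using h2⟩
  rcases hp4.eq_or_lt with rfl | hp4
  · exact ⟨3 ^ d, h3t, fun σ ℓ hℓ b => by simpa using eLpNorm_four_fm_osym_le σ hℓ b⟩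
  obtain ⟨C, hC, h⟩ := eLpNorm_le_of_two_of_four (d := d) hp hp4 h3t
  exact ⟨C, hC, fun σ ℓ hℓ => h _ (h2 σ ℓ hℓ) (eLpNorm_four_fm_osym_le σ hℓ)⟩

/-! ### The bilinear operators with symbol `e^{|ξ + η|₁ - |ξ|₁ - |η|₁}` -/

/-- Exactly one pattern survives, that of the actual signs of `s`, `t`, `s + t`. If `s` and `t` have
opposite signs, `|s| + |t| - |s + t|` is twice the modulus of the one whose sign differs from that
of the sum; otherwise it is `0`. Hence the weights `0` and `2A`. -/
theorem exp_mul_exp_eq_sum (A s t : ℝ) :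
    Real.exp (-A * |s|) * Real.exp (-A * |t|) = Real.exp (-A * |s + t|) *
      ∑ c : Bool × Bool × Bool, hsym c.2.2 0 (s + t) *
        (hsym c.1 (if c.2.2 = c.1 then 0 else 2 * A) s *
          hsym c.2.1 (if c.2.2 = c.2.1 then 0 else 2 * A) t) := by
  simp only [Fintype.sum_prod_type, Fintype.sum_bool, hsym]
  rcases le_or_gt 0 s with hs | hs <;> rcases le_or_gt 0 t with ht | ht <;>
    rcases le_or_gt 0 (s + t) with hst | hst <;>
    first | (exfalso; linarith) | skip
  all_goals
    try have hs' := not_le.2 hs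
    try have ht' := not_le.2 ht
    try have hst' := not_le.2 hst
    simp only [*, abs_of_nonneg, abs_of_neg, true_iff, false_iff, if_true, if_false,
      Bool.false_eq_true, Bool.true_eq_false, not_true_eq_false, mul_zero, zero_mul, add_zero,
      zero_add, neg_zero, Real.exp_zero, mul_one, one_mul]
    try simp only [← Real.exp_add]
    try congr 1
    try ring

/-- The signs of `ξ_i`, `η_i` and `ξ_i + η_i`. -/
abbrev SignPattern (d : ℕ) := Fin d → Bool × Bool × Bool

/-- The exponent that goes with the sign `σ`, if `ρ` is the sign of the sum. -/
def wt (A : ℝ) (ρ σ : Bool) : ℝ := if ρ = σ then 0 else 2 * A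

theorem wt_nonneg {A : ℝ} (hA : 0 ≤ A) (ρ σ : Bool) : 0 ≤ wt A ρ σ := by
  unfold wt; split_ifs <;> positivity

/-- The symbol of the first factor. -/
def symA (a : NNReal) (c : SignPattern d) : Sp d → ℂ :=
  osym (fun i => (c i).1) (fun i => wt (2 * Real.pi * a) (c i).2.2 (c i).1)

/-- The symbol of the second factor. -/
def symB (a : NNReal) (c : SignPattern d) : Sp d → ℂ :=
  osym (fun i => (c i).2.1) (fun i => wt (2 * Real.pi * a) (c i).2.2 (c i).2.1)

/-- The symbol of the product. -/
def symC (c : SignPattern d) : Sp d → ℂ := osym (fun i => (c i).2.2) 0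

theorem wt_pi_nonneg (a : NNReal) (ρ σ : Bool) : 0 ≤ wt (2 * Real.pi * a) ρ σ :=
  wt_nonneg (by positivity) _ _

theorem norm_symA_le (a : NNReal) (c : SignPattern d) (ξ : Sp d) : ‖symA a c ξ‖ ≤ 1 :=
  norm_osym_le _ (fun _ => wt_pi_nonneg a _ _) ξ

theorem norm_symB_le (a : NNReal) (c : SignPattern d) (ξ : Sp d) : ‖symB a c ξ‖ ≤ 1 :=
  norm_osym_le _ (fun _ => wt_pi_nonneg a _ _) ξ

theorem norm_symC_le (c : SignPattern d) (ξ : Sp d) : ‖symC c ξ‖ ≤ 1 :=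
  norm_osym_le _ (fun _ => le_rfl) ξ

theorem memLp_symA (a : NNReal) (c : SignPattern d) : MemLp (symA a c) ∞ volume :=
  memLp_osym _ fun _ => wt_pi_nonneg a _ _

theorem memLp_symB (a : NNReal) (c : SignPattern d) : MemLp (symB a c) ∞ volume :=
  memLp_osym _ fun _ => wt_pi_nonneg a _ _

theorem memLp_symC (c : SignPattern d) : MemLp (symC c) ∞ volume :=
  memLp_osym _ fun _ => le_rfl

/-- The product over the coordinates of the one-dimensional identity, expanded over sign patterns.
Each term separates `ξ`, `η` and `ξ + η`, so it is the symbol of a composition of linear multipliers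
with a pointwise product. -/
theorem esym_mul_esym (a : NNReal) (ξ η : Sp d) :
    esym (fun _ => a) ξ * esym (fun _ => a) η = esym (fun _ => a) (ξ + η) *
      ∑ c : SignPattern d, symC c (ξ + η) * (symA a c ξ * symB a c η) := by
  have he : ∀ ξ : Sp d, esym (fun _ => a) ξ =
      ((∏ i, Real.exp (-(2 * Real.pi * a) * |ξ i|) : ℝ) : ℂ) := fun ξ => by
    rw [esym, ← Real.exp_sum, Finset.mul_sum]
    congr 3
    ext i; ring
  simp only [he, symA, symB, symC, osym, ← Complex.ofReal_mul, ← Complex.ofReal_sum]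
  congr 1
  simp only [← Finset.prod_mul_distrib, PiLp.add_apply, Pi.zero_apply]
  rw [Finset.prod_congr rfl fun i _ => exp_mul_exp_eq_sum (2 * Real.pi * a) (ξ i) (η i),
    Finset.prod_mul_distrib, Finset.prod_univ_sum, Fintype.piFinset_univ]
  rfl

theorem IsL12.symA {g : Sp d → ℂ} (hg : IsL12 g) (a : NNReal) (c : SignPattern d) :
    IsL12 fun ξ => symA a c ξ * g ξ := hg.mul_bdd (measurable_osym _ _) (norm_symA_le a c)

theorem IsL12.symB {g : Sp d → ℂ} (hg : IsL12 g) (a : NNReal) (c : SignPattern d) :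
    IsL12 fun ξ => symB a c ξ * g ξ := hg.mul_bdd (measurable_osym _ _) (norm_symB_le a c)

theorem cv_esym_eq_sum (a : NNReal) {g g' : Sp d → ℂ} (hg : IsL12 g) (hg' : IsL12 g') :
    ∀ᵐ ξ, cv volume (fun ξ => esym (fun _ => a) ξ * g ξ) (fun ξ => esym (fun _ => a) ξ * g' ξ) ξ =
      esym (fun _ => a) ξ * ∑ c, symC c ξ *
        cv volume (fun ξ => symA a c ξ * g ξ) (fun ξ => symB a c ξ * g' ξ) ξ := by
  have hint : ∀ᵐ ξ, ∀ c, Integrable (fun y => (symA a c y * g y) *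
      (symB a c (ξ - y) * g' (ξ - y))) volume :=
    ae_all_iff.2 fun c => ae_integrable_cv (k := fun y => symA a c y * g y)
      (w := fun y => symB a c y * g' y) (hg.symA a c).meas (hg.symA a c).int (q := 2)
      (by norm_num) (hg'.symB a c).sq
  filter_upwards [hint] with ξ e3
  simp only [cv]
  simp only [← integral_const_mul]
  rw [← integral_finsetSum _ fun c _ => (e3 c).const_mul _, ← integral_const_mul]
  refine integral_congr_ae (ae_of_all _ fun y => ?_)
  have e6 := esym_mul_esym a y (ξ - y)
  rw [add_sub_cancel] at e6
  simp only
  have e7 : ∑ c, symC c ξ * (symA a c y * g y * (symB a c (ξ - y) * g' (ξ - y))) =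
      (∑ c, symC c ξ * (symA a c y * symB a c (ξ - y))) * (g y * g' (ξ - y)) := by
    rw [Finset.sum_mul]
    exact Finset.sum_congr rfl fun c _ => by ring
  rw [e7]
  linear_combination (g y * g' (ξ - y)) * e6

theorem fourier_fm_of {m : Sp d → ℂ} (hm : MemLp m ∞ volume) {b : L2 d} {k : Sp d → ℂ}
    (h : (𝓕 b : L2 d) =ᵐ[volume] k) : (𝓕 (fm m b) : L2 d) =ᵐ[volume] fun ξ => m ξ * k ξ := by
  filter_upwards [fourier_fm hm b, h] with ξ e1 e2
  rw [e1, e2]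

theorem exists_mul_of_isL12 {b b' : L2 d} {g g' : Sp d → ℂ} (hg : IsL12 g) (hg' : IsL12 g')
    (h : (𝓕 b : L2 d) =ᵐ[volume] g) (h' : (𝓕 b' : L2 d) =ᵐ[volume] g') :
    ∃ P : L2 d, P =ᵐ[volume] (fun x => b x * b' x) ∧ (𝓕 P : L2 d) =ᵐ[volume] cv volume g g' := by
  refine ⟨𝓕⁻ ((memLp_two_cv hg hg').toLp _), ?_, ?_⟩
  · refine (fourierInv_toLp (integrable_cv hg hg') (memLp_two_cv hg hg')).trans ?_
    rw [fourierInv_cv hg.int hg'.int]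
    filter_upwards [eq_fourierInv_of hg h, eq_fourierInv_of hg' h'] with x h1 h2
    rw [h1, h2]
  · rw [FourierTransform.fourier_fourierInv_eq]
    exact (memLp_two_cv hg hg').coeFn_toLp

/-- `b` is `e^{aΛ₁} ρ(D) (e^{-aΛ₁} θ(D) U · e^{-aΛ₁} V)`. -/
def IsBil (a : NNReal) (θ ρ : Sp d → ℂ) (U V b : L2 d) : Prop :=
  ∃ P : L2 d, P =ᵐ[volume] (fun x => fm (esym fun _ => a) (fm θ U) x * fm (esym fun _ => a) V x) ∧
    fm (esym fun _ => a) b = fm ρ P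

theorem isBil_sum (a : NNReal) {θ ρ : Sp d → ℂ} (hρ : MemLp ρ ∞ volume) {U V : L2 d}
    {g g' : Sp d → ℂ} (hg : IsL12 g) (hg' : IsL12 g') (h : (𝓕 (fm θ U) : L2 d) =ᵐ[volume] g)
    (h' : (𝓕 V : L2 d) =ᵐ[volume] g') {P : SignPattern d → L2 d}
    (hP : ∀ c, (𝓕 (P c) : L2 d) =ᵐ[volume]
      cv volume (fun ξ => symA a c ξ * g ξ) (fun ξ => symB a c ξ * g' ξ)) :
    IsBil a θ ρ U V (∑ c, fm (symC c) (fm ρ (P c))) := by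
  have hEm : MemLp (esym (d := d) fun _ => a) ∞ volume := memLp_esym _
  have hEg : IsL12 fun ξ => esym (fun _ => a) ξ * g ξ :=
    hg.mul_bdd (measurable_esym _) (norm_esym_le _)
  have hEg' : IsL12 fun ξ => esym (fun _ => a) ξ * g' ξ :=
    hg'.mul_bdd (measurable_esym _) (norm_esym_le _)
  obtain ⟨Q, hQ1, hQ2⟩ := exists_mul_of_isL12 hEg hEg' (fourier_fm_of hEm h) (fourier_fm_of hEm h')
  refine ⟨Q, hQ1, fourier_ext ?_⟩
  rw [map_sum]
  have hFsum : (𝓕 (∑ c, fm (esym fun _ => a) (fm (symC c) (fm ρ (P c)))) : L2 d) =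
      ∑ c, 𝓕 (fm (esym fun _ => a) (fm (symC c) (fm ρ (P c)))) :=
    map_sum (FourierTransform.fourierCLM ℂ (L2 d)) _ _
  rw [hFsum]
  have hall : ∀ᵐ ξ, ∀ c, (𝓕 (fm (esym fun _ => a) (fm (symC c) (fm ρ (P c)))) : L2 d) ξ =
      esym (fun _ => a) ξ * (symC c ξ * (ρ ξ *
        cv volume (fun ξ => symA a c ξ * g ξ) (fun ξ => symB a c ξ * g' ξ) ξ)) :=
    ae_all_iff.2 fun c =>
      fourier_fm_of hEm (fourier_fm_of (memLp_symC c) (fourier_fm_of hρ (hP c)))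
  filter_upwards [Lp.coeFn_fun_finsetSum Finset.univ
    (fun c => (𝓕 (fm (esym fun _ => a) (fm (symC c) (fm ρ (P c)))) : L2 d)), hall,
    cv_esym_eq_sum a hg hg', fourier_fm_of hρ hQ2] with ξ e1 e2 e5 e4
  rw [e1, e4]
  simp only [e2]
  rw [e5, Finset.mul_sum, Finset.mul_sum]
  exact Finset.sum_congr rfl fun c _ => by ring

/-- Bound of the bilinear operator for functions whose Fourier transform is integrable. -/
theorem exists_isBil {p : ℝ≥0∞} {C K : ℝ≥0∞} (a : NNReal) {θ ρ kθ : Sp d → ℂ}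
    (hC : ∀ (σ : Fin d → Bool) (ℓ : Fin d → ℝ), (∀ i, 0 ≤ ℓ i) → ∀ b : L2 d,
      eLpNorm (fm (osym σ ℓ) b) p volume ≤ C * eLpNorm b p volume)
    (hθ : IsKer volume kθ θ) (hρ : MemLp ρ ∞ volume)
    (hK : ∀ U V P : L2 d, P =ᵐ[volume] (fun x => fm θ U x * V x) →
      ‖fm ρ P‖ₑ ≤ K * (eLpNorm U p volume * eLpNorm V p volume))
    {U V : L2 d} {g g' : Sp d → ℂ} (hg : IsL12 g) (hg' : IsL12 g')
    (h : (𝓕 U : L2 d) =ᵐ[volume] g) (h' : (𝓕 V : L2 d) =ᵐ[volume] g') :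
    ∃ b : L2 d, IsBil a θ ρ U V b ∧
      ‖b‖ₑ ≤ 8 ^ d * C ^ 2 * K * (eLpNorm U p volume * eLpNorm V p volume) := by
  have hg₁ : IsL12 fun ξ => θ ξ * g ξ := hg.mul_bdd hθ.continuous.measurable hθ.norm_le
  have h₁ := fourier_fm_of hθ.memLp h
  have hP : ∀ c, ∃ P : L2 d, P =ᵐ[volume] (fun x => fm (symA a c) (fm θ U) x * fm (symB a c) V x) ∧
      (𝓕 P : L2 d) =ᵐ[volume]
        cv volume (fun ξ => symA a c ξ * (θ ξ * g ξ)) (fun ξ => symB a c ξ * g' ξ) := fun c =>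
    exists_mul_of_isL12 (hg₁.symA a c) (hg'.symB a c) (fourier_fm_of (memLp_symA a c) h₁)
      (fourier_fm_of (memLp_symB a c) h')
  choose P hP1 hP2 using hP
  refine ⟨_, isBil_sum a hρ hg₁ hg' h₁ h' hP2, ?_⟩
  have hb : ∀ c, ‖fm (symC c) (fm ρ (P c))‖ₑ ≤
      C ^ 2 * K * (eLpNorm U p volume * eLpNorm V p volume) := fun c => by
    -- The outer orthant projection acts on `L²`, where Plancherel is enough; only the two inner
    -- multipliers use the `L^p` bound.
    have h1 : ‖fm (symC c) (fm ρ (P c))‖ₑ ≤ ‖fm ρ (P c)‖ₑ := by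
      rw [Lp.enorm_def, Lp.enorm_def]
      exact eLpNorm_fm_le_of_norm_le (memLp_symC c) (norm_symC_le c) _
    refine h1.trans ((hK (fm (symA a c) U) (fm (symB a c) V) (P c) ?_).trans ?_)
    · rw [fm_comm hθ.memLp (memLp_symA a c)]; exact hP1 c
    · calc K * (eLpNorm (fm (symA a c) U) p volume * eLpNorm (fm (symB a c) V) p volume)
          ≤ K * ((C * eLpNorm U p volume) * (C * eLpNorm V p volume)) := by
            gcongr
            · exact hC _ _ (fun _ => wt_pi_nonneg a _ _) U
            · exact hC _ _ (fun _ => wt_pi_nonneg a _ _) V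
        _ = _ := by ring
  refine (enorm_sum_le _ _).trans ((Finset.sum_le_sum fun c _ => hb c).trans (le_of_eq ?_))
  rw [Finset.sum_const, nsmul_eq_mul]
  have : ((Finset.univ : Finset (SignPattern d)).card : ℝ≥0∞) = 8 ^ d := by
    rw [Finset.card_univ, Fintype.card_fun]; simp
  rw [this]; ring

/-! ### The bilinear operators on `L^p` -/

theorem exists_schwartz_seq {q : ℝ≥0∞} (hq : 1 ≤ q) (hqt : q ≠ ∞) {w : Sp d → ℂ}
    (hw : MemLp w q volume) :
    ∃ u : ℕ → 𝓢(Sp d, ℂ), Tendsto (fun n => eLpNorm (⇑(u n) - w) q volume) atTop (𝓝 0) := by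
  have : Fact (1 ≤ q) := ⟨hq⟩
  have h1 : hw.toLp w ∈ closure (Set.range (SchwartzMap.toLpCLM ℝ ℂ q (volume : Measure (Sp d)))) :=
    (SchwartzMap.denseRange_toLpCLM (E := Sp d) (F := ℂ) (p := q) (μ := volume) hqt) _
  obtain ⟨x, hx, hxt⟩ := mem_closure_iff_seq_limit.1 h1
  choose u hu using hx
  refine ⟨u, ?_⟩
  rw [Lp.tendsto_Lp_iff_tendsto_eLpNorm'] at hxt
  refine hxt.congr fun n => eLpNorm_congr_ae ?_
  have h2 : x n = (u n).toLp q volume := (hu n).symm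
  rw [h2]
  exact ((u n).coeFn_toLp q volume).sub hw.coeFn_toLp

theorem tendsto_cv {ν : Measure (Sp d)} [SFinite ν] {k : Sp d → ℂ} (hk : Measurable k)
    (hki : Integrable k ν) {q : ℝ≥0∞} (hq : 1 ≤ q) {f : ℕ → Sp d → ℂ} {f₀ : Sp d → ℂ}
    (hf : ∀ n, MemLp (f n) q volume) (hf₀ : MemLp f₀ q volume)
    (h : Tendsto (fun n => eLpNorm (f n - f₀) q volume) atTop (𝓝 0)) :
    Tendsto (fun n => eLpNorm (cv ν k (f n) - cv ν k f₀) q volume) atTop (𝓝 0) := by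
  have h1 : Tendsto (fun n => (∫⁻ y, ‖k y‖ₑ ∂ν) * eLpNorm (f n - f₀) q volume) atTop (𝓝 0) := by
    have := ENNReal.Tendsto.const_mul (a := ∫⁻ y, ‖k y‖ₑ ∂ν) h (Or.inr hki.2.ne)
    simpa using this
  refine tendsto_of_tendsto_of_tendsto_of_le_of_le tendsto_const_nhds h1 (fun _ => zero_le)
    fun n => ?_
  simp only
  rw [← eLpNorm_congr_ae (cv_sub_ae hk hki hq (hf n) hf₀)]
  exact eLpNorm_cv_le hk ((hf n).sub hf₀).1 hq

theorem holderTriple_half (p : ℝ≥0∞) : ENNReal.HolderTriple p p (p / 2) := ⟨by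
  rw [ENNReal.inv_div (by simp) (by simp), ← two_mul, ENNReal.div_eq_inv_mul, mul_comm]⟩

theorem one_le_half {p : ℝ≥0∞} (hp : 2 ≤ p) : 1 ≤ p / 2 := by
  rw [ENNReal.le_div_iff_mul_le (by simp) (by simp), one_mul]; exact hp

theorem memLp_mul_half {p : ℝ≥0∞} {f g : Sp d → ℂ} (hf : MemLp f p volume)
    (hg : MemLp g p volume) : MemLp (f * g) (p / 2) volume :=
  have := holderTriple_half p
  hg.mul hf

theorem eLpNorm_mul_half_le {p : ℝ≥0∞} {f g : Sp d → ℂ} (hf : MemLp f p volume)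
    (hg : MemLp g p volume) :
    eLpNorm (f * g) (p / 2) volume ≤ eLpNorm f p volume * eLpNorm g p volume := by
  have := holderTriple_half p
  have h := eLpNorm_smul_le_mul_eLpNorm (p := p) (q := p) (r := p / 2) (μ := volume) hg.1 hf.1
  have e : f • g = f * g := by ext x; simp
  rwa [e] at h

theorem tendsto_eLpNorm_bdd {q : ℝ≥0∞} (hq : 1 ≤ q) {f : ℕ → Sp d → ℂ} {f₀ : Sp d → ℂ}
    (hf : ∀ n, MemLp (f n) q volume) (hf₀ : MemLp f₀ q volume) (n : ℕ) :
    eLpNorm (f n) q volume ≤ eLpNorm f₀ q volume + eLpNorm (f n - f₀) q volume := by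
  have := eLpNorm_add_le hf₀.1 ((hf n).sub hf₀).1 hq
  rwa [add_sub_cancel] at this

theorem tendsto_tdist_mul {p : ℝ≥0∞} (hp : 2 ≤ p) {f g : ℕ → Sp d → ℂ} {f₀ g₀ : Sp d → ℂ}
    (hf : ∀ n, MemLp (f n) p volume) (hg : ∀ n, MemLp (g n) p volume) (hf₀ : MemLp f₀ p volume)
    (hg₀ : MemLp g₀ p volume) (h : Tendsto (fun n => eLpNorm (f n - f₀) p volume) atTop (𝓝 0))
    (h' : Tendsto (fun n => eLpNorm (g n - g₀) p volume) atTop (𝓝 0)) :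
    Tendsto (fun n => tdist (f n * g n)) atTop (𝓝 (tdist (f₀ * g₀))) := by
  have hp1 : 1 ≤ p := le_trans (by norm_num) hp
  refine tendsto_tdist (one_le_half hp) (fun n => memLp_mul_half (hf n) (hg n))
    (memLp_mul_half hf₀ hg₀) ?_
  have h1 : Tendsto (fun n => eLpNorm (f n - f₀) p volume *
      (eLpNorm g₀ p volume + eLpNorm (g n - g₀) p volume) +
      eLpNorm f₀ p volume * eLpNorm (g n - g₀) p volume) atTop (𝓝 0) := by
    have e1 := ENNReal.Tendsto.mul h (Or.inr (by simpa using hg₀.2.ne))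
      (tendsto_const_nhds.add h' : Tendsto (fun n => eLpNorm g₀ p volume +
        eLpNorm (g n - g₀) p volume) atTop (𝓝 (eLpNorm g₀ p volume + 0))) (Or.inr (by simp))
    have e2 := ENNReal.Tendsto.const_mul (a := eLpNorm f₀ p volume) h' (Or.inr hf₀.2.ne)
    simpa using e1.add e2
  refine tendsto_of_tendsto_of_tendsto_of_le_of_le tendsto_const_nhds h1 (fun _ => zero_le)
    fun n => ?_
  have e : f n * g n - f₀ * g₀ = (f n - f₀) * g n + f₀ * (g n - g₀) := by ring
  simp only
  rw [e]
  refine (eLpNorm_add_le (memLp_mul_half ((hf n).sub hf₀) (hg n)).1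
    (memLp_mul_half hf₀ ((hg n).sub hg₀)).1 (one_le_half hp)).trans ?_
  refine add_le_add ((eLpNorm_mul_half_le ((hf n).sub hf₀) (hg n)).trans ?_)
    (eLpNorm_mul_half_le hf₀ ((hg n).sub hg₀))
  gcongr
  exact tendsto_eLpNorm_bdd hp1 hg hg₀ n

/-- The operator `e^{-aΛ₁}` on `L^q` functions. -/
def ps (a : NNReal) (w : Sp d → ℂ) : Sp d → ℂ := cv (poisson fun _ => a) (fun _ => 1) w

theorem memLp_ps (a : NNReal) {q : ℝ≥0∞} (hq : 1 ≤ q) {w : Sp d → ℂ} (hw : MemLp w q volume) :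
    MemLp (ps a w) q volume := MemLp.cv measurable_const (integrable_const 1) hq hw

theorem eLpNorm_ps_le (a : NNReal) {q : ℝ≥0∞} (hq : 1 ≤ q) {w : Sp d → ℂ}
    (hw : AEStronglyMeasurable w volume) : eLpNorm (ps a w) q volume ≤ eLpNorm w q volume :=
  (eLpNorm_cv_le measurable_const hw hq).trans (by simp)

theorem ps_congr_ae (a : NNReal) {w w' : Sp d → ℂ} (h : w =ᵐ[volume] w') :
    ps a w =ᵐ[volume] ps a w' := cv_congr_ae h

theorem fm_esym_ae (a : NNReal) (b : L2 d) : fm (esym fun _ => a) b =ᵐ[volume] ps a b :=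
  fm_eq_cv (isKer_poisson _) b

/-- The identity `U₁V₁ - U₂V₂ = (U₁ - U₂)V₁ + U₂(V₁ - V₂)` holds after `e^{-aΛ₁}`, which is
injective. -/
theorem IsBil.sub_eq {a : NNReal} {θ ρ : Sp d → ℂ} {U₁ U₂ V₁ V₂ b₁ b₂ b b' : L2 d}
    (h₁ : IsBil a θ ρ U₁ V₁ b₁) (h₂ : IsBil a θ ρ U₂ V₂ b₂) (h : IsBil a θ ρ (U₁ - U₂) V₁ b)
    (h' : IsBil a θ ρ U₂ (V₁ - V₂) b') : b₁ - b₂ = b + b' := by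
  obtain ⟨P₁, hP₁, e₁⟩ := h₁
  obtain ⟨P₂, hP₂, e₂⟩ := h₂
  obtain ⟨P, hP, e⟩ := h
  obtain ⟨P', hP', e'⟩ := h'
  refine fm_injective (memLp_esym fun _ => a) (esym_ne_zero _) ?_
  rw [map_sub, map_add, e₁, e₂, e, e', ← map_sub, ← map_add]
  congr 1
  refine Lp.ext ?_
  rw [map_sub, map_sub] at hP
  rw [map_sub] at hP'
  filter_upwards [hP₁, hP₂, hP, hP', Lp.coeFn_sub P₁ P₂, Lp.coeFn_add P P',
    Lp.coeFn_sub (fm (esym fun _ => a) (fm θ U₁)) (fm (esym fun _ => a) (fm θ U₂)),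
    Lp.coeFn_sub (fm (esym fun _ => a) V₁) (fm (esym fun _ => a) V₂)] with x i1 i2 i3 i4 i5 i6 i7 i8
  rw [i5, i6, Pi.sub_apply, Pi.add_apply, i1, i2, i3, i4, i7, i8, Pi.sub_apply, Pi.sub_apply]
  ring

theorem isL12_schwartz (φ : 𝓢(Sp d, ℂ)) : IsL12 φ :=
  ⟨φ.continuous.measurable, φ.integrable, φ.memLp 2 volume⟩

theorem fourier_toLp_schwartz (φ : 𝓢(Sp d, ℂ)) :
    (𝓕 (φ.toLp 2 volume) : L2 d) =ᵐ[volume] (𝓕 φ : 𝓢(Sp d, ℂ)) := by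
  rw [SchwartzMap.toLp_fourier_eq]; exact SchwartzMap.coeFn_toLp _ _ _

/-- The bilinear operator `(w₁, w₂) ↦ e^{aΛ₁} ρ(D) (e^{-aΛ₁} θ(D) w₁ · e^{-aΛ₁} w₂)` from
`L^p × L^p` to `L^2`. -/
theorem exists_bilinear {p : ℝ≥0∞} (hp : 2 ≤ p) (hpt : p ≠ ∞) {C K : ℝ≥0∞} (hCt : C < ∞)
    (hKt : K < ∞) (a : NNReal) {θ ρ kθ : Sp d → ℂ}
    (hC : ∀ (σ : Fin d → Bool) (ℓ : Fin d → ℝ), (∀ i, 0 ≤ ℓ i) → ∀ b : L2 d,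
      eLpNorm (fm (osym σ ℓ) b) p volume ≤ C * eLpNorm b p volume)
    (hθ : IsKer volume kθ θ) (hρ : MemLp ρ ∞ volume) (hρt : ρ.HasTemperateGrowth)
    (hK : ∀ U V P : L2 d, P =ᵐ[volume] (fun x => fm θ U x * V x) →
      ‖fm ρ P‖ₑ ≤ K * (eLpNorm U p volume * eLpNorm V p volume))
    {w₁ w₂ : Sp d → ℂ} (hw₁ : MemLp w₁ p volume) (hw₂ : MemLp w₂ p volume) :
    ∃ b : L2 d, tdist (fm (esym fun _ => a) b) =
        TemperedDistribution.fourierMultiplierCLM ℂ ρ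
          (tdist (ps a (cv volume kθ w₁) * ps a w₂)) ∧
      ‖b‖ₑ ≤ 8 ^ d * C ^ 2 * K * (eLpNorm w₁ p volume * eLpNorm w₂ p volume) := by
  have hp1 : 1 ≤ p := le_trans (by norm_num) hp
  set K' : ℝ≥0∞ := 8 ^ d * C ^ 2 * K with hK'
  have hK't : K' < ∞ := ENNReal.mul_lt_top (ENNReal.mul_lt_top (ENNReal.pow_lt_top (by simp))
    (ENNReal.pow_lt_top hCt)) hKt
  have hex : ∀ u v : 𝓢(Sp d, ℂ), ∃ b : L2 d, IsBil a θ ρ (u.toLp 2 volume) (v.toLp 2 volume) b ∧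
      ‖b‖ₑ ≤ K' * (eLpNorm u p volume * eLpNorm v p volume) := fun u v => by
    obtain ⟨b, h1, h2⟩ := exists_isBil a hC hθ hρ hK (isL12_schwartz (𝓕 u)) (isL12_schwartz (𝓕 v))
      (fourier_toLp_schwartz u) (fourier_toLp_schwartz v)
    rw [eLpNorm_congr_ae (u.coeFn_toLp 2 volume), eLpNorm_congr_ae (v.coeFn_toLp 2 volume)] at h2
    exact ⟨b, h1, h2⟩
  obtain ⟨u, hu⟩ := exists_schwartz_seq hp1 hpt hw₁
  obtain ⟨v, hv⟩ := exists_schwartz_seq hp1 hpt hw₂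
  have hum : ∀ n, MemLp (u n) p volume := fun n => (u n).memLp p volume
  have hvm : ∀ n, MemLp (v n) p volume := fun n => (v n).memLp p volume
  choose b hb hbn using fun n => hex (u n) (v n)
  set δ : ℕ → ℝ≥0∞ := fun n => eLpNorm (⇑(u n) - w₁) p volume
  set δ' : ℕ → ℝ≥0∞ := fun n => eLpNorm (⇑(v n) - w₂) p volume
  set W₁ := eLpNorm w₁ p volume
  set W₂ := eLpNorm w₂ p volume
  have hW₁ : W₁ ≠ ∞ := hw₁.2.ne
  have hW₂ : W₂ ≠ ∞ := hw₂.2.ne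
  have hub : ∀ n, eLpNorm (u n) p volume ≤ W₁ + δ n := tendsto_eLpNorm_bdd hp1 hum hw₁
  have hvb : ∀ n, eLpNorm (v n) p volume ≤ W₂ + δ' n := tendsto_eLpNorm_bdd hp1 hvm hw₂
  have hsub : ∀ {f : ℕ → 𝓢(Sp d, ℂ)} {w : Sp d → ℂ} (_ : MemLp w p volume) (n m : ℕ),
      eLpNorm (f n - f m : 𝓢(Sp d, ℂ)) p volume ≤
        eLpNorm (⇑(f n) - w) p volume + eLpNorm (⇑(f m) - w) p volume := fun {f w} hw n m => by
    have e : ((f n - f m : 𝓢(Sp d, ℂ)) : Sp d → ℂ) = (⇑(f n) - w) - (⇑(f m) - w) := by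
      ext x; simp
    rw [e]
    exact eLpNorm_sub_le (((f n).memLp p volume).sub hw).1 (((f m).memLp p volume).sub hw).1 hp1
  -- By bilinearity, differences of the approximate values are controlled by differences of the
  -- arguments, so the values form a Cauchy sequence in `L²`.
  have hdiff : ∀ n m, ‖b n - b m‖ₑ ≤ K' * ((δ n + δ m) * (W₂ + δ' n)) +
      K' * ((W₁ + δ m) * (δ' n + δ' m)) := fun n m => by
    obtain ⟨c, hc, hcn⟩ := hex (u n - u m) (v n)
    obtain ⟨c', hc', hcn'⟩ := hex (u m) (v n - v m)
    have h1 := (hb n).sub_eq (hb m) (b := c) (b' := c') hc hc'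
    rw [h1]
    refine (enorm_add_le _ _).trans (add_le_add (hcn.trans ?_) (hcn'.trans ?_))
    · gcongr
      · exact hsub hw₁ n m
      · exact hvb n
    · gcongr
      · exact hub m
      · exact hsub hw₂ n m
  have hcau : CauchySeq b := by
    rw [cauchySeq_iff_tendsto_dist_atTop_0]
    have t1 : Tendsto (fun z : ℕ × ℕ => δ z.1) atTop (𝓝 0) :=
      hu.comp (tendsto_fst.mono_left (le_of_eq prod_atTop_atTop_eq.symm))
    have t2 : Tendsto (fun z : ℕ × ℕ => δ z.2) atTop (𝓝 0) :=
      hu.comp (tendsto_snd.mono_left (le_of_eq prod_atTop_atTop_eq.symm))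
    have t3 : Tendsto (fun z : ℕ × ℕ => δ' z.1) atTop (𝓝 0) :=
      hv.comp (tendsto_fst.mono_left (le_of_eq prod_atTop_atTop_eq.symm))
    have t4 : Tendsto (fun z : ℕ × ℕ => δ' z.2) atTop (𝓝 0) :=
      hv.comp (tendsto_snd.mono_left (le_of_eq prod_atTop_atTop_eq.symm))
    have t : Tendsto (fun z : ℕ × ℕ => K' * ((δ z.1 + δ z.2) * (W₂ + δ' z.1)) +
        K' * ((W₁ + δ z.2) * (δ' z.1 + δ' z.2))) atTop (𝓝 0) := by
      have i1 := ENNReal.Tendsto.const_mul (a := K') (ENNReal.Tendsto.mul (t1.add t2)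
        (Or.inr (by simpa using hW₂)) (t3.const_add W₂) (Or.inr (by simp))) (Or.inr hK't.ne)
      have i2 := ENNReal.Tendsto.const_mul (a := K') (ENNReal.Tendsto.mul (t2.const_add W₁)
        (Or.inr (by simp)) (t3.add t4) (Or.inr (by simpa using hW₁))) (Or.inr hK't.ne)
      simpa using i1.add i2
    have t' : Tendsto (fun z : ℕ × ℕ => ‖b z.1 - b z.2‖ₑ) atTop (𝓝 0) :=
      tendsto_of_tendsto_of_tendsto_of_le_of_le tendsto_const_nhds t (fun _ => zero_le)
        fun z => hdiff z.1 z.2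
    have := (ENNReal.tendsto_toReal ENNReal.zero_ne_top).comp t'
    refine this.congr fun z => ?_
    simp [dist_eq_norm]
  obtain ⟨b₀, hb₀⟩ := cauchySeq_tendsto_of_complete hcau
  refine ⟨b₀, ?_, ?_⟩
  -- The limit is identified after `e^{-aΛ₁}`: one side converges in `L²`, the product in `L^{p/2}`,
  -- and the two limits agree as distributions.
  · have l1 : Tendsto (fun n => tdist (fm (esym fun _ => a) (b n))) atTop
        (𝓝 (tdist (fm (esym fun _ => a) b₀))) := by
      have h1 := ((fm (esym fun _ => a)).continuous.tendsto b₀).comp hb₀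
      rw [Lp.tendsto_Lp_iff_tendsto_eLpNorm'] at h1
      exact tendsto_tdist (q := 2) (by norm_num) (fun n => Lp.memLp _) (Lp.memLp _) h1
    have hkt := hθ.int
    have m1 : ∀ n, MemLp (cv volume kθ (u n)) p volume := fun n => MemLp.cv hθ.meas hkt hp1 (hum n)
    have m1' : MemLp (cv volume kθ w₁) p volume := MemLp.cv hθ.meas hkt hp1 hw₁
    have l2 := tendsto_tdist_mul hp (fun n => memLp_ps a hp1 (m1 n)) (fun n => memLp_ps a hp1 (hvm n))
      (memLp_ps a hp1 m1') (memLp_ps a hp1 hw₂)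
      (tendsto_cv measurable_const (integrable_const 1) hp1 m1 m1'
        (tendsto_cv hθ.meas hkt hp1 hum hw₁ hu))
      (tendsto_cv measurable_const (integrable_const 1) hp1 hvm hw₂ hv)
    have l3 := ((TemperedDistribution.fourierMultiplierCLM ℂ ρ).continuous.tendsto _).comp l2
    refine tendsto_nhds_unique l1 (l3.congr fun n => ?_)
    obtain ⟨P, hP1, hP2⟩ := hb n
    rw [hP2, ← tdist_fm hρ hρt, Function.comp_apply]
    congr 1
    refine tdist_congr ?_
    have e1 : fm (esym fun _ => a) (fm θ ((u n).toLp 2 volume)) =ᵐ[volume]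
        ps a (cv volume kθ (u n)) :=
      (fm_esym_ae a _).trans (ps_congr_ae a ((fm_eq_cv hθ _).trans
        (cv_congr_ae ((u n).coeFn_toLp 2 volume))))
    have e2 : fm (esym fun _ => a) ((v n).toLp 2 volume) =ᵐ[volume] ps a (v n) :=
      (fm_esym_ae a _).trans (ps_congr_ae a ((v n).coeFn_toLp 2 volume))
    filter_upwards [hP1, e1, e2] with x i1 i2 i3
    rw [i1, i2, i3, Pi.mul_apply]
  · have t : Tendsto (fun n => K' * ((W₁ + δ n) * (W₂ + δ' n))) atTop (𝓝 (K' * (W₁ * W₂))) := by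
      have i1 := ENNReal.Tendsto.const_mul (a := K') (ENNReal.Tendsto.mul (hu.const_add W₁)
        (Or.inr (by simpa using hW₂)) (hv.const_add W₂) (Or.inr (by simpa using hW₁)))
        (Or.inr hK't.ne)
      simpa using i1
    refine le_of_tendsto_of_tendsto' hb₀.enorm t fun n => (hbn n).trans ?_
    gcongr
    · exact hub n
    · exact hvb n

/-! ### Dyadic symbols -/

/-- The Fourier multiplier with symbol `m` on tempered distributions. -/
abbrev md (m : Sp d → ℂ) : TDist d →L[ℂ] TDist d := TemperedDistribution.fourierMultiplierCLM ℂ m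

theorem md_md {m n : Sp d → ℂ} (hm : m.HasTemperateGrowth) (hn : n.HasTemperateGrowth)
    (u : TDist d) : md m (md n u) = md (m * n) u := by
  rw [md, md, md, TemperedDistribution.fourierMultiplierCLM_fourierMultiplierCLM_apply hn hm,
    mul_comm]

theorem md_sub {m n : Sp d → ℂ} (hm : m.HasTemperateGrowth) (hn : n.HasTemperateGrowth)
    (u : TDist d) : md (m - n) u = md m u - md n u := by
  ext φ
  have h : ∀ φ ψ : 𝓢(Sp d, ℂ), 𝓕 (φ - ψ) = 𝓕 φ - 𝓕 ψ :=
    map_sub (FourierTransform.fourierCLM ℂ 𝓢(Sp d, ℂ))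
  simp [md, TemperedDistribution.fourierMultiplierCLM_apply_apply, SchwartzMap.smulLeftCLM_sub hm hn,
    h]

theorem md_sum {ι : Type*} (s : Finset ι) {m : ι → Sp d → ℂ}
    (hm : ∀ i ∈ s, (m i).HasTemperateGrowth) (u : TDist d) :
    md (fun ξ => ∑ i ∈ s, m i ξ) u = ∑ i ∈ s, md (m i) u := by
  rw [md, TemperedDistribution.fourierMultiplierCLM_sum ℂ hm, _root_.sum_apply]

/-- The symbol `m(2^{-j} 2πξ)`. -/
def symb (m : Sp d → ℝ) (j : ℤ) (ξ : Sp d) : ℂ :=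
  ((m ((2 : ℝ) ^ (-j) • ((2 * Real.pi) • ξ)) : ℝ) : ℂ)

theorem dyadic_eq (m : Sp d → ℝ) (j : ℤ) (u : TDist d) : dyadic m j u = md (symb m j) u := rfl

/-- Smooth compactly supported functions. -/
def IsTest (m : Sp d → ℝ) : Prop := ContDiff ℝ (⊤ : ℕ∞) m ∧ HasCompactSupport m

theorem IsTest.comp_smul {m : Sp d → ℝ} (hm : IsTest m) {c : ℝ} (hc : c ≠ 0) :
    IsTest fun ξ => m (c • ξ) :=
  ⟨hm.1.comp (by fun_prop), hm.2.comp_smul hc⟩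

theorem IsTest.exists_schwartz {m : Sp d → ℝ} (hm : IsTest m) :
    ∃ φ : 𝓢(Sp d, ℂ), ∀ ξ, φ ξ = (m ξ : ℂ) := by
  have h1 : HasCompactSupport (Complex.ofRealCLM ∘ m) := hm.2.comp_left rfl
  have h2 : ContDiff ℝ (⊤ : ℕ∞) (Complex.ofRealCLM ∘ m) := Complex.ofRealCLM.contDiff.comp hm.1
  exact ⟨h1.toSchwartzMap h2, fun ξ => rfl⟩

theorem IsTest.exists_schwartz_symb {m : Sp d → ℝ} (hm : IsTest m) (j : ℤ) :
    ∃ φ : 𝓢(Sp d, ℂ), symb m j = φ := by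
  obtain ⟨φ, hφ⟩ := (hm.comp_smul (c := (2 : ℝ) ^ (-j) * (2 * Real.pi))
    (by positivity)).exists_schwartz
  refine ⟨φ, funext fun ξ => ?_⟩
  rw [hφ, symb, smul_smul]

theorem IsTest.temperate {m : Sp d → ℝ} (hm : IsTest m) (j : ℤ) :
    (symb m j).HasTemperateGrowth := by
  obtain ⟨φ, hφ⟩ := hm.exists_schwartz_symb j
  rw [hφ]; exact φ.hasTemperateGrowth

/-- The kernel of `m(D)`. -/
def ker0 (m : Sp d → ℝ) : Sp d → ℂ := 𝓕⁻ (symb m 0)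

/-- The kernel of `m(2^{-j} D)`. -/
def dker (m : Sp d → ℝ) (j : ℤ) (x : Sp d) : ℂ :=
  ((((2 : ℝ) ^ j) ^ d : ℝ) : ℂ) * ker0 m ((2 : ℝ) ^ j • x)

/-- The constant in Bernstein's inequality. -/
def kC (m : Sp d → ℝ) : ℝ≥0∞ := 1 + ((∫⁻ y, ‖ker0 m y‖ₑ) + ⨆ y, ‖ker0 m y‖ₑ)

theorem one_le_kC (m : Sp d → ℝ) : 1 ≤ kC m := le_self_add

theorem IsTest.ker0_eq {m : Sp d → ℝ} (hm : IsTest m) :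
    ∃ k : 𝓢(Sp d, ℂ), ker0 m = k ∧ IsKer volume k (symb m 0) := by
  obtain ⟨φ, hφ⟩ := hm.exists_schwartz_symb 0
  refine ⟨𝓕⁻ φ, ?_, ?_⟩
  · rw [ker0, hφ, SchwartzMap.fourierInv_coe]
  · rw [hφ]; exact isKer_schwartz φ

theorem IsTest.kC_lt_top {m : Sp d → ℝ} (hm : IsTest m) : kC m < ∞ := by
  obtain ⟨k, hk, -⟩ := hm.ker0_eq
  rw [kC, hk]
  refine ENNReal.add_lt_top.2 ⟨ENNReal.one_lt_top, ?_⟩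
  refine ENNReal.add_lt_top.2 ⟨(k.integrable (μ := volume)).2, ?_⟩
  obtain ⟨C, hC⟩ := k.decay 0 0
  refine (iSup_le fun y => ?_ : _ ≤ ENNReal.ofReal C).trans_lt ENNReal.ofReal_lt_top
  rw [← ofReal_norm]
  exact ENNReal.ofReal_le_ofReal (by simpa using hC.2 y)

theorem IsTest.isKer {m : Sp d → ℝ} (hm : IsTest m) (j : ℤ) :
    IsKer volume (dker m j) (symb m j) := by
  obtain ⟨k, hk, hker⟩ := hm.ker0_eq
  have h2 : ((2 : ℝ) ^ j) ≠ 0 := by positivity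
  refine ⟨?_, ?_, fun ξ => ?_⟩
  · unfold dker; rw [hk]
    exact (Continuous.measurable (by fun_prop))
  · unfold dker; rw [hk]
    exact ((integrable_comp_smul_iff volume _ h2).2 k.integrable).const_mul _
  · have h1 := hker.eq ((2 : ℝ) ^ (-j) • ξ)
    have h3 := Measure.integral_comp_smul (volume : Measure (Sp d))
      (fun y => (Real.fourierChar (-(inner ℝ y ((2 : ℝ) ^ (-j) • ξ))) : ℂ) * k y) ((2 : ℝ) ^ j)
    rw [← h1] at h3
    have e : symb m 0 ((2 : ℝ) ^ (-j) • ξ) = symb m j ξ := by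
      simp only [symb, neg_zero, zpow_zero, one_smul]
      rw [smul_comm]
    rw [e, finrank_euclideanSpace_fin, abs_of_pos (by positivity)] at h3
    have h4 : ∫ y, (Real.fourierChar (-(inner ℝ y ξ)) : ℂ) * dker m j y =
        ((((2 : ℝ) ^ j) ^ d : ℝ) : ℂ) * ∫ y : Sp d, (Real.fourierChar (-(inner ℝ ((2 : ℝ) ^ j • y)
          ((2 : ℝ) ^ (-j) • ξ))) : ℂ) * k ((2 : ℝ) ^ j • y) := by
      rw [← integral_const_mul]
      refine integral_congr_ae (ae_of_all _ fun y => ?_)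
      simp only [dker, hk]
      rw [real_inner_smul_left, real_inner_smul_right, ← mul_assoc ((2 : ℝ) ^ j),
        ← zpow_add₀ two_ne_zero, add_neg_cancel, zpow_zero, one_mul]
      ring
    rw [h4, h3, Complex.real_smul, ← mul_assoc, ← Complex.ofReal_mul,
      mul_inv_cancel₀ (by positivity), Complex.ofReal_one, one_mul]

theorem IsTest.lintegral_dker_le {m : Sp d → ℝ} (hm : IsTest m) (j : ℤ) :
    ∫⁻ y, ‖dker m j y‖ₑ ≤ kC m := by
  refine le_trans (le_of_eq ?_) (le_self_add.trans le_add_self : (∫⁻ y, ‖ker0 m y‖ₑ) ≤ kC m)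
  obtain ⟨k, hk, hker⟩ := hm.ker0_eq
  rw [← ofReal_integral_norm_eq_lintegral_enorm (hm.isKer j).int,
    ← ofReal_integral_norm_eq_lintegral_enorm (by rw [hk]; exact k.integrable)]
  congr 1
  have h3 := Measure.integral_comp_smul (volume : Measure (Sp d)) (fun y => ‖ker0 m y‖)
    ((2 : ℝ) ^ j)
  rw [finrank_euclideanSpace_fin, abs_of_pos (by positivity), smul_eq_mul] at h3
  simp only [dker, norm_mul, Complex.norm_real]
  rw [integral_const_mul, h3, ← mul_assoc, Real.norm_eq_abs, abs_of_pos (by positivity),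
    mul_inv_cancel₀ (by positivity), one_mul]

/-- The scale factor `2^{jd}`. -/
def scl (d : ℕ) (j : ℤ) : ℝ≥0∞ := ENNReal.ofReal (((2 : ℝ) ^ j) ^ d)

theorem scl_rpow (j : ℤ) (s : ℝ) : scl d j ^ s = ENNReal.ofReal (2 ^ ((j : ℝ) * (d * s))) := by
  rw [scl, ENNReal.ofReal_rpow_of_pos (by positivity), ← Real.rpow_intCast, ← Real.rpow_natCast,
    ← Real.rpow_mul two_pos.le, ← Real.rpow_mul two_pos.le]
  congr 2; ring

theorem enorm_dker_le (m : Sp d → ℝ) (j : ℤ) (y : Sp d) : ‖dker m j y‖ₑ ≤ kC m * scl d j := by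
  rw [dker, enorm_mul, mul_comm, scl]
  gcongr
  · exact (le_iSup (fun y => ‖ker0 m y‖ₑ) _).trans (le_add_self.trans le_add_self)
  · rw [← ofReal_norm, Complex.norm_real, Real.norm_eq_abs, abs_of_pos (by positivity)]

/-- The operator `m(2^{-j} D)` on functions. -/
def dop (m : Sp d → ℝ) (j : ℤ) (w : Sp d → ℂ) : Sp d → ℂ := cv volume (dker m j) w

theorem IsTest.memLp_dop {m : Sp d → ℝ} (hm : IsTest m) (j : ℤ) {q : ℝ≥0∞} (hq : 1 ≤ q)
    {w : Sp d → ℂ} (hw : MemLp w q volume) : MemLp (dop m j w) q volume :=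
  MemLp.cv (hm.isKer j).meas (hm.isKer j).int hq hw

theorem IsTest.bernstein {m : Sp d → ℝ} (hm : IsTest m) (j : ℤ) {w : Sp d → ℂ}
    (hw : AEStronglyMeasurable w volume) {q r : ℝ≥0∞} (hq : 1 ≤ q) (hqr : q ≤ r) :
    eLpNorm (dop m j w) r volume ≤
      kC m * scl d j ^ (1 / q.toReal - 1 / r.toReal) * eLpNorm w q volume :=
  GevreyBesov.bernstein (hm.isKer j).meas (hm.lintegral_dker_le j) (enorm_dker_le m j) hw hq hqr
    hm.kC_lt_top

theorem IsTest.eLpNorm_dop_le {m : Sp d → ℝ} (hm : IsTest m) (j : ℤ) {w : Sp d → ℂ}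
    (hw : AEStronglyMeasurable w volume) {q : ℝ≥0∞} (hq : 1 ≤ q) :
    eLpNorm (dop m j w) q volume ≤ kC m * eLpNorm w q volume := by
  have := hm.bernstein j hw hq le_rfl
  simpa using this

theorem IsTest.memLp_dop_of_le {m : Sp d → ℝ} (hm : IsTest m) (j : ℤ) {q r : ℝ≥0∞} (hq : 1 ≤ q)
    (hqr : q ≤ r) {w : Sp d → ℂ} (hw : MemLp w q volume) : MemLp (dop m j w) r volume := by
  refine ⟨(hm.memLp_dop j hq hw).1, (hm.bernstein j hw.1 hq hqr).trans_lt ?_⟩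
  refine ENNReal.mul_lt_top (ENNReal.mul_lt_top hm.kC_lt_top ?_) hw.2
  rw [scl_rpow]; exact ENNReal.ofReal_lt_top

theorem IsTest.rep_dyadic {m : Sp d → ℝ} (hm : IsTest m) (j : ℤ) {q : ℝ≥0∞} (hq : 1 ≤ q)
    {w : Sp d → ℂ} {u : TDist d} (h : Rep q w u) : Rep q (dop m j w) (dyadic m j u) :=
  (hm.isKer j).represents (hm.temperate j) hq h

theorem IsTest.memLp_symb {m : Sp d → ℝ} (hm : IsTest m) (j : ℤ) : MemLp (symb m j) ∞ volume :=
  (hm.isKer j).memLp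

theorem IsTest.fm_symb_ae {m : Sp d → ℝ} (hm : IsTest m) (j : ℤ) (b : L2 d) :
    fm (symb m j) b =ᵐ[volume] dop m j b := fm_eq_cv (hm.isKer j) b

theorem IsTest.dyadic_tdist {m : Sp d → ℝ} (hm : IsTest m) (j : ℤ) (b : L2 d) :
    dyadic m j (tdist b) = tdist (fm (symb m j) b) := tdist_fm (hm.memLp_symb j) (hm.temperate j) b

theorem IsTest.distLpNorm_dyadic_le {m : Sp d → ℝ} (hm : IsTest m) (j : ℤ) (u : TDist d)
    {q : ℝ≥0∞} (hq : 1 ≤ q) : distLpNorm q (dyadic m j u) ≤ kC m * distLpNorm q u := by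
  rcases eq_or_ne (distLpNorm q u) ∞ with h | h
  · rw [h]
    -- The summand `1` in `kC` matters here: `kC m` is nonzero, so `kC m * ∞ = ∞`.
    rw [ENNReal.mul_top (one_pos.trans_le (one_le_kC m)).ne']; exact le_top
  · obtain ⟨w, hw⟩ := exists_rep_of_distLpNorm_lt (lt_top_iff_ne_top.2 h)
    rw [distLpNorm_eq hq hw, distLpNorm_eq hq (hm.rep_dyadic j hq hw)]
    exact hm.eLpNorm_dop_le j hw.1.1 hq

/-! ### Littlewood-Paley decomposition -/

theorem IsCutoff.isTest {χ : Sp d → ℝ} (hχ : IsCutoff χ) : IsTest χ := by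
  refine ⟨hχ.smooth, HasCompactSupport.intro (isCompact_closedBall (0 : Sp d) (4 / 3)) fun ξ hξ => ?_⟩
  exact hχ.eq_zero ξ (by simpa using hξ)

theorem IsCutoff.isTest_annulus {χ : Sp d → ℝ} (hχ : IsCutoff χ) : IsTest (annulus χ) := by
  have h := hχ.isTest
  have h1 := h.comp_smul (c := (2 : ℝ)⁻¹) (by norm_num)
  exact ⟨h1.1.sub h.1, h1.2.sub h.2⟩

theorem norm_dil (j : ℤ) (ξ : Sp d) :
    ‖(2 : ℝ) ^ (-j) • ((2 * Real.pi) • ξ)‖ = ((2 : ℝ) ^ j)⁻¹ * (2 * Real.pi * ‖ξ‖) := by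
  rw [norm_smul, norm_smul, zpow_neg, Real.norm_eq_abs, Real.norm_eq_abs, abs_of_pos (by positivity),
    abs_of_pos (by positivity)]

theorem IsCutoff.symb_eq_one {χ : Sp d → ℝ} (hχ : IsCutoff χ) {j : ℤ} {ξ : Sp d}
    (h : 2 * Real.pi * ‖ξ‖ < 3 / 4 * 2 ^ j) : symb χ j ξ = 1 := by
  rw [symb, hχ.eq_one]; · simp
  rw [norm_dil, inv_mul_lt_iff₀ (by positivity), mul_comm (_ ^ j)]; exact h

theorem IsCutoff.symb_eq_zero {χ : Sp d → ℝ} (hχ : IsCutoff χ) {j : ℤ} {ξ : Sp d}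
    (h : 4 / 3 * 2 ^ j < 2 * Real.pi * ‖ξ‖) : symb χ j ξ = 0 := by
  rw [symb, hχ.eq_zero]; · simp
  rw [norm_dil, lt_inv_mul_iff₀ (by positivity), mul_comm (_ ^ j)]; exact h

theorem symb_annulus (χ : Sp d → ℝ) (j : ℤ) : symb (annulus χ) j = symb χ (j + 1) - symb χ j := by
  ext ξ
  simp only [symb, annulus, Pi.sub_apply, Complex.ofReal_sub]
  congr 3
  rw [smul_smul, neg_add, zpow_add₀ two_ne_zero, mul_comm]
  simp

theorem IsCutoff.symb_annulus_eq_zero {χ : Sp d → ℝ} (hχ : IsCutoff χ) {j : ℤ} {ξ : Sp d}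
    (h : 2 * Real.pi * ‖ξ‖ < 3 / 4 * 2 ^ j ∨ 8 / 3 * 2 ^ j < 2 * Real.pi * ‖ξ‖) :
    symb (annulus χ) j ξ = 0 := by
  have h2 : (2 : ℝ) ^ (j + 1) = 2 * 2 ^ j := by rw [zpow_add₀ two_ne_zero, zpow_one, mul_comm]
  have h0 : (0 : ℝ) < 2 ^ j := by positivity
  rw [symb_annulus, Pi.sub_apply]
  rcases h with h | h
  · rw [hχ.symb_eq_one h, hχ.symb_eq_one (by rw [h2]; linarith), sub_self]
  · rw [hχ.symb_eq_zero (by linarith : 4 / 3 * (2 : ℝ) ^ j < 2 * Real.pi * ‖ξ‖),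
      hχ.symb_eq_zero (by rw [h2]; linarith), sub_self]

theorem IsCutoff.mem_of_symb_annulus_ne_zero {χ : Sp d → ℝ} (hχ : IsCutoff χ) {j : ℤ} {ξ : Sp d}
    (h : symb (annulus χ) j ξ ≠ 0) :
    3 / 4 * 2 ^ j ≤ 2 * Real.pi * ‖ξ‖ ∧ 2 * Real.pi * ‖ξ‖ ≤ 8 / 3 * 2 ^ j := by
  by_contra h'
  rw [not_and_or, not_le, not_le] at h'
  exact h (hχ.symb_annulus_eq_zero h')

theorem IsCutoff.le_of_symb_ne_zero {χ : Sp d → ℝ} (hχ : IsCutoff χ) {j : ℤ} {ξ : Sp d}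
    (h : symb χ j ξ ≠ 0) : 2 * Real.pi * ‖ξ‖ ≤ 4 / 3 * 2 ^ j := by
  by_contra! h'
  exact h (hχ.symb_eq_zero h')

theorem two_zpow_le {i j : ℤ} (n : ℕ) (h : i + n ≤ j) : (2 : ℝ) ^ n * 2 ^ i ≤ 2 ^ j := by
  rw [← zpow_natCast, ← zpow_add₀ two_ne_zero]
  exact zpow_le_zpow_right₀ (by norm_num) (by omega)

theorem IsCutoff.chi_mul_annulus {χ : Sp d → ℝ} (hχ : IsCutoff χ) {i j : ℤ} (h : j + 2 ≤ i) :
    symb χ i * symb (annulus χ) j = symb (annulus χ) j := by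
  ext ξ
  rw [Pi.mul_apply]
  by_cases hne : symb (annulus χ) j ξ = 0
  · rw [hne, mul_zero]
  · have h1 := hχ.mem_of_symb_annulus_ne_zero hne
    have hj : (0 : ℝ) < 2 ^ j := by positivity
    -- `8/3 < 3/4 * 2^2`.
    have := two_zpow_le 2 h
    rw [hχ.symb_eq_one (by linarith), one_mul]

theorem IsCutoff.chi_mul_annulus_eq_zero {χ : Sp d → ℝ} (hχ : IsCutoff χ) {i j : ℤ}
    (h : i + 1 ≤ j) : symb χ i * symb (annulus χ) j = 0 := by
  ext ξ
  rw [Pi.mul_apply, Pi.zero_apply]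
  by_contra hne
  have h1 := hχ.le_of_symb_ne_zero (left_ne_zero_of_mul hne)
  have h2 := hχ.mem_of_symb_annulus_ne_zero (right_ne_zero_of_mul hne)
  have hi : (0 : ℝ) < 2 ^ i := by positivity
  -- `4/3 < 3/4 * 2`.
  have := two_zpow_le 1 h
  linarith

theorem sum_Ico_symb_annulus (χ : Sp d → ℝ) {M N : ℤ} (h : M ≤ N) :
    ∑ j ∈ Finset.Ico M N, symb (annulus χ) j = symb χ N - symb χ M := by
  induction N, h using Int.leInduction with
  | base => simp
  | succ n hn ih =>
    have e : Finset.Ico M (n + 1) = insert n (Finset.Ico M n) := by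
      ext x; simp only [Finset.mem_Ico, Finset.mem_insert]; omega
    rw [e, Finset.sum_insert (by simp), ih, symb_annulus]
    ring

theorem IsCutoff.sum_block {χ : Sp d → ℝ} (hχ : IsCutoff χ) {M N : ℤ} (h : M ≤ N) (u : TDist d) :
    ∑ j ∈ Finset.Ico M N, block χ j u = lowCut χ N u - lowCut χ M u := by
  simp only [block, lowCut, dyadic_eq]
  rw [← md_sub (hχ.isTest.temperate N) (hχ.isTest.temperate M), ← sum_Ico_symb_annulus χ h,
    ← md_sum _ fun j _ => hχ.isTest_annulus.temperate j]
  congr 2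
  ext ξ; simp

/-- Three neighbouring annuli telescope to the cutoff at level `j + 2` minus that at level `j - 1`;
the first is `1` and the second is `0` on the support of the middle annulus. -/
theorem IsCutoff.annulus_fattened {χ : Sp d → ℝ} (hχ : IsCutoff χ) (j : ℤ) :
    (symb (annulus χ) (j - 1) + symb (annulus χ) j + symb (annulus χ) (j + 1)) *
      symb (annulus χ) j = symb (annulus χ) j := by
  have e : symb (annulus χ) (j - 1) + symb (annulus χ) j + symb (annulus χ) (j + 1) =
      symb χ (j + 2) - symb χ (j - 1) := by
    rw [symb_annulus, symb_annulus, symb_annulus, sub_add_cancel, show j + 1 + 1 = j + 2 by ring]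
    ring
  rw [e, sub_mul, hχ.chi_mul_annulus le_rfl, hχ.chi_mul_annulus_eq_zero (by omega), sub_zero]

/-! ### Products of frequency localized functions -/

/-- The Fourier transform of a product is supported in the sum of the supports. -/
theorem md_tdist_mul_eq_zero {p : ℝ≥0∞} (hp : 2 ≤ p) (hpt : p ≠ ∞) {θ₁ θ₂ ρ k₁ k₂ : Sp d → ℂ}
    (h₁ : IsKer volume k₁ θ₁) (h₂ : IsKer volume k₂ θ₂) (hρ : MemLp ρ ∞ volume)
    (hρt : ρ.HasTemperateGrowth) (h0 : ∀ ξ η, ρ (ξ + η) * (θ₁ ξ * θ₂ η) = 0) {w₁ w₂ : Sp d → ℂ}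
    (hw₁ : MemLp w₁ p volume) (hw₂ : MemLp w₂ p volume) :
    md ρ (tdist (cv volume k₁ w₁ * cv volume k₂ w₂)) = 0 := by
  have hp1 : 1 ≤ p := le_trans (by norm_num) hp
  obtain ⟨u, hu⟩ := exists_schwartz_seq hp1 hpt hw₁
  obtain ⟨v, hv⟩ := exists_schwartz_seq hp1 hpt hw₂
  have hum : ∀ n, MemLp (u n) p volume := fun n => (u n).memLp p volume
  have hvm : ∀ n, MemLp (v n) p volume := fun n => (v n).memLp p volume
  have l := tendsto_tdist_mul hp (fun n => MemLp.cv h₁.meas h₁.int hp1 (hum n))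
    (fun n => MemLp.cv h₂.meas h₂.int hp1 (hvm n)) (MemLp.cv h₁.meas h₁.int hp1 hw₁)
    (MemLp.cv h₂.meas h₂.int hp1 hw₂) (tendsto_cv h₁.meas h₁.int hp1 hum hw₁ hu)
    (tendsto_cv h₂.meas h₂.int hp1 hvm hw₂ hv)
  refine tendsto_nhds_unique (((md ρ).continuous.tendsto _).comp l)
    (tendsto_const_nhds.congr fun n => ?_)
  have hg : ∀ φ : 𝓢(Sp d, ℂ), ∀ {θ k : Sp d → ℂ}, IsKer volume k θ →
      IsL12 (fun ξ => θ ξ * (𝓕 φ : 𝓢(Sp d, ℂ)) ξ) := fun φ θ k h =>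
    (isL12_schwartz (𝓕 φ)).mul_bdd h.continuous.measurable h.norm_le
  obtain ⟨P, hP1, hP2⟩ := exists_mul_of_isL12 (hg (u n) h₁) (hg (v n) h₂)
    (fourier_fm_of h₁.memLp (fourier_toLp_schwartz (u n)))
    (fourier_fm_of h₂.memLp (fourier_toLp_schwartz (v n)))
  have e1 := (fm_eq_cv h₁ _).trans (cv_congr_ae ((u n).coeFn_toLp 2 volume))
  have e2 := (fm_eq_cv h₂ _).trans (cv_congr_ae ((v n).coeFn_toLp 2 volume))
  have e3 : tdist (cv volume k₁ (u n) * cv volume k₂ (v n)) = tdist P := by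
    refine tdist_congr ?_
    filter_upwards [hP1, e1, e2] with x i1 i2 i3
    rw [i1, i2, i3, Pi.mul_apply]
  have e4 : fm ρ P = 0 := by
    refine fourier_ext ?_
    have h3 : (𝓕 (0 : L2 d) : L2 d) = 0 := (FourierTransform.fourierCLM ℂ (L2 d)).map_zero
    rw [h3]
    filter_upwards [fourier_fm_of hρ hP2, Lp.coeFn_zero ℂ 2 (volume : Measure (Sp d))] with ξ i1 i2
    rw [i1, i2, Pi.zero_apply, cv, ← integral_const_mul]
    refine (integral_congr_ae (ae_of_all _ fun y => ?_)).trans (integral_zero _ _)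
    have h4 := h0 y (ξ - y)
    rw [add_sub_cancel] at h4
    linear_combination ((𝓕 (u n) : 𝓢(Sp d, ℂ)) y * (𝓕 (v n) : 𝓢(Sp d, ℂ)) (ξ - y)) * h4
  rw [Function.comp_apply, e3, tdist_fm hρ hρt, e4, tdist_congr (Lp.coeFn_zero ℂ 2 volume),
    tdist_zero]

/-- A function equal to `1` on the support of `annulus χ`. -/
def fat (χ : Sp d → ℝ) (ξ : Sp d) : ℝ :=
  annulus χ ((2 : ℝ) • ξ) + annulus χ ξ + annulus χ ((2 : ℝ)⁻¹ • ξ)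

theorem IsCutoff.isTest_fat {χ : Sp d → ℝ} (hχ : IsCutoff χ) : IsTest (fat χ) := by
  have h := hχ.isTest_annulus
  have h1 := h.comp_smul (c := (2 : ℝ)⁻¹) (by norm_num)
  have h2 := h.comp_smul (c := (2 : ℝ)) (by norm_num)
  exact ⟨(h2.1.add h.1).add h1.1, (h2.2.add h.2).add h1.2⟩

theorem symb_fat (χ : Sp d → ℝ) (j : ℤ) : symb (fat χ) j =
    symb (annulus χ) (j - 1) + symb (annulus χ) j + symb (annulus χ) (j + 1) := by
  ext ξ
  have e1 : (2 : ℝ) • ((2 : ℝ) ^ (-j) • ((2 * Real.pi) • ξ)) =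
      (2 : ℝ) ^ (-(j - 1)) • ((2 * Real.pi) • ξ) := by
    rw [smul_smul, neg_sub, sub_eq_add_neg, zpow_add₀ two_ne_zero, zpow_one]
  have e2 : (2 : ℝ)⁻¹ • ((2 : ℝ) ^ (-j) • ((2 * Real.pi) • ξ)) =
      (2 : ℝ) ^ (-(j + 1)) • ((2 * Real.pi) • ξ) := by
    rw [smul_smul, neg_add, zpow_add₀ two_ne_zero, zpow_neg_one, mul_comm]
  simp only [symb, fat, Pi.add_apply, Complex.ofReal_add, e1, e2]

theorem IsCutoff.dyadic_fat_block {χ : Sp d → ℝ} (hχ : IsCutoff χ) (j : ℤ) (u : TDist d) :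
    dyadic (fat χ) j (block χ j u) = block χ j u := by
  rw [block, dyadic_eq, dyadic_eq, md_md (hχ.isTest_fat.temperate j) (hχ.isTest_annulus.temperate j),
    symb_fat, hχ.annulus_fattened]

theorem IsCutoff.dop_fat_ae {χ : Sp d → ℝ} (hχ : IsCutoff χ) {j : ℤ} {u : TDist d} {q : ℝ≥0∞}
    (hq : 1 ≤ q) {w : Sp d → ℂ} (h : Rep q w (block χ j u)) : dop (fat χ) j w =ᵐ[volume] w := by
  have h1 := hχ.isTest_fat.rep_dyadic j hq h
  rw [hχ.dyadic_fat_block] at h1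
  exact Rep.unique hq hq h1 h

/-! ### Hölder and Bernstein inequalities for products in `L²` -/

/-- The exponent conjugate to `p`: `1/p* + 1/p = 1/2`. -/
theorem holderTriple_star {p : ℝ≥0∞} (hp : 2 ≤ p) :
    ENNReal.HolderTriple (2⁻¹ - p⁻¹)⁻¹ p 2 := ⟨by
  rw [inv_inv, tsub_add_cancel_of_le (ENNReal.inv_le_inv.2 hp)]⟩

/-- Here `p ≤ 4` enters: `p ≤ p*` means `1/p ≥ 1/2 - 1/p`. For `p = 2` the exponent `p*` is `∞`. -/
theorem le_star {p : ℝ} (hp : 2 ≤ p) (hp4 : p ≤ 4) :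
    ENNReal.ofReal p ≤ (2⁻¹ - (ENNReal.ofReal p)⁻¹)⁻¹ ∧
      1 / (ENNReal.ofReal p).toReal - 1 / ((2⁻¹ - (ENNReal.ofReal p)⁻¹)⁻¹).toReal =
        2 / p - 1 / 2 := by
  have hp0 : 0 < p := by linarith
  have e : (2⁻¹ - (ENNReal.ofReal p)⁻¹ : ℝ≥0∞) = ENNReal.ofReal (1 / 2 - 1 / p) := by
    rw [ENNReal.ofReal_sub _ (by positivity), one_div, one_div, ENNReal.ofReal_inv_of_pos two_pos,
      ENNReal.ofReal_inv_of_pos hp0]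
    simp
  have h2 : 1 / p ≤ 1 / 2 := one_div_le_one_div_of_le two_pos hp
  have h4 : 1 / 4 ≤ 1 / p := one_div_le_one_div_of_le hp0 hp4
  rw [e]
  constructor
  · rw [ENNReal.le_inv_iff_le_inv, ← ENNReal.ofReal_inv_of_pos hp0, ← one_div]
    exact ENNReal.ofReal_le_ofReal (by linarith)
  · rw [ENNReal.toReal_inv, ENNReal.toReal_ofReal hp0.le, ENNReal.toReal_ofReal (by linarith),
      one_div (1 / 2 - 1 / p)⁻¹, inv_inv]
    ring

/-- Hölder in `L^{p*} · L^p`, then Bernstein from `L^p` to `L^{p*}` on the localized factor. The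
loss is at the input frequency `2^k`, which suits the paraproduct. -/
theorem IsTest.eLpNorm_fm_mul_star_le {m : Sp d → ℝ} (hm : IsTest m) {p : ℝ} (hp : 2 ≤ p)
    (hp4 : p ≤ 4) (k : ℤ) {U V P : L2 d} (hP : P =ᵐ[volume] fun x => fm (symb m k) U x * V x) :
    eLpNorm P 2 volume ≤ kC m * ENNReal.ofReal (2 ^ ((k : ℝ) * (d * (2 / p - 1 / 2)))) *
      (eLpNorm U (ENNReal.ofReal p) volume * eLpNorm V (ENNReal.ofReal p) volume) := by
  have hp1 : 1 ≤ ENNReal.ofReal p := by simpa using by linarith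
  have := holderTriple_star (p := ENNReal.ofReal p) (by simpa using hp)
  have h := eLpNorm_smul_le_mul_eLpNorm (p := (2⁻¹ - (ENNReal.ofReal p)⁻¹)⁻¹)
    (q := ENNReal.ofReal p) (r := 2) (μ := volume) (Lp.aestronglyMeasurable V)
    (Lp.aestronglyMeasurable (fm (symb m k) U))
  rw [eLpNorm_congr_ae hP]
  refine h.trans ?_
  obtain ⟨h1, h2⟩ := le_star hp hp4
  rw [eLpNorm_congr_ae (hm.fm_symb_ae k U)]
  have h3 := hm.bernstein k (Lp.aestronglyMeasurable U) hp1 h1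
  rw [h2, scl_rpow] at h3
  rw [← mul_assoc]
  gcongr

/-- Hölder into `L^{p/2}`, then Bernstein from `L^{p/2}` to `L²`, possible because `p/2 ≤ 2`. The
loss is at the output frequency `2^j`, which suits the remainder, where `j` may be far below the
input frequencies. -/
theorem IsTest.eLpNorm_dyadic_mul_le {m m' : Sp d → ℝ} (hm : IsTest m) (hm' : IsTest m') {p : ℝ}
    (hp : 2 ≤ p) (hp4 : p ≤ 4) (j k : ℤ) {U V P : L2 d}
    (hP : P =ᵐ[volume] fun x => fm (symb m k) U x * V x) :
    eLpNorm (fm (symb m' j) P) 2 volume ≤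
      kC m' * kC m * ENNReal.ofReal (2 ^ ((j : ℝ) * (d * (2 / p - 1 / 2)))) *
      (eLpNorm U (ENNReal.ofReal p) volume * eLpNorm V (ENNReal.ofReal p) volume) := by
  have hp1 : 1 ≤ ENNReal.ofReal p := by simpa using by linarith
  have hp0 : 0 < p := by linarith
  have e2 : ENNReal.ofReal p / 2 = ENNReal.ofReal (p / 2) := by
    rw [ENNReal.ofReal_div_of_pos two_pos]; simp
  have hh1 : 1 ≤ ENNReal.ofReal p / 2 := by rw [e2]; simpa using by linarith
  have hh2 : ENNReal.ofReal p / 2 ≤ 2 := by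
    rw [e2, show (2 : ℝ≥0∞) = ENNReal.ofReal 2 by simp]
    exact ENNReal.ofReal_le_ofReal (by linarith)
  have := holderTriple_half (ENNReal.ofReal p)
  have h := eLpNorm_smul_le_mul_eLpNorm (p := ENNReal.ofReal p)
    (q := ENNReal.ofReal p) (r := ENNReal.ofReal p / 2) (μ := volume) (Lp.aestronglyMeasurable V)
    (Lp.aestronglyMeasurable (fm (symb m k) U))
  have hP' : eLpNorm P (ENNReal.ofReal p / 2) volume ≤
      eLpNorm (fm (symb m k) U) (ENNReal.ofReal p) volume * eLpNorm V (ENNReal.ofReal p) volume := by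
    rw [eLpNorm_congr_ae hP]; exact h
  rw [eLpNorm_congr_ae (hm.fm_symb_ae k U)] at hP'
  rw [eLpNorm_congr_ae (hm'.fm_symb_ae j P)]
  have h3 := hm'.bernstein j (Lp.aestronglyMeasurable P) hh1 hh2
  have e3 : 1 / (ENNReal.ofReal p / 2).toReal - 1 / (2 : ℝ≥0∞).toReal = 2 / p - 1 / 2 := by
    rw [e2, ENNReal.toReal_ofReal (by positivity)]; simp
  rw [e3, scl_rpow] at h3
  refine h3.trans ?_
  calc kC m' * ENNReal.ofReal (2 ^ ((j : ℝ) * (d * (2 / p - 1 / 2)))) *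
        eLpNorm P (ENNReal.ofReal p / 2) volume
      ≤ kC m' * ENNReal.ofReal (2 ^ ((j : ℝ) * (d * (2 / p - 1 / 2)))) *
        (kC m * eLpNorm U (ENNReal.ofReal p) volume * eLpNorm V (ENNReal.ofReal p) volume) := by
        gcongr
        refine hP'.trans ?_
        gcongr
        exact hm.eLpNorm_dop_le k (Lp.aestronglyMeasurable U) hp1
    _ = _ := by ring

theorem ps_dop_fat_ae {χ : Sp d → ℝ} {k : ℤ} {w : Sp d → ℂ} (a : NNReal)
    (h : dop (fat χ) k w =ᵐ[volume] w) :
    ps a (cv volume (dker (fat χ) k) w) =ᵐ[volume] ps a w := ps_congr_ae a h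

/-- The product `e^{-aΛ₁} w₁ · e^{-aΛ₁} w₂`, in `L^2`. -/
theorem IsCutoff.exists_mul_L2 {χ : Sp d → ℝ} (hχ : IsCutoff χ) {p : ℝ} (hp : 2 ≤ p)
    (hp4 : p ≤ 4) : ∃ C : ℝ≥0∞, C < ∞ ∧ ∀ (a : NNReal) (k : ℤ) (w₁ w₂ : Sp d → ℂ),
      MemLp w₁ (ENNReal.ofReal p) volume → MemLp w₂ (ENNReal.ofReal p) volume →
      dop (fat χ) k w₁ =ᵐ[volume] w₁ →
      ∃ b : L2 d, tdist (fm (esym fun _ => a) b) = tdist (ps a w₁ * ps a w₂) ∧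
        ‖b‖ₑ ≤ C * ENNReal.ofReal (2 ^ ((k : ℝ) * (d * (2 / p - 1 / 2)))) *
          (eLpNorm w₁ (ENNReal.ofReal p) volume * eLpNorm w₂ (ENNReal.ofReal p) volume) := by
  obtain ⟨C, hC, hCb⟩ := exists_eLpNorm_fm_osym_le (d := d) hp hp4
  have hf := hχ.isTest_fat
  refine ⟨8 ^ d * C ^ 2 * kC (fat χ), ENNReal.mul_lt_top (ENNReal.mul_lt_top
    (ENNReal.pow_lt_top (by simp)) (ENNReal.pow_lt_top hC)) hf.kC_lt_top,
    fun a k w₁ w₂ hw₁ hw₂ h => ?_⟩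
  -- No output localization, `ρ = 1`; the input multiplier `θ` is the fattened cutoff, which leaves
  -- `w₁` unchanged.
  obtain ⟨b, hb1, hb2⟩ := exists_bilinear (p := ENNReal.ofReal p) (ρ := fun _ => 1)
    (by simpa using hp) (by simp) hC
    (K := kC (fat χ) * ENNReal.ofReal (2 ^ ((k : ℝ) * (d * (2 / p - 1 / 2)))))
    (ENNReal.mul_lt_top hf.kC_lt_top ENNReal.ofReal_lt_top) a hCb (hf.isKer k)
    (memLp_top_const 1) (Function.HasTemperateGrowth.const 1) (fun U V P hP => by
      rw [fm_one, Lp.enorm_def]; exact hf.eLpNorm_fm_mul_star_le hp hp4 k hP) hw₁ hw₂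
  refine ⟨b, ?_, hb2.trans (le_of_eq (by ring))⟩
  rw [hb1, TemperedDistribution.fourierMultiplierCLM_const, one_smul]
  exact tdist_congr ((ps_dop_fat_ae a h).mul (EventuallyEq.refl _ _))

/-- The blocks of the product `e^{-aΛ₁} w₁ · e^{-aΛ₁} w₂`, in `L^2`. -/
theorem IsCutoff.exists_block_mul_L2 {χ : Sp d → ℝ} (hχ : IsCutoff χ) {p : ℝ} (hp : 2 ≤ p)
    (hp4 : p ≤ 4) : ∃ C : ℝ≥0∞, C < ∞ ∧ ∀ (a : NNReal) (j k : ℤ) (w₁ w₂ : Sp d → ℂ),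
      MemLp w₁ (ENNReal.ofReal p) volume → MemLp w₂ (ENNReal.ofReal p) volume →
      dop (fat χ) k w₁ =ᵐ[volume] w₁ →
      ∃ b : L2 d, tdist (fm (esym fun _ => a) b) = block χ j (tdist (ps a w₁ * ps a w₂)) ∧
        ‖b‖ₑ ≤ C * ENNReal.ofReal (2 ^ ((j : ℝ) * (d * (2 / p - 1 / 2)))) *
          (eLpNorm w₁ (ENNReal.ofReal p) volume * eLpNorm w₂ (ENNReal.ofReal p) volume) := by
  obtain ⟨C, hC, hCb⟩ := exists_eLpNorm_fm_osym_le (d := d) hp hp4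
  have hf := hχ.isTest_fat
  have hφ := hχ.isTest_annulus
  refine ⟨8 ^ d * C ^ 2 * (kC (annulus χ) * kC (fat χ)), ENNReal.mul_lt_top (ENNReal.mul_lt_top
    (ENNReal.pow_lt_top (by simp)) (ENNReal.pow_lt_top hC))
    (ENNReal.mul_lt_top hφ.kC_lt_top hf.kC_lt_top), fun a j k w₁ w₂ hw₁ hw₂ h => ?_⟩
  obtain ⟨b, hb1, hb2⟩ := exists_bilinear (p := ENNReal.ofReal p) (ρ := symb (annulus χ) j)
    (by simpa using hp) (by simp) hC
    (K := kC (annulus χ) * kC (fat χ) * ENNReal.ofReal (2 ^ ((j : ℝ) * (d * (2 / p - 1 / 2)))))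
    (ENNReal.mul_lt_top (ENNReal.mul_lt_top hφ.kC_lt_top hf.kC_lt_top) ENNReal.ofReal_lt_top) a hCb
    (hf.isKer k) (hφ.memLp_symb j) (hφ.temperate j) (fun U V P hP => by
      rw [Lp.enorm_def]; exact hf.eLpNorm_dyadic_mul_le hφ hp hp4 j k hP) hw₁ hw₂
  refine ⟨b, ?_, hb2.trans (le_of_eq (by ring))⟩
  rw [hb1, block, dyadic_eq]
  congr 1
  exact tdist_congr ((ps_dop_fat_ae a h).mul (EventuallyEq.refl _ _))

/-! ### Inversion of `e^{-aΛ₁}` at low frequencies -/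

theorem esym_apply (b : Fin d → NNReal) (ξ : Sp d) :
    esym b ξ = ((∏ i, Real.exp (-(2 * Real.pi * b i) * |ξ i|) : ℝ) : ℂ) := by
  rw [esym, ← Real.exp_sum, Finset.mul_sum]
  congr 3
  ext i; ring

theorem two_cosh_sub_exp (t : ℝ) : 2 * Real.cosh t - Real.exp (-|t|) = Real.exp |t| := by
  rw [← Real.cosh_abs, Real.cosh_eq]; ring

/-- The smooth part of the symbol `m(ξ) e^{a|ξ|₁}`. -/
def coshPart (m : Sp d → ℝ) (a : ℝ) (j : ℤ) (S : Finset (Fin d)) (ξ : Sp d) : ℝ :=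
  m (((2 : ℝ) ^ (-j) * (2 * Real.pi)) • ξ) *
    ((∏ i ∈ S, 2 * Real.cosh (2 * Real.pi * a * ξ i)) * ∏ _i ∈ Finset.univ \ S, (-1 : ℝ))

theorem IsTest.coshPart {m : Sp d → ℝ} (hm : IsTest m) (a : ℝ) (j : ℤ) (S : Finset (Fin d)) :
    IsTest (coshPart m a j S) := by
  have h := hm.comp_smul (c := (2 : ℝ) ^ (-j) * (2 * Real.pi)) (by positivity)
  refine ⟨h.1.mul (ContDiff.mul (contDiff_prod fun i _ => ?_) contDiff_const), h.2.mul_right⟩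
  exact contDiff_const.mul (Real.contDiff_cosh.comp (by fun_prop))

/-- Writing `e^{|t|} = 2 cosh t - e^{-|t|}` confines the corner at `t = 0` to the decaying
exponential, the Fourier transform of a probability measure. The product over the coordinates is
then expanded; `S` is the set of coordinates where the hyperbolic cosine is taken. -/
theorem symb_eq_sum_coshPart (m : Sp d → ℝ) (a : NNReal) (j : ℤ) (ξ : Sp d) :
    symb m j ξ = ∑ S ∈ (Finset.univ : Finset (Fin d)).powerset,
      (coshPart m a j S ξ : ℂ) * (esym (fun i => if i ∈ S then 0 else a) ξ * esym (fun _ => a) ξ) := by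
  have h1 := Finset.prod_add (fun i => 2 * Real.cosh (2 * Real.pi * a * ξ i))
    (fun i => -Real.exp (-|2 * Real.pi * a * ξ i|)) (Finset.univ : Finset (Fin d))
  simp only [← sub_eq_add_neg, two_cosh_sub_exp] at h1
  have h2 : ∀ S ∈ (Finset.univ : Finset (Fin d)).powerset,
      (coshPart m a j S ξ : ℂ) * (esym (fun i => if i ∈ S then 0 else a) ξ * esym (fun _ => a) ξ) =
      (m (((2 : ℝ) ^ (-j) * (2 * Real.pi)) • ξ) : ℂ) *
        ((((∏ i ∈ S, 2 * Real.cosh (2 * Real.pi * a * ξ i)) *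
        ∏ i ∈ Finset.univ \ S, -Real.exp (-|2 * Real.pi * a * ξ i|) : ℝ) : ℂ) *
          esym (fun _ => a) ξ) := fun S _ => by
    have h3 : esym (fun i => if i ∈ S then 0 else a) ξ =
        ((∏ i ∈ Finset.univ \ S, Real.exp (-|2 * Real.pi * a * ξ i|) : ℝ) : ℂ) := by
      rw [esym_apply, ← Finset.prod_sdiff (Finset.subset_univ S)]
      congr 1
      rw [Finset.prod_congr rfl (g := fun i => Real.exp (-|2 * Real.pi * a * ξ i|)) fun i hi => ?_,
        Finset.prod_congr (s₁ := S) rfl (g := fun _ => (1 : ℝ)) fun i hi => ?_]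
      · simp
      · simp [hi]
      · have : i ∉ S := by simpa using hi
        simp only [this, if_false]
        rw [abs_mul, abs_of_nonneg (by positivity : 0 ≤ 2 * Real.pi * (a : ℝ)), neg_mul]
    have h4 : ∏ i ∈ Finset.univ \ S, -Real.exp (-|2 * Real.pi * a * ξ i|) =
        (∏ _i ∈ Finset.univ \ S, (-1 : ℝ)) *
          ∏ i ∈ Finset.univ \ S, Real.exp (-|2 * Real.pi * a * ξ i|) := by
      rw [← Finset.prod_mul_distrib]
      exact Finset.prod_congr rfl fun i _ => by ring
    rw [h3, h4, coshPart]
    push_cast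
    ring
  rw [Finset.sum_congr rfl h2, ← Finset.mul_sum, ← Finset.sum_mul, ← Complex.ofReal_sum, ← h1,
    esym_apply, ← Complex.ofReal_mul, ← Finset.prod_mul_distrib]
  have h5 : ∏ i, Real.exp |2 * Real.pi * a * ξ i| * Real.exp (-(2 * Real.pi * a) * |ξ i|) = 1 := by
    refine Finset.prod_eq_one fun i _ => ?_
    rw [← Real.exp_add, abs_mul, abs_of_nonneg (by positivity : 0 ≤ 2 * Real.pi * (a : ℝ))]
    simp
  rw [h5, Complex.ofReal_one, mul_one, symb, smul_smul]

/-- Each term of the expansion is a Schwartz multiplier composed with a Poisson kernel, and both act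
on `L^∞` by convolution with finite measures. The constant depends on `a`; it serves only to prove
convergence and does not enter the final estimates. -/
theorem IsTest.exists_eLpNorm_top_le {m : Sp d → ℝ} (hm : IsTest m) (a : NNReal) (j : ℤ) :
    ∃ C : ℝ≥0∞, C < ∞ ∧ ∀ X : L2 d, fm (symb m j) X = X →
      eLpNorm X ∞ volume ≤ C * eLpNorm (fm (esym fun _ => a) X) ∞ volume := by
  choose φ hφ using fun S => (hm.coshPart a j S).exists_schwartz
  refine ⟨∑ S ∈ (Finset.univ : Finset (Fin d)).powerset,
    ∫⁻ y, ‖(𝓕⁻ (φ S) : 𝓢(Sp d, ℂ)) y‖ₑ, ENNReal.sum_lt_top.2 fun S _ =>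
      (𝓕⁻ (φ S) : 𝓢(Sp d, ℂ)).integrable.2, fun X hX => ?_⟩
  set y := fm (esym fun _ => a) X with hy
  have hφm : ∀ S, MemLp (φ S) ∞ volume := fun S => (isKer_schwartz (φ S)).memLp
  have e1 : X = ∑ S ∈ (Finset.univ : Finset (Fin d)).powerset,
      fm (φ S) (fm (esym fun i => if i ∈ S then 0 else a) y) := by
    rw [← hX, hy]
    simp_rw [fm_fm (memLp_esym _) (memLp_esym _), fm_fm (hφm _) (memLp_mul_top (memLp_esym _)
      (memLp_esym _))]
    rw [← fm_sum_symbol _ fun S _ => memLp_mul_top (hφm S)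
      (memLp_mul_top (memLp_esym _) (memLp_esym _))]
    congr 2
    ext ξ
    rw [symb_eq_sum_coshPart m a j ξ, Finset.sum_apply]
    exact Finset.sum_congr rfl fun S _ => by simp [hφ]
  have e2 : X =ᵐ[volume] ∑ S ∈ (Finset.univ : Finset (Fin d)).powerset,
      (fm (φ S) (fm (esym fun i => if i ∈ S then 0 else a) y) : Sp d → ℂ) := by
    conv_lhs => rw [e1]
    exact Lp.coeFn_finsetSum _ _
  rw [eLpNorm_congr_ae e2, Finset.sum_mul]
  refine (eLpNorm_sum_le (fun S _ => Lp.aestronglyMeasurable _) le_top).trans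
    (Finset.sum_le_sum fun S _ => ?_)
  rw [eLpNorm_congr_ae (fm_eq_cv (isKer_schwartz (φ S)) _)]
  refine (eLpNorm_cv_le (isKer_schwartz (φ S)).meas (Lp.aestronglyMeasurable _) le_top).trans ?_
  gcongr
  rw [eLpNorm_congr_ae (fm_eq_cv (isKer_poisson _) y)]
  exact (eLpNorm_cv_le measurable_const (Lp.aestronglyMeasurable _) le_top).trans (by simp)

/-! ### Convergence of series of distributions -/

theorem exists_hasSum_tdist {q : ℝ≥0∞} (hq : 1 ≤ q) {ι : Type*} {w : ι → Sp d → ℂ}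
    (hw : ∀ i, MemLp (w i) q volume) (hs : ∑' i, eLpNorm (w i) q volume ≠ ∞) :
    ∃ w₀, MemLp w₀ q volume ∧ HasSum (fun i => tdist (w i)) (tdist w₀) ∧
      eLpNorm w₀ q volume ≤ ∑' i, eLpNorm (w i) q volume := by
  have : Fact (1 ≤ q) := ⟨hq⟩
  have hsum : Summable fun i => (hw i).toLp (w i) := by
    refine Summable.of_norm ?_
    simp only [Lp.norm_toLp]
    exact ENNReal.summable_toReal hs
  refine ⟨_, Lp.memLp (∑' i, (hw i).toLp (w i)), ?_, ?_⟩
  · have h := (Lp.toTemperedDistributionCLM ℂ (volume : Measure (Sp d)) q).hasSum hsum.hasSum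
    rw [Lp.toTemperedDistributionCLM_apply, ← tdist_coe] at h
    refine h.congr_fun fun i => ?_
    rw [Lp.toTemperedDistributionCLM_apply, ← tdist_coe]
    exact tdist_congr (hw i).coeFn_toLp.symm
  · have h := enorm_tsum_le_tsum_enorm (f := fun i => (hw i).toLp (w i))
    simpa [Lp.enorm_def, eLpNorm_congr_ae (hw _).coeFn_toLp] using h

/-- The weight `(1 + |ξ|²)^r`. -/
def wgt (d : ℕ) (r : ℝ) (ξ : Sp d) : ℂ := (((1 + ‖ξ‖ ^ 2) ^ r : ℝ) : ℂ)

theorem temperate_wgt (r : ℝ) : (wgt d r).HasTemperateGrowth := by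
  unfold wgt; fun_prop

theorem wgt_mul_wgt (r : ℝ) : wgt d r * wgt d (-r) = fun _ => 1 := by
  ext ξ
  rw [Pi.mul_apply, wgt, wgt, ← Complex.ofReal_mul, ← Real.rpow_add (by positivity)]
  simp

theorem norm_wgt_le {r : ℝ} (hr : 0 ≤ r) (ξ : Sp d) : ‖wgt d (-r) ξ‖ ≤ 1 := by
  rw [wgt, Complex.norm_real, Real.norm_eq_abs, abs_of_nonneg (by positivity)]
  exact Real.rpow_le_one_of_one_le_of_nonpos (by nlinarith [sq_nonneg ‖ξ‖]) (by linarith)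

theorem memLp_wgt {r : ℝ} (hr : 0 ≤ r) : MemLp (wgt d (-r)) ∞ volume :=
  memLp_top_of_bound (temperate_wgt _).1.continuous.aestronglyMeasurable 1
    (ae_of_all _ (norm_wgt_le hr))

/-- The hypothesis makes the transform of `b` vanish on the ball of radius `c`, where the cutoff is
`1`; outside it the weight is at most `c^(-2r)`. -/
theorem IsCutoff.norm_fm_wgt_le {χ : Sp d → ℝ} (hχ : IsCutoff χ) {r : ℝ} (hr : 0 ≤ r) (j : ℤ)
    {b : L2 d} (hb : fm (symb χ j) b = 0) :
    ‖fm (wgt d (-r)) b‖ ≤ (3 / 4 * 2 ^ j / (2 * Real.pi)) ^ (-(2 * r)) * ‖b‖ := by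
  set c : ℝ := 3 / 4 * 2 ^ j / (2 * Real.pi) with hc
  have hc0 : 0 < c := by positivity
  rw [← Lp.norm_fourier_eq (fm _ b), ← Lp.norm_fourier_eq b]
  refine Lp.norm_le_mul_norm_of_ae_le_mul ?_
  have h1 := fourier_fm (hχ.isTest.memLp_symb j) b
  have h3 : (𝓕 (0 : L2 d) : L2 d) = 0 := (FourierTransform.fourierCLM ℂ (L2 d)).map_zero
  rw [hb, h3] at h1
  filter_upwards [fourier_fm (memLp_wgt hr) b, h1, Lp.coeFn_zero ℂ 2 (volume : Measure (Sp d))]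
    with ξ i1 i2 i3
  rw [i1, norm_mul]
  by_cases h : ‖ξ‖ < c
  · have h2 : symb χ j ξ = 1 := hχ.symb_eq_one (by
      rw [hc, lt_div_iff₀ (by positivity)] at h; linarith)
    rw [i3, h2, one_mul, Pi.zero_apply] at i2
    rw [← i2]; simp
  · gcongr
    rw [wgt, Complex.norm_real, Real.norm_eq_abs, abs_of_nonneg (by positivity),
      show -(2 * r) = 2 * (-r) by ring, Real.rpow_mul hc0.le, Real.rpow_two]
    refine Real.rpow_le_rpow_of_nonpos (by positivity) ?_ (by linarith)
    push Not at h
    have : c ^ 2 ≤ ‖ξ‖ ^ 2 := by gcongr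
    linarith

/-- A series of functions with higher and higher frequencies converges if the norms grow at most
exponentially. -/
theorem IsCutoff.summable_tdist {χ : Sp d → ℝ} (hχ : IsCutoff χ) (n : ℤ) {b : ℕ → L2 d}
    (hb : ∀ j : ℕ, fm (symb χ (j - n)) (b j) = 0) {C s : ℝ}
    (hC : ∀ j : ℕ, ‖b j‖ ≤ C * 2 ^ (s * j)) : Summable fun j => tdist (b j) := by
  -- With `2r = |s| + 1`, the gain `2^(-2rj)` beats the growth `2^(sj)` by a factor `2^(-j)` at
  -- least.
  set r : ℝ := (|s| + 1) / 2 with hr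
  have hr0 : 0 ≤ r := by positivity
  set c : ℝ := 3 / 4 * 2 ^ (-n) / (2 * Real.pi) with hc
  have hc0 : 0 < c := by positivity
  have hC0 : 0 ≤ C := by
    have := (norm_nonneg _).trans (hC 0)
    simpa using this
  have h1 : ∀ j : ℕ, ‖fm (wgt d (-r)) (b j)‖ ≤ (c ^ (-(2 * r)) * C) * (1 / 2 : ℝ) ^ j := fun j => by
    refine (hχ.norm_fm_wgt_le hr0 _ (hb j)).trans ?_
    have e : 3 / 4 * (2 : ℝ) ^ ((j : ℤ) - n) / (2 * Real.pi) = c * 2 ^ (j : ℝ) := by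
      rw [hc, sub_eq_add_neg, zpow_add₀ two_ne_zero, zpow_natCast, Real.rpow_natCast]; ring
    rw [e, Real.mul_rpow hc0.le (by positivity), mul_assoc, mul_assoc]
    refine mul_le_mul_of_nonneg_left ?_ (by positivity)
    calc (2 ^ (j : ℝ)) ^ (-(2 * r)) * ‖b j‖ ≤ (2 ^ (j : ℝ)) ^ (-(2 * r)) * (C * 2 ^ (s * j)) := by
          gcongr; exact hC j
      _ = C * 2 ^ (j * (s - |s|) - j : ℝ) := by
          rw [← Real.rpow_mul two_pos.le, mul_left_comm, ← Real.rpow_add two_pos]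
          congr 2; rw [hr]; ring
      _ ≤ C * 2 ^ (-j : ℝ) := by
          gcongr
          · norm_num
          · have : (j : ℝ) * (s - |s|) ≤ 0 :=
              mul_nonpos_of_nonneg_of_nonpos (by positivity) (by linarith [le_abs_self s])
            linarith
      _ = _ := by
          rw [Real.rpow_neg two_pos.le, Real.rpow_natCast, one_div, inv_pow]
  have h2 : Summable fun j => fm (wgt d (-r)) (b j) :=
    Summable.of_norm_bounded ((summable_geometric_of_lt_one (by norm_num) (by norm_num)).mul_left _)
      h1
  -- The weighted series converges in `L²`; removing the weight is continuous on tempered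
  -- distributions.
  have h3 := ((md (wgt d r)).hasSum
    ((Lp.toTemperedDistributionCLM ℂ (volume : Measure (Sp d)) 2).hasSum h2.hasSum)).summable
  refine h3.congr fun j => ?_
  simp only [Lp.toTemperedDistributionCLM_apply, ← tdist_coe]
  rw [← tdist_fm (memLp_wgt hr0) (temperate_wgt _)]
  have h4 := md_md (temperate_wgt r) (temperate_wgt (-r)) (tdist (b j))
  rw [wgt_mul_wgt, md, md, md, TemperedDistribution.fourierMultiplierCLM_const, one_smul] at h4
  exact h4

/-! ### Construction of `e^{aΛ₁} h` from its dyadic blocks -/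

/-- The `H_j` are the dyadic blocks of `e^{aΛ₁} h`. -/
def IsDec (χ : Sp d → ℝ) (a : NNReal) (h : TDist d) (H : ℤ → L2 d) : Prop :=
  ∀ j, tdist (fm (esym fun _ => a) (H j)) = block χ j h

theorem temperate_one : (fun _ : Sp d => (1 : ℂ)).HasTemperateGrowth := .const 1

/-- The `H j` inherit the relations between the blocks of `h`: multipliers commute with `e^{-aΛ₁}`,
which is injective on `L²`. -/
theorem IsDec.fm_eq {χ : Sp d → ℝ} (hχ : IsCutoff χ) {a : NNReal} {h : TDist d} {H : ℤ → L2 d}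
    (hH : IsDec χ a h H) {m n : Sp d → ℂ} (hm : MemLp m ∞ volume) (hmt : m.HasTemperateGrowth)
    (hn : MemLp n ∞ volume) (hnt : n.HasTemperateGrowth) {i j : ℤ}
    (hmn : m * symb (annulus χ) i = n * symb (annulus χ) j) : fm m (H i) = fm n (H j) := by
  have key : ∀ {m : Sp d → ℂ} (_ : MemLp m ∞ volume) (_ : m.HasTemperateGrowth) (i : ℤ),
      tdist (fm (esym fun _ => a) (fm m (H i))) = md (m * symb (annulus χ) i) h :=
    fun {m} hm hmt i => by
      rw [fm_comm (memLp_esym _) hm, ← tdist_fm hm hmt, hH i, block, dyadic_eq,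
        ← md_md hmt (hχ.isTest_annulus.temperate i)]
  refine fm_injective (memLp_esym fun _ => a) (esym_ne_zero _) (tdist_L2_injective ?_)
  rw [key hm hmt, key hn hnt, hmn]

theorem IsDec.fm_eq_self {χ : Sp d → ℝ} (hχ : IsCutoff χ) {a : NNReal} {h : TDist d}
    {H : ℤ → L2 d} (hH : IsDec χ a h H) {m : Sp d → ℂ} (hm : MemLp m ∞ volume)
    (hmt : m.HasTemperateGrowth) {i : ℤ} (hmi : m * symb (annulus χ) i = symb (annulus χ) i) :
    fm m (H i) = H i := by
  have := hH.fm_eq hχ hm hmt (memLp_top_const 1) temperate_one (i := i) (j := i)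
    (by rw [hmi]; ext ξ; simp)
  rwa [fm_one] at this

theorem fm_zero (b : L2 d) : fm (0 : Sp d → ℂ) b = 0 := by
  have := fm_sum_symbol (∅ : Finset ℕ) (m := fun _ => (0 : Sp d → ℂ)) (by simp) b
  simpa using this

theorem IsDec.fm_eq_zero {χ : Sp d → ℝ} (hχ : IsCutoff χ) {a : NNReal} {h : TDist d}
    {H : ℤ → L2 d} (hH : IsDec χ a h H) {m : Sp d → ℂ} (hm : MemLp m ∞ volume)
    (hmt : m.HasTemperateGrowth) {i : ℤ} (hmi : m * symb (annulus χ) i = 0) :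
    fm m (H i) = 0 := by
  have := hH.fm_eq hχ hm hmt (n := 0) MemLp.zero (.const 0) (i := i) (j := i)
    (by rw [hmi]; ext ξ; simp)
  rwa [fm_zero] at this

theorem IsDec.memLp_top {χ : Sp d → ℝ} (hχ : IsCutoff χ) {a : NNReal} {h : TDist d}
    {H : ℤ → L2 d} (hH : IsDec χ a h H) (j : ℤ) : MemLp (H j) ∞ volume := by
  have hf := hχ.isTest_fat
  have h1 := hH.fm_eq_self hχ (hf.memLp_symb j) (hf.temperate j) (i := j)
    (by rw [symb_fat]; exact hχ.annulus_fattened j)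
  rw [← h1]
  exact (hf.memLp_dop_of_le j (q := 2) (by norm_num) le_top (Lp.memLp (H j))).ae_eq
    (hf.fm_symb_ae j (H j)).symm

theorem coeFn_sum_Lp {q : ℝ≥0∞} {ι : Type*} (s : Finset ι) (b : ι → Lp (α := Sp d) ℂ q volume) :
    ((∑ i ∈ s, b i : Lp (α := Sp d) ℂ q volume) : Sp d → ℂ) =ᵐ[volume] ∑ i ∈ s, (b i : Sp d → ℂ) :=
  Lp.coeFn_finsetSum _ _

theorem tdist_finset_sum {ι : Type*} (s : Finset ι) (b : ι → L2 d) :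
    tdist (∑ i ∈ s, b i : L2 d) = ∑ i ∈ s, tdist (b i) := by
  rw [tdist_congr (coeFn_sum_Lp s b), tdist_sum s (q := 2) (by norm_num) fun i _ => Lp.memLp _]

/-- The operator `e^{-aΛ₁}` maps the partial sum to `Ṡ_N h - Ṡ_M h`, and it can be inverted on `L^∞`
at bounded frequencies. -/
theorem IsDec.exists_low_le {χ : Sp d → ℝ} (hχ : IsCutoff χ) (a : NNReal) :
    ∃ C : ℝ≥0∞, C < ∞ ∧ ∀ (h : TDist d) (H : ℤ → L2 d), IsDec χ a h H → ∀ M N : ℤ, M ≤ N → N ≤ 0 →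
      eLpNorm (∑ j ∈ Finset.Ico M N, H j : L2 d) ∞ volume ≤
        C * (distLpNorm ∞ (lowCut χ M h) + distLpNorm ∞ (lowCut χ N h)) := by
  -- Since `N ≤ 0`, the indices satisfy `j ≤ -1`, and the cutoff at level `2` is `1` on all these
  -- annuli.
  obtain ⟨C, hC, hb⟩ := hχ.isTest.exists_eLpNorm_top_le a 2
  -- A nonzero constant keeps the bound trivially true when a norm of a cutoff of `h` is infinite.
  refine ⟨C + 1, ENNReal.add_lt_top.2 ⟨hC, by simp⟩, fun h H hH M N hMN hN => ?_⟩
  rcases eq_or_ne (distLpNorm ∞ (lowCut χ M h) + distLpNorm ∞ (lowCut χ N h)) ∞ with hi | hi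
  · rw [hi, ENNReal.mul_top (by simp)]; exact le_top
  rw [Ne, ENNReal.add_eq_top, not_or, ← Ne, ← Ne] at hi
  obtain ⟨l, hl⟩ := exists_rep_of_distLpNorm_lt (lt_top_iff_ne_top.2 hi.1)
  obtain ⟨l', hl'⟩ := exists_rep_of_distLpNorm_lt (lt_top_iff_ne_top.2 hi.2)
  rw [distLpNorm_eq le_top hl, distLpNorm_eq le_top hl']
  set X : L2 d := ∑ j ∈ Finset.Ico M N, H j with hX
  have hfix : fm (symb χ 2) X = X := by
    rw [hX, map_sum]
    refine Finset.sum_congr rfl fun j hj => ?_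
    have := (Finset.mem_Ico.1 hj).2
    exact hH.fm_eq_self hχ (hχ.isTest.memLp_symb 2) (hχ.isTest.temperate 2)
      (hχ.chi_mul_annulus (by omega))
  have hy : tdist (fm (esym fun _ => a) X) = lowCut χ N h - lowCut χ M h := by
    rw [hX, map_sum, tdist_finset_sum, ← hχ.sum_block hMN]
    exact Finset.sum_congr rfl fun j _ => hH j
  have hy' : tdist (l' - l) = lowCut χ N h - lowCut χ M h := by
    rw [tdist_sub le_top le_top hl'.1 hl.1, hl.2.tdist_eq, hl'.2.tdist_eq]
  have hae : fm (esym fun _ => a) X =ᵐ[volume] l' - l :=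
    Rep.unique (q := 2) (by norm_num) le_top (rep_tdist (by norm_num) (Lp.memLp _))
      ((hy.trans hy'.symm) ▸ rep_tdist le_top (hl'.1.sub hl.1))
  refine (hb X hfix).trans ?_
  rw [eLpNorm_congr_ae hae]
  gcongr
  · exact le_self_add
  · rw [add_comm]; exact eLpNorm_sub_le hl'.1.1 hl.1.1 le_top

theorem IsDec.memLp_sum {χ : Sp d → ℝ} (hχ : IsCutoff χ) {a : NNReal} {h : TDist d}
    {H : ℤ → L2 d} (hH : IsDec χ a h H) (s : Finset ℤ) :
    MemLp (∑ j ∈ s, H j : L2 d) ∞ volume :=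
  (memLp_finsetSum' s fun j _ => hH.memLp_top hχ j).ae_eq (coeFn_sum_Lp s H).symm

theorem sum_Ico_consecutive_int {M : Type*} [AddCommMonoid M] (f : ℤ → M) {a b c : ℤ} (h1 : a ≤ b)
    (h2 : b ≤ c) : ∑ j ∈ Finset.Ico a b, f j + ∑ j ∈ Finset.Ico b c, f j =
      ∑ j ∈ Finset.Ico a c, f j := by
  rw [← Finset.sum_union (Finset.Ico_disjoint_Ico_consecutive a b c),
    Finset.Ico_union_Ico_eq_Ico h1 h2]

/-- The low frequency part of `e^{aΛ₁} h`. -/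
theorem IsDec.exists_low {χ : Sp d → ℝ} (hχ : IsCutoff χ) {a : NNReal} {h : TDist d}
    (hh : IsSh χ h) {H : ℤ → L2 d} (hH : IsDec χ a h H) :
    ∃ x : Sp d → ℂ, MemLp x ∞ volume ∧ Tendsto (fun n : ℕ => eLpNorm
      (((∑ j ∈ Finset.Ico (-(n : ℤ)) 0, H j : L2 d) : Sp d → ℂ) - x) ∞ volume) atTop (𝓝 0) := by
  obtain ⟨C, hC, hb⟩ := IsDec.exists_low_le hχ a
  set X : ℕ → L2 d := fun n => ∑ j ∈ Finset.Ico (-(n : ℤ)) 0, H j with hX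
  have hXm : ∀ n, MemLp (X n) ∞ volume := fun n => hH.memLp_sum hχ _
  set δ : ℕ → ℝ≥0∞ := fun n => distLpNorm ∞ (lowCut χ (-(n : ℤ)) h) with hδ
  have hδ0 : Tendsto δ atTop (𝓝 0) :=
    hh.comp (tendsto_neg_atTop_atBot.comp tendsto_natCast_atTop_atTop)
  have hle : ∀ n m : ℕ, n ≤ m → eLpNorm ((X n : Sp d → ℂ) - (X m : Sp d → ℂ)) ∞ volume ≤
      C * (δ n + δ m) := fun n m hnm => by
    have e1 : X m = X n + ∑ j ∈ Finset.Ico (-(m : ℤ)) (-(n : ℤ)), H j := by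
      simp only [hX]
      rw [add_comm, sum_Ico_consecutive_int _ (by omega) (by omega)]
    have e2 : (X n : Sp d → ℂ) - (X m : Sp d → ℂ) =ᵐ[volume]
        -((∑ j ∈ Finset.Ico (-(m : ℤ)) (-(n : ℤ)), H j : L2 d) : Sp d → ℂ) := by
      rw [e1]
      filter_upwards [Lp.coeFn_add (X n) (∑ j ∈ Finset.Ico (-(m : ℤ)) (-(n : ℤ)), H j)] with x hx
      rw [Pi.sub_apply, hx, Pi.add_apply, Pi.neg_apply]; ring
    rw [eLpNorm_congr_ae e2, eLpNorm_neg, add_comm]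
    exact hb h H hH _ _ (by omega) (by omega)
  have hle' : ∀ n m : ℕ, eLpNorm ((X n : Sp d → ℂ) - (X m : Sp d → ℂ)) ∞ volume ≤ C * (δ n + δ m) :=
    fun n m => by
      rcases le_total n m with hnm | hnm
      · exact hle n m hnm
      · rw [eLpNorm_sub_comm, add_comm]; exact hle m n hnm
  have : Fact ((1 : ℝ≥0∞) ≤ ∞) := ⟨le_top⟩
  have hcau : CauchySeq fun n => (hXm n).toLp (X n) := by
    rw [cauchySeq_iff_tendsto_dist_atTop_0]
    have t1 : Tendsto (fun z : ℕ × ℕ => δ z.1) atTop (𝓝 0) :=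
      hδ0.comp (tendsto_fst.mono_left (le_of_eq prod_atTop_atTop_eq.symm))
    have t2 : Tendsto (fun z : ℕ × ℕ => δ z.2) atTop (𝓝 0) :=
      hδ0.comp (tendsto_snd.mono_left (le_of_eq prod_atTop_atTop_eq.symm))
    have t : Tendsto (fun z : ℕ × ℕ => C * (δ z.1 + δ z.2)) atTop (𝓝 0) := by
      simpa using ENNReal.Tendsto.const_mul (a := C) (t1.add t2) (Or.inr hC.ne)
    have t' : Tendsto (fun z : ℕ × ℕ => eLpNorm ((X z.1 : Sp d → ℂ) - (X z.2 : Sp d → ℂ)) ∞ volume) atTop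
        (𝓝 0) :=
      tendsto_of_tendsto_of_tendsto_of_le_of_le tendsto_const_nhds t (fun _ => zero_le)
        fun z => hle' z.1 z.2
    refine ((ENNReal.tendsto_toReal ENNReal.zero_ne_top).comp t').congr fun z => ?_
    rw [Lp.dist_def, Function.comp_apply]
    congr 1
    exact eLpNorm_congr_ae ((hXm _).coeFn_toLp.symm.sub (hXm _).coeFn_toLp.symm)
  obtain ⟨x, hx⟩ := cauchySeq_tendsto_of_complete hcau
  refine ⟨x, Lp.memLp x, ?_⟩
  rw [Lp.tendsto_Lp_iff_tendsto_eLpNorm'] at hx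
  exact hx.congr fun n => eLpNorm_congr_ae ((hXm n).coeFn_toLp.sub (EventuallyEq.refl _ _))

/-- For `n ≥ |i| + 3` the annuli from `-n` to `n - 1` add up to `1` on the annulus `i`, so the block
of the partial sum no longer changes. -/
theorem IsDec.block_eq {χ : Sp d → ℝ} (hχ : IsCutoff χ) {a : NNReal} {h : TDist d}
    {H : ℤ → L2 d} (hH : IsDec χ a h H) {u : TDist d}
    (hu : Tendsto (fun n : ℕ => ∑ j ∈ Finset.Ico (-(n : ℤ)) n, tdist (H j)) atTop (𝓝 u)) (i : ℤ) :
    block χ i u = tdist (H i) := by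
  have hφ := hχ.isTest_annulus
  have h1 := ((md (symb (annulus χ) i)).continuous.tendsto u).comp hu
  refine tendsto_nhds_unique h1 (tendsto_const_nhds.congr' ?_)
  filter_upwards [eventually_ge_atTop (i.natAbs + 3)] with n hn
  rw [Function.comp_apply, map_sum]
  have e1 : ∀ j, md (symb (annulus χ) i) (tdist (H j)) = tdist (fm (symb (annulus χ) j) (H i)) :=
    fun j => by
      rw [tdist_fm (hφ.memLp_symb i) (hφ.temperate i), hH.fm_eq hχ (hφ.memLp_symb i) (hφ.temperate i)
        (hφ.memLp_symb j) (hφ.temperate j) (mul_comm _ _)]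
  rw [Finset.sum_congr rfl fun j _ => e1 j, ← tdist_finset_sum,
    ← fm_sum_symbol _ fun j _ => hφ.memLp_symb j, sum_Ico_symb_annulus χ (by omega),
    hH.fm_eq_self hχ ((hχ.isTest.memLp_symb _).sub (hχ.isTest.memLp_symb _))
      ((hχ.isTest.temperate _).sub (hχ.isTest.temperate _))]
  rw [sub_mul, hχ.chi_mul_annulus (by omega), hχ.chi_mul_annulus_eq_zero (by omega), sub_zero]

/-- For `J ≤ -1`, `Ṡ_J` kills every `H j` with `j ≥ J + 1`. What remains is `Ṡ_J` applied to the
tail of the low-frequency series, which tends to `0` uniformly. -/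
theorem IsDec.isSh {χ : Sp d → ℝ} (hχ : IsCutoff χ) {a : NNReal} {h : TDist d}
    {H : ℤ → L2 d} (hH : IsDec χ a h H) {x : Sp d → ℂ} (hx : MemLp x ∞ volume)
    (hxt : Tendsto (fun n : ℕ => eLpNorm
      (((∑ j ∈ Finset.Ico (-(n : ℤ)) 0, H j : L2 d) : Sp d → ℂ) - x) ∞ volume) atTop (𝓝 0))
    {u : TDist d} (hu : HasSum (fun j : ℕ => tdist (H j)) u) : IsSh χ (tdist x + u) := by
  have ht := hχ.isTest
  have hzero : ∀ J j : ℤ, J + 1 ≤ j → md (symb χ J) (tdist (H j)) = 0 := fun J j hJ => by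
    rw [tdist_fm (ht.memLp_symb J) (ht.temperate J), hH.fm_eq_zero hχ (ht.memLp_symb J)
      (ht.temperate J) (hχ.chi_mul_annulus_eq_zero hJ), tdist_congr (Lp.coeFn_zero ℂ 2 volume),
      tdist_zero]
  have hle : ∀ᶠ J : ℤ in atBot, distLpNorm ∞ (lowCut χ J (tdist x + u)) ≤ kC χ * eLpNorm
      (((∑ j ∈ Finset.Ico (-(((-J - 1).toNat : ℕ) : ℤ)) 0, H j : L2 d) : Sp d → ℂ) - x) ∞ volume := by
    filter_upwards [eventually_le_atBot (-1)] with J hJ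
    set n := (-J - 1).toNat
    have hn : (n : ℤ) = -J - 1 := Int.toNat_of_nonneg (by omega)
    have e1 : lowCut χ J u = 0 := by
      have h1 := (md (symb χ J)).hasSum hu
      have h2 : (fun j : ℕ => md (symb χ J) (tdist (H j))) = fun _ => 0 :=
        funext fun j => hzero J j (by omega)
      exact h1.unique (by simp only [h2]; exact hasSum_zero)
    set X : L2 d := ∑ j ∈ Finset.Ico (-(n : ℤ)) 0, H j with hX
    have hXm : MemLp X ∞ volume := hH.memLp_sum hχ _
    have e2 : lowCut χ J (tdist X) = 0 := by
      rw [hX, tdist_finset_sum, lowCut, dyadic_eq, map_sum]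
      refine Finset.sum_eq_zero fun j hj => hzero J j ?_
      have := (Finset.mem_Ico.1 hj).1
      omega
    have e3 : lowCut χ J (tdist x + u) = lowCut χ J (tdist (x - (X : Sp d → ℂ))) := by
      have h3 : tdist x = tdist (x - (X : Sp d → ℂ)) + tdist X := by
        rw [tdist_sub le_top le_top hx hXm, sub_add_cancel]
      have h4 : ∀ v w : TDist d, lowCut χ J (v + w) = lowCut χ J v + lowCut χ J w :=
        fun v w => map_add (md (symb χ J)) v w
      rw [h4, e1, add_zero, h3, h4, e2, add_zero]
    rw [e3, eLpNorm_sub_comm]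
    refine (ht.distLpNorm_dyadic_le J _ le_top).trans ?_
    gcongr
    exact distLpNorm_le (rep_tdist le_top (hx.sub hXm))
  have ht' : Tendsto (fun J : ℤ => (-J - 1).toNat) atBot atTop := by
    refine tendsto_atTop.2 fun b => ?_
    filter_upwards [eventually_le_atBot (-(b : ℤ) - 1)] with J hJ
    omega
  have h0 := ENNReal.Tendsto.const_mul (a := kC χ) (hxt.comp ht') (Or.inr ht.kC_lt_top.ne)
  rw [mul_zero] at h0
  exact tendsto_of_tendsto_of_tendsto_of_le_of_le' tendsto_const_nhds h0
    (Eventually.of_forall fun _ => zero_le) hle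

/-- A distribution of `𝓢'_h` whose blocks are of the form `e^{-aΛ₁} H_j`, with `H_j` of at most
exponential growth in `L^2`, is in the image of `e^{-aΛ₁}`. -/
theorem IsDec.exists_isExp {χ : Sp d → ℝ} (hχ : IsCutoff χ) {a : NNReal} {h : TDist d}
    (hh : IsSh χ h) {H : ℤ → L2 d} (hH : IsDec χ a h H) {C s : ℝ}
    (hC : ∀ j : ℕ, ‖H j‖ ≤ C * 2 ^ (s * j)) :
    ∃ u : TDist d, IsExp χ a h u ∧ ∀ j, block χ j u = tdist (H j) := by
  obtain ⟨x, hx, hxt⟩ := hH.exists_low hχ hh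
  have ht := hχ.isTest
  -- The cutoff at level `j - 1` vanishes on the annulus `j`.
  obtain ⟨v, hv⟩ := hχ.summable_tdist 1 (b := fun j => H j) (fun j =>
    hH.fm_eq_zero hχ (ht.memLp_symb _) (ht.temperate _) (hχ.chi_mul_annulus_eq_zero (by omega))) hC
  have hlim : Tendsto (fun n : ℕ => ∑ j ∈ Finset.Ico (-(n : ℤ)) n, tdist (H j)) atTop
      (𝓝 (tdist x + v)) := by
    have h1 := (tendsto_tdist le_top (fun n => hH.memLp_sum hχ _) hx hxt).add hv.tendsto_sum_nat
    refine h1.congr fun n => ?_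
    rw [tdist_finset_sum, ← sum_Ico_consecutive_int _ (by omega : -(n : ℤ) ≤ 0)
      (by omega : (0 : ℤ) ≤ n)]
    congr 1
    have e : Finset.Ico (0 : ℤ) n = (Finset.range n).image (fun j : ℕ => (j : ℤ)) := by
      ext x
      simp only [Finset.mem_Ico, Finset.mem_image, Finset.mem_range]
      exact ⟨fun hx => ⟨x.toNat, by omega, by omega⟩, fun ⟨y, hy, hy'⟩ => by omega⟩
    rw [e, Finset.sum_image (by simp)]
  refine ⟨tdist x + v, ⟨hh, hH.isSh hχ hx hxt hv, fun j => ⟨H j, hH.memLp_top hχ j, ?_, ?_⟩⟩,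
    hH.block_eq hχ hlim⟩
  · rw [hH.block_eq hχ hlim]
    exact (rep_tdist le_top (hH.memLp_top hχ j)).2
  · rw [isExpNeg_iff le_top (hH.memLp_top hχ j), ← hH j]
    refine ⟨memLp_ps a le_top (hH.memLp_top hχ j), ?_⟩
    exact (rep_tdist (q := 2) (by norm_num) (Lp.memLp _)).2.congr (fm_esym_ae a (H j))

theorem besovNorm_two_le {χ : Sp d → ℝ} {s : ℝ} {u : TDist d} {H : ℤ → L2 d}
    (hu : ∀ j, block χ j u = tdist (H j)) :
    besovNorm χ s 2 u ≤ ∑' j : ℤ, ENNReal.ofReal (2 ^ ((j : ℝ) * s)) * ‖H j‖ₑ := by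
  refine ENNReal.tsum_le_tsum fun j => ?_
  rw [hu j, Lp.enorm_def]
  gcongr
  simpa using distLpNorm_le (rep_tdist (q := 2) (by norm_num) (Lp.memLp (H j)))

/-! ### Norms of sums of distributions -/

theorem distLpNorm_hasSum_le {q : ℝ≥0∞} (hq : 1 ≤ q) {ι : Type*} {W : ι → TDist d} {h : TDist d}
    (hW : HasSum W h) : distLpNorm q h ≤ ∑' i, distLpNorm q (W i) := by
  rcases eq_or_ne (∑' i, distLpNorm q (W i)) ∞ with hi | hi
  · rw [hi]; exact le_top
  choose w hw using fun i => exists_rep_of_distLpNorm_lt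
    (lt_top_iff_ne_top.2 (ENNReal.ne_top_of_tsum_ne_top hi i))
  have e : ∀ i, distLpNorm q (W i) = eLpNorm (w i) q volume := fun i => distLpNorm_eq hq (hw i)
  simp_rw [e] at hi ⊢
  obtain ⟨w₀, hw₀, hs, hle⟩ := exists_hasSum_tdist hq (fun i => (hw i).1) hi
  have e' : ∀ i, tdist (w i) = W i := fun i => (hw i).2.tdist_eq
  simp_rw [e'] at hs
  rw [hW.unique hs]
  exact (distLpNorm_le (rep_tdist hq hw₀)).trans hle

theorem distLpNorm_add_le {q : ℝ≥0∞} (hq : 1 ≤ q) (u v : TDist d) :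
    distLpNorm q (u + v) ≤ distLpNorm q u + distLpNorm q v := by
  rcases eq_or_ne (distLpNorm q u) ∞ with hu | hu
  · simp [hu]
  rcases eq_or_ne (distLpNorm q v) ∞ with hv | hv
  · simp [hv]
  obtain ⟨w, hw⟩ := exists_rep_of_distLpNorm_lt (lt_top_iff_ne_top.2 hu)
  obtain ⟨w', hw'⟩ := exists_rep_of_distLpNorm_lt (lt_top_iff_ne_top.2 hv)
  rw [distLpNorm_eq hq hw, distLpNorm_eq hq hw', ← hw.2.tdist_eq, ← hw'.2.tdist_eq,
    ← tdist_add hq hq hw.1 hw'.1]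
  exact (distLpNorm_le (rep_tdist hq (hw.1.add hw'.1))).trans (eLpNorm_add_le hw.1.1 hw'.1.1 hq)

theorem distLpNorm_zero {q : ℝ≥0∞} : distLpNorm q (0 : TDist d) = 0 := by
  have h : Rep q (0 : Sp d → ℂ) 0 := ⟨MemLp.zero, fun φ => by simp⟩
  simpa using distLpNorm_le h

theorem IsSh.add {χ : Sp d → ℝ} {u v : TDist d} (hu : IsSh χ u) (hv : IsSh χ v) :
    IsSh χ (u + v) := by
  have h := Tendsto.add hu hv
  rw [add_zero] at h
  refine tendsto_of_tendsto_of_tendsto_of_le_of_le tendsto_const_nhds h (fun _ => zero_le)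
    fun j => ?_
  have e : lowCut χ j (u + v) = lowCut χ j u + lowCut χ j v := map_add (md (symb χ j)) u v
  simp only [e]
  exact distLpNorm_add_le le_top _ _

/-- Dominated convergence for `𝓢'_h`. -/
theorem isSh_of_hasSum {χ : Sp d → ℝ} {W : ℤ → TDist d} {h : TDist d} (hW : HasSum W h)
    {y : ℤ → ℝ≥0∞} (hy : ∑' i, y i ≠ ∞)
    (hle : ∀ᶠ J : ℤ in atBot, ∀ i, distLpNorm ∞ (lowCut χ J (W i)) ≤ y i)
    (hsh : ∀ i, IsSh χ (W i)) : IsSh χ h := by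
  have h1 : ∀ J, distLpNorm ∞ (lowCut χ J h) ≤ ∑' i, distLpNorm ∞ (lowCut χ J (W i)) := fun J =>
    distLpNorm_hasSum_le le_top ((md (symb χ J)).hasSum hW)
  have h2 : Tendsto (fun J : ℤ => ∑' i, distLpNorm ∞ (lowCut χ J (W i))) atBot (𝓝 0) := by
    have := tendsto_lintegral_filter_of_dominated_convergence (μ := (Measure.count : Measure ℤ))
      (l := atBot) (F := fun (J : ℤ) i => distLpNorm ∞ (lowCut χ J (W i))) (f := fun _ => 0) y
      (Eventually.of_forall fun J => measurable_of_countable _)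
      (hle.mono fun J hJ => ae_of_all _ hJ) (by rwa [lintegral_count]) (ae_of_all _ hsh)
    simpa [lintegral_count] using this
  exact tendsto_of_tendsto_of_tendsto_of_le_of_le tendsto_const_nhds h2 (fun _ => zero_le) h1

theorem isSh_of_eventually_eq_zero {χ : Sp d → ℝ} {u : TDist d} (h : ∀ᶠ J : ℤ in atBot, lowCut χ J u = 0) :
    IsSh χ u :=
  tendsto_const_nhds.congr' (h.mono fun J hJ => by simp only [hJ, distLpNorm_zero])

theorem tendsto_zero_of_distLpNorm {q : ℝ≥0∞} (hq : 1 ≤ q) {ι : Type*} {l : Filter ι}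
    {u : ι → TDist d} (hu : Tendsto (fun i => distLpNorm q (u i)) l (𝓝 0)) :
    Tendsto u l (𝓝 0) := by
  have hfin : ∀ᶠ i in l, distLpNorm q (u i) < ∞ := (tendsto_order.1 hu).2 ∞ ENNReal.zero_lt_top
  have key : ∀ i, ∃ w : Sp d → ℂ, MemLp w q volume ∧
      (distLpNorm q (u i) < ∞ → Represents w (u i)) ∧
      eLpNorm w q volume ≤ distLpNorm q (u i) := fun i => by
    by_cases h : distLpNorm q (u i) < ∞
    · obtain ⟨w, hw⟩ := exists_rep_of_distLpNorm_lt h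
      exact ⟨w, hw.1, fun _ => hw.2, (distLpNorm_eq hq hw).ge⟩
    · exact ⟨0, MemLp.zero, fun h' => absurd h' h, by simp⟩
  choose w hw hw' hle using key
  have h0 : Tendsto (fun i => eLpNorm (w i - 0) q volume) l (𝓝 0) := by
    simp only [sub_zero]
    exact tendsto_of_tendsto_of_tendsto_of_le_of_le tendsto_const_nhds hu (fun _ => zero_le) hle
  have h1 := tendsto_tdist hq hw MemLp.zero h0
  rw [tdist_zero] at h1
  exact h1.congr' (hfin.mono fun i hi => (hw' i hi).tdist_eq)

/-- In `𝓢'_h`, `Ṡ_j u` tends to `0`. -/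
theorem IsSh.tendsto_lowCut {χ : Sp d → ℝ} {u : TDist d} (hu : IsSh χ u) :
    Tendsto (fun j : ℤ => lowCut χ j u) atBot (𝓝 0) := tendsto_zero_of_distLpNorm le_top hu

/-! ### Products of bounded functions -/

/-- `u` is a bounded function. -/
def IsBdd (u : TDist d) : Prop := ∃ w, Rep ∞ w u

theorem IsBdd.add {u v : TDist d} (hu : IsBdd u) (hv : IsBdd v) : IsBdd (u + v) := by
  obtain ⟨w, hw⟩ := hu
  obtain ⟨w', hw'⟩ := hv
  refine ⟨w + w', ?_⟩
  rw [← hw.2.tdist_eq, ← hw'.2.tdist_eq, ← tdist_add le_top le_top hw.1 hw'.1]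
  exact rep_tdist le_top (hw.1.add hw'.1)

theorem mulBdd_add_left {u u' v : TDist d} (hu : IsBdd u) (hu' : IsBdd u') (hv : IsBdd v) :
    mulBdd (u + u') v = mulBdd u v + mulBdd u' v := by
  obtain ⟨w, hw⟩ := hu
  obtain ⟨w', hw'⟩ := hu'
  obtain ⟨z, hz⟩ := hv
  have h : Rep ∞ (w + w') (u + u') := by
    rw [← hw.2.tdist_eq, ← hw'.2.tdist_eq, ← tdist_add le_top le_top hw.1 hw'.1]
    exact rep_tdist le_top (hw.1.add hw'.1)
  rw [mulBdd_eq h hz, mulBdd_eq hw hz, mulBdd_eq hw' hz, add_mul, tdist_add le_top le_top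
    (memLp_mul_top hw.1 hz.1) (memLp_mul_top hw'.1 hz.1)]

theorem mulBdd_comm {u v : TDist d} (hu : IsBdd u) (hv : IsBdd v) : mulBdd u v = mulBdd v u := by
  obtain ⟨w, hw⟩ := hu
  obtain ⟨z, hz⟩ := hv
  rw [mulBdd_eq hw hz, mulBdd_eq hz hw, mul_comm]

theorem mulBdd_add_right {u v v' : TDist d} (hu : IsBdd u) (hv : IsBdd v) (hv' : IsBdd v') :
    mulBdd u (v + v') = mulBdd u v + mulBdd u v' := by
  rw [mulBdd_comm hu (hv.add hv'), mulBdd_add_left hv hv' hu, mulBdd_comm hv hu, mulBdd_comm hv' hu]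

theorem eLpNorm_mul_top_le {w w' : Sp d → ℂ} (hw : MemLp w ∞ volume) (hw' : MemLp w' ∞ volume) :
    eLpNorm (w * w') ∞ volume ≤ eLpNorm w ∞ volume * eLpNorm w' ∞ volume := by
  have h := eLpNorm_smul_le_mul_eLpNorm (p := ∞) (q := ∞) (r := ∞) (μ := volume) hw'.1 hw.1
  have e : w • w' = w * w' := by ext x; simp
  rwa [e] at h

theorem distLpNorm_mulBdd_le {u v : TDist d} (hu : IsBdd u) (hv : IsBdd v) :
    distLpNorm ∞ (mulBdd u v) ≤ distLpNorm ∞ u * distLpNorm ∞ v := by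
  obtain ⟨w, hw⟩ := hu
  obtain ⟨z, hz⟩ := hv
  rw [mulBdd_eq hw hz, distLpNorm_eq le_top hw, distLpNorm_eq le_top hz]
  exact (distLpNorm_le (rep_tdist le_top (memLp_mul_top hw.1 hz.1))).trans
    (eLpNorm_mul_top_le hw.1 hz.1)

theorem exists_sum_tendsto {q : ℝ≥0∞} (hq : 1 ≤ q) {w : ℕ → Sp d → ℂ}
    (hw : ∀ i, MemLp (w i) q volume) (hs : ∑' i, eLpNorm (w i) q volume ≠ ∞) :
    ∃ w₀, MemLp w₀ q volume ∧
      Tendsto (fun n => eLpNorm ((∑ i ∈ Finset.range n, w i) - w₀) q volume) atTop (𝓝 0) ∧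
      eLpNorm w₀ q volume ≤ ∑' i, eLpNorm (w i) q volume := by
  have : Fact (1 ≤ q) := ⟨hq⟩
  have hsum : Summable fun i => (hw i).toLp (w i) := by
    refine Summable.of_norm ?_
    simp only [Lp.norm_toLp]
    exact ENNReal.summable_toReal hs
  refine ⟨_, Lp.memLp (∑' i, (hw i).toLp (w i)), ?_, ?_⟩
  · have h := hsum.hasSum.tendsto_sum_nat
    rw [Lp.tendsto_Lp_iff_tendsto_eLpNorm'] at h
    refine h.congr fun n => eLpNorm_congr_ae (EventuallyEq.sub ?_ (EventuallyEq.refl _ _))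
    refine (coeFn_sum_Lp _ _).trans ?_
    have h2 : ∀ᵐ x, ∀ i, (hw i).toLp (w i) x = w i x := ae_all_iff.2 fun i => (hw i).coeFn_toLp
    filter_upwards [h2] with x hx
    simp [hx]
  · have h := enorm_tsum_le_tsum_enorm (f := fun i => (hw i).toLp (w i))
    simpa [Lp.enorm_def, eLpNorm_congr_ae (hw _).coeFn_toLp] using h

/-! ### The dyadic blocks of `f` and of `e^{aΛ₁} f` -/

/-- The functions `w_j` are the blocks of `F = e^{aΛ₁} f`. -/
structure Blocks (χ : Sp d → ℝ) (a : NNReal) (p : ℝ) (f F : TDist d) (w : ℤ → Sp d → ℂ) : Prop where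
  sh : IsSh χ f
  memTop : ∀ j, MemLp (w j) ∞ volume
  memLp : ∀ j, MemLp (w j) (ENNReal.ofReal p) volume
  repF : ∀ j, Represents (w j) (block χ j F)
  repf : ∀ j, Rep ∞ (ps a (w j)) (block χ j f)

theorem IsExp.exists_blocks {χ : Sp d → ℝ} {a : NNReal} {p σ : ℝ} (hp : 1 ≤ p) {f F : TDist d}
    (h : IsExp χ a f F) (hF : besovNorm χ σ p F < ∞) : ∃ w, Blocks χ a p f F w := by
  obtain ⟨hf, -, hw⟩ := h
  choose w h1 h2 h3 using hw
  refine ⟨w, hf, h1, fun j => ?_, h2, fun j => (isExpNeg_iff le_top (h1 j) _).1 (h3 j)⟩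
  have h4 := ENNReal.ne_top_of_tsum_ne_top hF.ne j
  have h5 : distLpNorm (ENNReal.ofReal p) (block χ j F) < ∞ := by
    rw [lt_top_iff_ne_top]
    intro h6
    rw [h6, ENNReal.mul_top] at h4
    · exact h4 rfl
    · rw [Ne, ENNReal.ofReal_eq_zero, not_le]; positivity
  obtain ⟨w', hw'⟩ := exists_rep_of_distLpNorm_lt h5
  exact hw'.1.ae_eq (Rep.unique (by simpa using hp) le_top hw' ⟨h1 j, h2 j⟩)

theorem Blocks.besovNorm_eq {χ : Sp d → ℝ} {a : NNReal} {p : ℝ} (hp : 1 ≤ p) {f F : TDist d}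
    {w : ℤ → Sp d → ℂ} (h : Blocks χ a p f F w) (s : ℝ) : besovNorm χ s p F =
      ∑' j : ℤ, ENNReal.ofReal (2 ^ ((j : ℝ) * s)) * eLpNorm (w j) (ENNReal.ofReal p) volume := by
  refine tsum_congr fun j => ?_
  rw [distLpNorm_eq (by simpa using hp) ⟨h.memLp j, h.repF j⟩]

theorem Blocks.dop_fat {χ : Sp d → ℝ} (hχ : IsCutoff χ) {a : NNReal} {p : ℝ} {f F : TDist d}
    {w : ℤ → Sp d → ℂ} (h : Blocks χ a p f F w) (j : ℤ) : dop (fat χ) j (w j) =ᵐ[volume] w j :=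
  hχ.dop_fat_ae le_top ⟨h.memTop j, h.repF j⟩

theorem Blocks.eLpNorm_top_le {χ : Sp d → ℝ} (hχ : IsCutoff χ) {a : NNReal} {p : ℝ} (hp : 1 ≤ p)
    {f F : TDist d} {w : ℤ → Sp d → ℂ} (h : Blocks χ a p f F w) (j : ℤ) :
    eLpNorm (ps a (w j)) ∞ volume ≤ kC (fat χ) * ENNReal.ofReal (2 ^ ((j : ℝ) * (d / p))) *
      eLpNorm (w j) (ENNReal.ofReal p) volume := by
  refine (eLpNorm_ps_le a le_top (h.memTop j).1).trans ?_
  rw [← eLpNorm_congr_ae (h.dop_fat hχ j)]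
  refine (hχ.isTest_fat.bernstein j (h.memLp j).1 (q := ENNReal.ofReal p) (r := ∞)
    (by simpa using hp) le_top).trans (le_of_eq ?_)
  rw [scl_rpow]
  simp [ENNReal.toReal_ofReal (by linarith : 0 ≤ p), div_eq_mul_inv]

/-- The blocks of an element of `𝓢'_h` are small at low frequencies. -/
theorem IsCutoff.tendsto_block {χ : Sp d → ℝ} (hχ : IsCutoff χ) {f : TDist d} (hf : IsSh χ f) :
    Tendsto (fun j : ℤ => distLpNorm ∞ (block χ j f)) atBot (𝓝 0) := by
  have h1 : ∀ j, distLpNorm ∞ (block χ j f) ≤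
      kC (annulus χ) * distLpNorm ∞ (lowCut χ (j + 2) f) := fun j => by
    have e : block χ j f = dyadic (annulus χ) j (lowCut χ (j + 2) f) := by
      rw [lowCut, dyadic_eq, dyadic_eq, md_md (hχ.isTest_annulus.temperate j)
        (hχ.isTest.temperate _), mul_comm, hχ.chi_mul_annulus le_rfl, block, dyadic_eq]
    rw [e]
    exact hχ.isTest_annulus.distLpNorm_dyadic_le j _ le_top
  have h2 := ENNReal.Tendsto.const_mul (a := kC (annulus χ))
    (hf.comp (tendsto_atBot_add_const_right atBot (2 : ℤ) tendsto_id))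
    (Or.inr hχ.isTest_annulus.kC_lt_top.ne)
  rw [mul_zero] at h2
  exact tendsto_of_tendsto_of_tendsto_of_le_of_le tendsto_const_nhds h2 (fun _ => zero_le) h1

/-- The blocks of low frequency are uniformly bounded. -/
theorem Blocks.exists_bound {χ : Sp d → ℝ} (hχ : IsCutoff χ) {a : NNReal} {p : ℝ} {f F : TDist d}
    {w : ℤ → Sp d → ℂ} (h : Blocks χ a p f F w) (N : ℤ) :
    ∃ C : ℝ≥0∞, C < ∞ ∧ ∀ j ≤ N, eLpNorm (ps a (w j)) ∞ volume ≤ C := by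
  obtain ⟨M, hM⟩ := eventually_atBot.1 ((tendsto_order.1 (hχ.tendsto_block h.sh)).2 1 one_pos)
  refine ⟨1 + ∑ j ∈ Finset.Icc M N, eLpNorm (ps a (w j)) ∞ volume, ENNReal.add_lt_top.2
    ⟨by simp, ENNReal.sum_lt_top.2 fun j _ => (h.repf j).1.2⟩, fun j hj => ?_⟩
  rcases le_total j M with hjM | hjM
  · have := hM j hjM
    rw [distLpNorm_eq le_top (h.repf j)] at this
    exact this.le.trans le_self_add
  · exact (Finset.single_le_sum (f := fun j => eLpNorm (ps a (w j)) ∞ volume)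
      (fun _ _ => zero_le) (Finset.mem_Icc.2 ⟨hjM, hj⟩)).trans le_add_self

/-- `Ṡ_N f` is the sum of the blocks of lower frequency. -/
theorem Blocks.exists_lowCut {χ : Sp d → ℝ} (hχ : IsCutoff χ) {a : NNReal} {p : ℝ} {f F : TDist d}
    {w : ℤ → Sp d → ℂ} (h : Blocks χ a p f F w) (N : ℤ)
    (hs : ∑' n : ℕ, eLpNorm (ps a (w (N - 1 - n))) ∞ volume ≠ ∞) :
    ∃ S : Sp d → ℂ, Rep ∞ S (lowCut χ N f) ∧
      Tendsto (fun m => eLpNorm ((∑ n ∈ Finset.range m, ps a (w (N - 1 - (n : ℕ)))) - S) ∞ volume)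
        atTop (𝓝 0) ∧
      eLpNorm S ∞ volume ≤ ∑' n : ℕ, eLpNorm (ps a (w (N - 1 - n))) ∞ volume := by
  obtain ⟨S, hS, ht, hle⟩ := exists_sum_tendsto le_top (fun n : ℕ => (h.repf (N - 1 - n)).1) hs
  refine ⟨S, ?_, ht, hle⟩
  have h1 := tendsto_tdist le_top
    (fun m => memLp_finsetSum' (Finset.range m) fun n _ => (h.repf (N - 1 - (n : ℕ))).1) hS ht
  have h2 : Tendsto (fun m : ℕ => lowCut χ N f - lowCut χ (N - m) f) atTop (𝓝 (lowCut χ N f - 0)) :=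
    tendsto_const_nhds.sub (h.sh.tendsto_lowCut.comp
      (tendsto_atBot_add_const_left _ N (tendsto_neg_atTop_atBot.comp tendsto_natCast_atTop_atTop)))
  rw [sub_zero] at h2
  have e : tdist S = lowCut χ N f := by
    refine tendsto_nhds_unique h1 (h2.congr fun m => ?_)
    rw [← hχ.sum_block (by omega), tdist_sum _ le_top fun n _ => (h.repf (N - 1 - (n : ℕ))).1]
    refine Finset.sum_bij' (fun j _ => (N - 1 - j).toNat) (fun n _ => N - 1 - n) ?_ ?_ ?_ ?_ ?_
    · intro j hj; simp only [Finset.mem_Ico, Finset.mem_range] at hj ⊢; omega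
    · intro j hj; simp only [Finset.mem_Ico, Finset.mem_range] at hj ⊢; omega
    · intro j hj; simp only [Finset.mem_Ico] at hj; omega
    · intro j hj; omega
    · intro j hj
      simp only [Finset.mem_Ico] at hj
      rw [show N - 1 - ((N - 1 - j).toNat : ℤ) = j by omega, (h.repf j).2.tdist_eq]
  rw [← e]
  exact rep_tdist le_top hS

/-! ### Series of products -/

theorem hasSum_tdist_fm {ι : Type*} {b : ι → L2 d} {b₀ : L2 d} (h : HasSum b b₀) (m : Sp d → ℂ) :
    HasSum (fun i => tdist (fm m (b i))) (tdist (fm m b₀)) := by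
  have := ((Lp.toTemperedDistributionCLM ℂ (volume : Measure (Sp d)) 2).comp (fm m)).hasSum h
  simpa only [ContinuousLinearMap.comp_apply, Lp.toTemperedDistributionCLM_apply, ← tdist_coe,
    Function.comp_def] using this

theorem summable_of_enorm {ι : Type*} {b : ι → L2 d} (h : ∑' i, ‖b i‖ₑ ≠ ∞) : Summable b := by
  refine Summable.of_norm ?_
  have := ENNReal.summable_toReal h
  simpa using this

theorem two_rpow_mul (x y : ℝ) : ENNReal.ofReal (2 ^ x) * ENNReal.ofReal (2 ^ y) =
    ENNReal.ofReal (2 ^ (x + y)) := by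
  rw [← ENNReal.ofReal_mul (by positivity), ← Real.rpow_add two_pos]

theorem two_rpow_mono {x y : ℝ} (h : x ≤ y) : ENNReal.ofReal (2 ^ x) ≤ ENNReal.ofReal (2 ^ y) :=
  ENNReal.ofReal_le_ofReal (Real.rpow_le_rpow_of_exponent_le one_le_two h)

theorem two_rpow_ne_zero (x : ℝ) : ENNReal.ofReal (2 ^ x) ≠ 0 := by
  rw [Ne, ENNReal.ofReal_eq_zero, not_le]; positivity

/-- If the blocks of the terms of a series `h = ∑ W_i` are of the form `e^{-aΛ₁} c_{i,j}`, then
`e^{aΛ₁} h` has the blocks `∑_i c_{i,j}`. -/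
theorem IsCutoff.exists_isExp_of_hasSum {χ : Sp d → ℝ} (hχ : IsCutoff χ) {a : NNReal} {ι : Type*}
    {W : ι → TDist d} {h : TDist d} (hh : IsSh χ h) (hW : HasSum W h) {c : ι → ℤ → L2 d}
    (hc : ∀ i j, tdist (fm (esym fun _ => a) (c i j)) = block χ j (W i)) {s : ℝ} {M : ℝ≥0∞}
    (hM : M < ∞) (hcM : ∑' i, ∑' j : ℤ, ENNReal.ofReal (2 ^ ((j : ℝ) * s)) * ‖c i j‖ₑ ≤ M) :
    ∃ H : TDist d, IsExp χ a h H ∧ besovNorm χ s 2 H ≤ M := by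
  rw [ENNReal.tsum_comm] at hcM
  simp_rw [ENNReal.tsum_mul_left] at hcM
  have hj : ∀ j : ℤ, ENNReal.ofReal (2 ^ ((j : ℝ) * s)) * ∑' i, ‖c i j‖ₑ ≤ M := fun j =>
    (ENNReal.le_tsum j).trans hcM
  have hfin : ∀ j, ∑' i, ‖c i j‖ₑ ≠ ∞ := fun j hj' => by
    have h1 := (hj j).trans_lt hM
    rw [hj', ENNReal.mul_top (two_rpow_ne_zero _)] at h1
    exact h1.ne rfl
  have hle : ∀ j, ‖∑' i, c i j‖ₑ ≤ ∑' i, ‖c i j‖ₑ := fun j => enorm_tsum_le_tsum_enorm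
  have hdec : IsDec χ a h fun j => ∑' i, c i j := fun j => by
    have h1 := hasSum_tdist_fm (summable_of_enorm (hfin j)).hasSum (esym fun _ => a)
    simp_rw [hc] at h1
    exact h1.unique ((md (symb (annulus χ) j)).hasSum hW)
  -- The Besov bound itself limits each single block by `M 2^(-sj)`, which is the growth condition
  -- required here.
  obtain ⟨H, hH, hb⟩ := hdec.exists_isExp hχ hh (C := M.toReal) (s := -s) fun j => by
    have h1 : ENNReal.ofReal (2 ^ ((j : ℝ) * s)) * ‖∑' i, c i j‖ₑ ≤ M :=
      (mul_le_mul_right (hle j) _).trans (by simpa using hj j)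
    have h2 := ENNReal.toReal_mono hM.ne h1
    rw [ENNReal.toReal_mul, ENNReal.toReal_ofReal (by positivity), toReal_enorm] at h2
    calc ‖∑' i, c i j‖ = 2 ^ ((j : ℝ) * s) * ‖∑' i, c i j‖ * 2 ^ (-s * j) := by
          rw [mul_right_comm, ← Real.rpow_add two_pos]
          ring_nf
          simp
      _ ≤ _ := by gcongr
  refine ⟨H, hH, (besovNorm_two_le hb).trans ((ENNReal.tsum_le_tsum fun j => ?_).trans hcM)⟩
  exact mul_le_mul_right (hle j) _

/-- The blocks of `f` are of the form `φ(2^{-j}D)(…)`. -/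
theorem Blocks.dop_annulus_ae {χ : Sp d → ℝ} (hχ : IsCutoff χ) {a : NNReal} {p : ℝ} {f F : TDist d}
    {w : ℤ → Sp d → ℂ} (h : Blocks χ a p f F w) (j : ℤ) : ps a (w j) =ᵐ[volume]
      dop (annulus χ) j (ps a (w (j - 1)) + ps a (w j) + ps a (w (j + 1))) := by
  have h1 : Rep ∞ (ps a (w (j - 1)) + ps a (w j) + ps a (w (j + 1)))
      (block χ (j - 1) f + block χ j f + block χ (j + 1) f) := by
    have e : tdist (ps a (w (j - 1)) + ps a (w j) + ps a (w (j + 1))) =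
        block χ (j - 1) f + block χ j f + block χ (j + 1) f := by
      rw [tdist_add le_top le_top ((h.repf _).1.add (h.repf _).1) (h.repf _).1,
        tdist_add le_top le_top (h.repf _).1 (h.repf _).1, (h.repf _).2.tdist_eq,
        (h.repf _).2.tdist_eq, (h.repf _).2.tdist_eq]
    rw [← e]
    exact rep_tdist le_top (((h.repf _).1.add (h.repf _).1).add (h.repf _).1)
  have h2 := hχ.isTest_annulus.rep_dyadic j le_top h1
  have ht := fun i => hχ.isTest_annulus.temperate i
  have e : dyadic (annulus χ) j (block χ (j - 1) f + block χ j f + block χ (j + 1) f) =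
      block χ j f := by
    simp only [block, dyadic_eq, map_add]
    rw [md_md (ht _) (ht _), md_md (ht _) (ht _), md_md (ht _) (ht _)]
    have hs := md_sum (Finset.Icc (j - 1) (j + 1))
      (m := fun i => symb (annulus χ) j * symb (annulus χ) i)
      (fun i _ => (ht j).mul (ht i)) f
    have hI : Finset.Icc (j - 1) (j + 1) = {j - 1, j, j + 1} := by
      ext x; simp only [Finset.mem_Icc, Finset.mem_insert, Finset.mem_singleton]; omega
    rw [hI, Finset.sum_insert (by simp; omega), Finset.sum_insert (by simp),
      Finset.sum_singleton] at hs
    rw [add_assoc, ← hs]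
    congr 2
    conv_rhs => rw [← hχ.annulus_fattened j]
    ext ξ
    simp [Finset.sum_insert (show j - 1 ∉ ({j, j + 1} : Finset ℤ) by simp; omega)]
    ring
  rw [e] at h2
  exact Rep.unique le_top le_top (h.repf j) h2

theorem Blocks.memLp_ps {χ : Sp d → ℝ} {a : NNReal} {p : ℝ} (hp : 1 ≤ p) {f F : TDist d}
    {w : ℤ → Sp d → ℂ} (h : Blocks χ a p f F w) (j : ℤ) :
    MemLp (ps a (w j)) (ENNReal.ofReal p) volume :=
  GevreyBesov.memLp_ps a (by simpa using hp) (h.memLp j)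

/-- The frequencies of a product of two blocks. -/
theorem Blocks.md_mul_eq_zero {χ : Sp d → ℝ} (hχ : IsCutoff χ) {a : NNReal} {p : ℝ} (hp : 2 ≤ p)
    {f F g G : TDist d} {w z : ℤ → Sp d → ℂ} (hw : Blocks χ a p f F w) (hz : Blocks χ a p g G z)
    {m : Sp d → ℝ} (hm : IsTest m) {i j k : ℤ}
    (h0 : ∀ ξ η, symb m j (ξ + η) ≠ 0 → symb (annulus χ) k ξ ≠ 0 → symb (annulus χ) i η = 0) :
    md (symb m j) (tdist (ps a (w k) * ps a (z i))) = 0 := by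
  have hp1 : 1 ≤ p := by linarith
  have ht := hχ.isTest_annulus
  rw [tdist_congr ((hw.dop_annulus_ae hχ k).mul (hz.dop_annulus_ae hχ i))]
  refine md_tdist_mul_eq_zero (p := ENNReal.ofReal p) (by simpa using hp) (by simp) (ht.isKer k)
    (ht.isKer i) (hm.memLp_symb j) (hm.temperate j) (fun ξ η => ?_)
    (((hw.memLp_ps hp1 _).add (hw.memLp_ps hp1 _)).add (hw.memLp_ps hp1 _))
    (((hz.memLp_ps hp1 _).add (hz.memLp_ps hp1 _)).add (hz.memLp_ps hp1 _))
  by_contra hne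
  exact right_ne_zero_of_mul (right_ne_zero_of_mul hne)
    (h0 ξ η (left_ne_zero_of_mul hne) (left_ne_zero_of_mul (right_ne_zero_of_mul hne)))

/-! ### Interaction of frequency supports -/

theorem norm_sub_le_norm_add (ξ η : Sp d) : ‖η‖ - ‖ξ‖ ≤ ‖ξ + η‖ := by
  have := norm_sub_norm_le η (-ξ)
  rwa [norm_neg, sub_neg_eq_add, add_comm η] at this

/-- Up to the factor `2π`, `|η| ≥ 3/4 · 2^i` and `|ξ| ≤ 8/3 · 2^(i-2)` leave `|ξ + η| ≥ 2^i/12`,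
while the cutoff at level `j ≤ i - 5` ends at `4/3 · 2^(i-5) = 2^i/24`. -/
theorem IsCutoff.para_chi {χ : Sp d → ℝ} (hχ : IsCutoff χ) {i j k : ℤ} (hk : k ≤ i - 2)
    (hj : j ≤ i - 5) (ξ η : Sp d) (h1 : symb χ j (ξ + η) ≠ 0) (h2 : symb (annulus χ) k ξ ≠ 0) :
    symb (annulus χ) i η = 0 := by
  by_contra h3
  have e1 := hχ.le_of_symb_ne_zero h1
  have e2 := hχ.mem_of_symb_annulus_ne_zero h2
  have e3 := hχ.mem_of_symb_annulus_ne_zero h3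
  have e4 := mul_le_mul_of_nonneg_left (norm_sub_le_norm_add ξ η) (by positivity : 0 ≤ 2 * Real.pi)
  have e5 := two_zpow_le 2 (show k + (2 : ℕ) ≤ i by push_cast; omega)
  have e6 := two_zpow_le 5 (show j + (5 : ℕ) ≤ i by push_cast; omega)
  have e7 : (0 : ℝ) < 2 ^ i := by positivity
  rw [mul_sub] at e4
  linarith

/-- Up to the factor `2π`, `|ξ + η|` lies between `2^i/12` and `10/3 · 2^i`. The annulus `i - 6`
ends at `2^i/24` and the annulus `i + 6` begins at `48 · 2^i`. -/
theorem IsCutoff.para_annulus {χ : Sp d → ℝ} (hχ : IsCutoff χ) {i j k : ℤ} (hk : k ≤ i - 2)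
    (hj : j ∉ Finset.Icc (i - 5) (i + 5)) (ξ η : Sp d) (h1 : symb (annulus χ) j (ξ + η) ≠ 0)
    (h2 : symb (annulus χ) k ξ ≠ 0) : symb (annulus χ) i η = 0 := by
  by_contra h3
  have e1 := hχ.mem_of_symb_annulus_ne_zero h1
  have e2 := hχ.mem_of_symb_annulus_ne_zero h2
  have e3 := hχ.mem_of_symb_annulus_ne_zero h3
  have e4 := mul_le_mul_of_nonneg_left (norm_sub_le_norm_add ξ η) (by positivity : 0 ≤ 2 * Real.pi)
  have e8 := mul_le_mul_of_nonneg_left (norm_add_le ξ η) (by positivity : 0 ≤ 2 * Real.pi)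
  have e5 := two_zpow_le 2 (show k + (2 : ℕ) ≤ i by push_cast; omega)
  have e7 : (0 : ℝ) < 2 ^ i := by positivity
  rw [Finset.mem_Icc, not_and_or, not_le, not_le] at hj
  rw [mul_sub] at e4
  rw [mul_add] at e8
  rcases hj with hj | hj
  · have e6 := two_zpow_le 6 (show j + (6 : ℕ) ≤ i by push_cast; omega)
    linarith
  · have e6 := two_zpow_le 5 (show i + (5 : ℕ) ≤ j by push_cast; omega)
    linarith

/-- The sum of the frequencies is at most `8/3 · (1 + 2) · 2^k = 8 · 2^k`, below the inner radius
`12 · 2^k` of the annulus `k + 4`. -/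
theorem IsCutoff.rem_annulus {χ : Sp d → ℝ} (hχ : IsCutoff χ) {i j k : ℤ} (hk : i ≤ k + 1)
    (hj : k + 4 ≤ j) (ξ η : Sp d) (h1 : symb (annulus χ) j (ξ + η) ≠ 0)
    (h2 : symb (annulus χ) k ξ ≠ 0) : symb (annulus χ) i η = 0 := by
  by_contra h3
  have e1 := hχ.mem_of_symb_annulus_ne_zero h1
  have e2 := hχ.mem_of_symb_annulus_ne_zero h2
  have e3 := hχ.mem_of_symb_annulus_ne_zero h3
  have e8 := mul_le_mul_of_nonneg_left (norm_add_le ξ η) (by positivity : 0 ≤ 2 * Real.pi)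
  have e5 : (2 : ℝ) ^ i ≤ 2 * 2 ^ k := by
    rw [mul_comm, ← zpow_add_one₀ two_ne_zero]
    exact zpow_le_zpow_right₀ (by norm_num) hk
  have e7 : (0 : ℝ) < 2 ^ k := by positivity
  rw [mul_add] at e8
  have e6 := two_zpow_le 4 (show k + (4 : ℕ) ≤ j by push_cast; omega)
  linarith

theorem IsTest.enorm_fm_symb_le {m : Sp d → ℝ} (hm : IsTest m) (j : ℤ) (b : L2 d) :
    ‖fm (symb m j) b‖ₑ ≤ kC m * ‖b‖ₑ := by
  rw [Lp.enorm_def, Lp.enorm_def, eLpNorm_congr_ae (hm.fm_symb_ae j b)]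
  exact hm.eLpNorm_dop_le j (Lp.memLp b).1 (by norm_num)

theorem IsTest.fm_symb_eq_zero {m : Sp d → ℝ} (hm : IsTest m) {a : NNReal} {j : ℤ} {b : L2 d}
    (h : md (symb m j) (tdist (fm (esym fun _ => a) b)) = 0) : fm (symb m j) b = 0 := by
  have h1 := hm.dyadic_tdist j (fm (esym fun _ => a) b)
  rw [dyadic_eq, h, fm_comm (hm.memLp_symb j) (memLp_esym _)] at h1
  have h2 : tdist (fm (esym fun _ : Fin d => a) (fm (symb m j) b)) = tdist (fm (esym fun _ => a) 0) := by
    rw [← h1, map_zero, tdist_congr (Lp.coeFn_zero _ _ _), tdist_zero]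
  exact fm_injective (memLp_esym _) (esym_ne_zero _) (tdist_L2_injective h2)

/-! ### The paraproduct -/

theorem Blocks.term_le {χ : Sp d → ℝ} {a : NNReal} {p : ℝ} (hp : 1 ≤ p) {f F : TDist d}
    {w : ℤ → Sp d → ℂ} (h : Blocks χ a p f F w) (s : ℝ) (j : ℤ) :
    ENNReal.ofReal (2 ^ ((j : ℝ) * s)) * eLpNorm (w j) (ENNReal.ofReal p) volume ≤
      besovNorm χ s p F := by
  rw [h.besovNorm_eq hp]
  exact ENNReal.le_tsum j

theorem sub_two_sub_injective (i : ℤ) : Function.Injective fun n : ℕ => i - 1 - 1 - (n : ℤ) :=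
  fun m n h => by simpa using h

/-- The function `Ṡ_{i-1} f` is bounded by `2^i`, for `f` of regularity `d/p - 1`. -/
theorem Blocks.tsum_eLpNorm_top_le {χ : Sp d → ℝ} (hχ : IsCutoff χ) {a : NNReal} {p : ℝ}
    (hp : 1 ≤ p) {f F : TDist d} {w : ℤ → Sp d → ℂ} (h : Blocks χ a p f F w) (i : ℤ) :
    ∑' n : ℕ, eLpNorm (ps a (w (i - 1 - 1 - n))) ∞ volume ≤
      kC (fat χ) * ENNReal.ofReal (2 ^ (i : ℝ)) * besovNorm χ (d / p - 1) p F := by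
  calc ∑' n : ℕ, eLpNorm (ps a (w (i - 1 - 1 - n))) ∞ volume
      ≤ ∑' n : ℕ, kC (fat χ) * ENNReal.ofReal (2 ^ (i : ℝ)) *
          (ENNReal.ofReal (2 ^ (((i - 1 - 1 - n : ℤ) : ℝ) * (d / p - 1))) *
            eLpNorm (w (i - 1 - 1 - n)) (ENNReal.ofReal p) volume) := by
        refine ENNReal.tsum_le_tsum fun n => (h.eLpNorm_top_le hχ hp _).trans ?_
        rw [mul_assoc, mul_assoc, ← mul_assoc (ENNReal.ofReal (2 ^ (i : ℝ))), two_rpow_mul]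
        gcongr
        · exact one_le_two
        · push_cast
          have : (0 : ℝ) ≤ n := n.cast_nonneg
          linarith
    _ ≤ _ := by
        rw [ENNReal.tsum_mul_left, h.besovNorm_eq hp]
        gcongr
        exact ENNReal.tsum_comp_le_tsum_of_injective (sub_two_sub_injective i) (fun j : ℤ =>
          ENNReal.ofReal (2 ^ ((j : ℝ) * (d / p - 1))) * eLpNorm (w j) (ENNReal.ofReal p) volume)

/-- The terms of the paraproduct. -/
theorem Blocks.exists_para_term {χ : Sp d → ℝ} (hχ : IsCutoff χ) {a : NNReal} {p : ℝ} (hp : 2 ≤ p)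
    (hpd : p * ((d : ℝ) - 2) ≤ 2 * d) {f F g G : TDist d} {w z : ℤ → Sp d → ℂ}
    (hw : Blocks χ a p f F w) (hz : Blocks χ a p g G z) (hF : besovNorm χ (d / p - 1) p F < ∞)
    {C : ℝ≥0∞} (hC : C < ∞) (hmul : ∀ (k : ℤ) (w₁ w₂ : Sp d → ℂ),
      MemLp w₁ (ENNReal.ofReal p) volume → MemLp w₂ (ENNReal.ofReal p) volume →
      dop (fat χ) k w₁ =ᵐ[volume] w₁ →
      ∃ b : L2 d, tdist (fm (esym fun _ => a) b) = tdist (ps a w₁ * ps a w₂) ∧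
        ‖b‖ₑ ≤ C * ENNReal.ofReal (2 ^ ((k : ℝ) * (d * (2 / p - 1 / 2)))) *
          (eLpNorm w₁ (ENNReal.ofReal p) volume * eLpNorm w₂ (ENNReal.ofReal p) volume)) (i : ℤ) :
    ∃ (S : Sp d → ℂ) (b : L2 d), Rep ∞ S (lowCut χ (i - 1) f) ∧
      eLpNorm S ∞ volume ≤
        kC (fat χ) * ENNReal.ofReal (2 ^ (i : ℝ)) * besovNorm χ (d / p - 1) p F ∧
      mulBdd (lowCut χ (i - 1) f) (block χ i g) = tdist (fm (esym fun _ => a) b) ∧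
      (∀ j ≤ i - 5, fm (symb χ j) b = 0) ∧
      (∀ j ∉ Finset.Icc (i - 5) (i + 5), fm (symb (annulus χ) j) b = 0) ∧
      ‖b‖ₑ ≤ C * besovNorm χ (d / p - 1) p F * (ENNReal.ofReal (2 ^ ((i : ℝ) * (d / p - d / 2 + 1))) *
        eLpNorm (z i) (ENNReal.ofReal p) volume) := by
  have hp1 : 1 ≤ p := by linarith
  have hp0 : 0 < p := by linarith
  -- This is where `p ≤ 2d/(d-2)` is used. The Bernstein exponent `d(2/p - 1/2)` is `κ + (d/p - 1)`
  -- with `κ = d/p - d/2 + 1`; as `κ ≥ 0`, the factor `2^(kκ)` is at most `2^(iκ)` for `k ≤ i`, and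
  -- the sum over `k` is part of the norm of `F`.
  have hκ : 0 ≤ (d : ℝ) / p - d / 2 + 1 := by
    have : (d : ℝ) / p - d / 2 + 1 = (2 * d - p * (d - 2)) / (2 * p) := by field_simp; ring
    rw [this]
    exact div_nonneg (by linarith) (by linarith)
  have h1 := hw.tsum_eLpNorm_top_le hχ hp1 i
  obtain ⟨S, hS, hSt, hSle⟩ := hw.exists_lowCut hχ (i - 1) (h1.trans_lt (ENNReal.mul_lt_top
    (ENNReal.mul_lt_top hχ.isTest_fat.kC_lt_top ENNReal.ofReal_lt_top) hF)).ne
  choose c hc hcle using fun k => hmul k (w k) (z i) (hw.memLp k) (hz.memLp i) (hw.dop_fat hχ k)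
  have hsum : ∑' n : ℕ, ‖c (i - 1 - 1 - n)‖ₑ ≤ C * besovNorm χ (d / p - 1) p F *
      (ENNReal.ofReal (2 ^ ((i : ℝ) * (d / p - d / 2 + 1))) *
        eLpNorm (z i) (ENNReal.ofReal p) volume) := by
    calc ∑' n : ℕ, ‖c (i - 1 - 1 - n)‖ₑ
        ≤ ∑' n : ℕ, C * (ENNReal.ofReal (2 ^ ((i : ℝ) * (d / p - d / 2 + 1))) *
            eLpNorm (z i) (ENNReal.ofReal p) volume) *
          (ENNReal.ofReal (2 ^ (((i - 1 - 1 - n : ℤ) : ℝ) * (d / p - 1))) *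
            eLpNorm (w (i - 1 - 1 - n)) (ENNReal.ofReal p) volume) := by
          refine ENNReal.tsum_le_tsum fun n => (hcle _).trans ?_
          set k : ℤ := i - 1 - 1 - n
          have hk : (k : ℝ) ≤ i := by exact_mod_cast (by omega : k ≤ i)
          have e : ENNReal.ofReal (2 ^ ((k : ℝ) * (d * (2 / p - 1 / 2)))) ≤
              ENNReal.ofReal (2 ^ ((i : ℝ) * (d / p - d / 2 + 1))) *
                ENNReal.ofReal (2 ^ ((k : ℝ) * (d / p - 1))) := by
            rw [two_rpow_mul]
            refine two_rpow_mono ?_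
            have := mul_le_mul_of_nonneg_right hk hκ
            calc (k : ℝ) * (d * (2 / p - 1 / 2)) =
                k * (d / p - d / 2 + 1) + k * (d / p - 1) := by ring
              _ ≤ _ := by linarith
          calc _ ≤ C * (ENNReal.ofReal (2 ^ ((i : ℝ) * (d / p - d / 2 + 1))) *
                ENNReal.ofReal (2 ^ ((k : ℝ) * (d / p - 1)))) *
                (eLpNorm (w k) (ENNReal.ofReal p) volume *
                  eLpNorm (z i) (ENNReal.ofReal p) volume) := by gcongr
            _ = _ := by ring
      _ ≤ C * (ENNReal.ofReal (2 ^ ((i : ℝ) * (d / p - d / 2 + 1))) *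
            eLpNorm (z i) (ENNReal.ofReal p) volume) * besovNorm χ (d / p - 1) p F := by
          rw [ENNReal.tsum_mul_left, hw.besovNorm_eq hp1]
          gcongr
          exact ENNReal.tsum_comp_le_tsum_of_injective (sub_two_sub_injective i) (fun j : ℤ =>
            ENNReal.ofReal (2 ^ ((j : ℝ) * (d / p - 1))) * eLpNorm (w j) (ENNReal.ofReal p) volume)
      _ = _ := by ring
  have hfin : ∑' n : ℕ, ‖c (i - 1 - 1 - n)‖ₑ ≠ ∞ := (hsum.trans_lt (ENNReal.mul_lt_top
    (ENNReal.mul_lt_top hC hF) (ENNReal.mul_lt_top ENNReal.ofReal_lt_top (hz.memLp i).2))).ne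
  have hb := (summable_of_enorm hfin).hasSum
  have hW : mulBdd (lowCut χ (i - 1) f) (block χ i g) =
      tdist (fm (esym fun _ => a) (∑' n : ℕ, c (i - 1 - 1 - n))) := by
    -- The partial sums converge to `b` in `L²` on one side and to `Ṡ_{i-1}f` in `L^∞` on the other;
    -- the two limits are compared as distributions.
    have l1 := (hasSum_tdist_fm hb (esym fun _ => a)).tendsto_sum_nat
    rw [mulBdd_eq hS (hz.repf i)]
    have hm : ∀ m : ℕ, MemLp (∑ n ∈ Finset.range m, ps a (w (i - 1 - 1 - (n : ℕ)))) ∞ volume :=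
      fun m => memLp_finsetSum' _ fun n _ => (hw.repf _).1
    have l2 : Tendsto (fun m : ℕ => tdist
        ((∑ n ∈ Finset.range m, ps a (w (i - 1 - 1 - (n : ℕ)))) * ps a (z i)))
        atTop (𝓝 (tdist (S * ps a (z i)))) := by
      refine tendsto_tdist le_top (fun m => memLp_mul_top (hm m) (hz.repf i).1)
        (memLp_mul_top hS.1 (hz.repf i).1) ?_
      have l3 := ENNReal.Tendsto.mul_const hSt (b := eLpNorm (ps a (z i)) ∞ volume)
        (Or.inr (hz.repf i).1.2.ne)
      rw [zero_mul] at l3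
      refine tendsto_of_tendsto_of_tendsto_of_le_of_le tendsto_const_nhds l3 (fun _ => zero_le)
        fun m => ?_
      simp only [← sub_mul]
      exact eLpNorm_mul_top_le ((hm m).sub hS.1) (hz.repf i).1
    refine tendsto_nhds_unique l2 (l1.congr fun m => ?_)
    rw [Finset.sum_mul, tdist_sum _ le_top fun n _ => memLp_mul_top (hw.repf _).1 (hz.repf i).1]
    exact Finset.sum_congr rfl fun n _ => hc _
  have hzero : ∀ {m : Sp d → ℝ} (_ : IsTest m) (j : ℤ), (∀ n : ℕ, md (symb m j)
      (tdist (ps a (w (i - 1 - 1 - n)) * ps a (z i))) = 0) →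
      fm (symb m j) (∑' n : ℕ, c (i - 1 - 1 - n)) = 0 := fun {m} hm j h0 => by
    rw [(fm (symb m j)).map_tsum (summable_of_enorm hfin)]
    refine (tsum_congr fun n => ?_).trans tsum_zero
    exact hm.fm_symb_eq_zero (a := a) (by rw [hc]; exact h0 n)
  refine ⟨S, ∑' n : ℕ, c (i - 1 - 1 - n), hS, hSle.trans h1, hW, fun j hj => ?_, fun j hj => ?_,
    enorm_tsum_le_tsum_enorm.trans hsum⟩
  · exact hzero hχ.isTest j fun n => hw.md_mul_eq_zero hχ hp hz hχ.isTest
      fun ξ η => hχ.para_chi (by omega) hj ξ η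
  · exact hzero hχ.isTest_annulus j fun n => hw.md_mul_eq_zero hχ hp hz hχ.isTest_annulus
      fun ξ η => hχ.para_annulus (by omega) hj ξ η

theorem summable_of_distLpNorm {q : ℝ≥0∞} (hq : 1 ≤ q) {ι : Type*} {W : ι → TDist d}
    (hs : ∑' i, distLpNorm q (W i) ≠ ∞) : Summable W := by
  choose w hw using fun i => exists_rep_of_distLpNorm_lt
    (lt_top_iff_ne_top.2 (ENNReal.ne_top_of_tsum_ne_top hs i))
  obtain ⟨w₀, -, h, -⟩ := exists_hasSum_tdist hq (fun i => (hw i).1) (by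
    simpa only [distLpNorm_eq hq (hw _)] using hs)
  exact h.summable.congr fun i => (hw i).2.tdist_eq

theorem summable_of_low {W : ℤ → TDist d}
    (hlow : ∑' n : ℕ, distLpNorm ∞ (W (-(n + 1 : ℤ))) ≠ ∞) (hhigh : Summable fun n : ℕ => W n) :
    Summable W :=
  (HasSum.of_nat_of_neg_add_one hhigh.hasSum (summable_of_distLpNorm le_top hlow).hasSum).summable

theorem IsCutoff.isSh_of_low {χ : Sp d → ℝ} (hχ : IsCutoff χ) {W : ℤ → TDist d} {h : TDist d}
    (hW : HasSum W h) (hlow : ∑' n : ℕ, distLpNorm ∞ (W (-(n + 1 : ℤ))) ≠ ∞) {y : ℕ → ℝ≥0∞}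
    (hy : ∑' n, y n ≠ ∞)
    (hle : ∀ᶠ J : ℤ in atBot, ∀ n : ℕ, distLpNorm ∞ (lowCut χ J (W n)) ≤ y n)
    (hsh : ∀ i, IsSh χ (W i)) : IsSh χ h := by
  set Y : ℤ → ℝ≥0∞ := fun i => if 0 ≤ i then y i.toNat else kC χ * distLpNorm ∞ (W i) with hY
  refine isSh_of_hasSum hW (y := Y) ?_ (hle.mono fun J hJ i => ?_) hsh
  · rw [tsum_of_nat_of_neg_add_one ENNReal.summable ENNReal.summable]
    refine ENNReal.add_ne_top.2 ⟨by simpa [hY] using hy, ?_⟩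
    have e : ∀ n : ℕ, Y (-(n + 1 : ℤ)) = kC χ * distLpNorm ∞ (W (-(n + 1 : ℤ))) := fun n =>
      if_neg (by omega)
    simp_rw [e, ENNReal.tsum_mul_left]
    exact ENNReal.mul_ne_top hχ.isTest.kC_lt_top.ne hlow
  · by_cases hi : 0 ≤ i
    · lift i to ℕ using hi
      simpa [hY] using hJ i
    · simp only [hY, if_neg hi]
      exact hχ.isTest.distLpNorm_dyadic_le J _ le_top

theorem tsum_two_neg_ne_top : ∑' n : ℕ, ENNReal.ofReal (2 ^ ((-(n + 1 : ℤ) : ℤ) : ℝ)) ≠ ∞ := by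
  refine Summable.tsum_ofReal_ne_top ?_
  refine (summable_geometric_two.mul_left (1 / 2)).congr fun n => ?_
  rw [Real.rpow_intCast, zpow_neg, zpow_add_one₀ two_ne_zero, zpow_natCast]
  simp [mul_comm]

/-- The paraproduct estimate. -/
theorem IsCutoff.exists_paraproduct {χ : Sp d → ℝ} (hχ : IsCutoff χ) {p : ℝ} (hp : 2 ≤ p)
    (hp4 : p ≤ 4) (hpd : p * ((d : ℝ) - 2) ≤ 2 * d) (s : ℝ) :
    ∃ C : ℝ≥0∞, C < ∞ ∧ ∀ (a : NNReal) (f g F G : TDist d), IsExp χ a f F → IsExp χ a g G →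
      besovNorm χ (d / p - 1) p F < ∞ → besovNorm χ (s + 1 - d / 2 + d / p) p G < ∞ →
      ∃ h H : TDist d, IsParaproduct χ f g h ∧ IsExp χ a h H ∧ besovNorm χ s 2 H ≤
        C * (besovNorm χ (d / p - 1) p F * besovNorm χ (s + 1 - d / 2 + d / p) p G) := by
  obtain ⟨C, hC, hmul⟩ := hχ.exists_mul_L2 hp hp4
  have hp1 : 1 ≤ p := by linarith
  -- At most `11` output blocks, those with `|j - i| ≤ 5`, meet the term `i`, and `2^(5|s|)`
  -- compares their weights with `2^(is)`.
  set K : ℝ≥0∞ := 11 * (ENNReal.ofReal (2 ^ (5 * |s|)) * kC (annulus χ)) with hK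
  have hKt : K < ∞ := ENNReal.mul_lt_top (by simp)
    (ENNReal.mul_lt_top ENNReal.ofReal_lt_top hχ.isTest_annulus.kC_lt_top)
  refine ⟨K * C, ENNReal.mul_lt_top hKt hC, fun a f g F G hfF hgG hF hG => ?_⟩
  obtain ⟨w, hw⟩ := hfF.exists_blocks hp1 hF
  obtain ⟨z, hz⟩ := hgG.exists_blocks hp1 hG
  choose S b hS hSle hW hlow hann hb using
    hw.exists_para_term hχ hp hpd hz hF hC (fun k w₁ w₂ => hmul a k w₁ w₂)
  set NF := besovNorm χ (d / p - 1) p F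
  set NG := besovNorm χ (s + 1 - d / 2 + d / p) p G
  have hbs : ∀ i : ℤ, ENNReal.ofReal (2 ^ ((i : ℝ) * s)) * ‖b i‖ₑ ≤
      C * NF * (ENNReal.ofReal (2 ^ ((i : ℝ) * (s + 1 - d / 2 + d / p))) *
        eLpNorm (z i) (ENNReal.ofReal p) volume) := fun i => by
    refine (mul_le_mul_right (hb i) _).trans (le_of_eq ?_)
    rw [mul_left_comm, ← mul_assoc (ENNReal.ofReal (2 ^ ((i : ℝ) * s))), two_rpow_mul]
    ring_nf
  set W : ℤ → TDist d := fun i => mulBdd (lowCut χ (i - 1) f) (block χ i g) with hWdef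
  -- low frequencies
  obtain ⟨B, hB, hzB⟩ := hz.exists_bound hχ 0
  -- The factor `Ṡ_{i-1}f` is bounded by a multiple of `2^i`, and the blocks of `g` are bounded
  -- uniformly for `i ≤ 0` because `g` lies in `𝓢'_h`.
  have hWlow : ∑' n : ℕ, distLpNorm ∞ (W (-(n + 1 : ℤ))) ≠ ∞ := by
    have h1 : ∀ n : ℕ, distLpNorm ∞ (W (-(n + 1 : ℤ))) ≤
        ENNReal.ofReal (2 ^ ((-(n + 1 : ℤ) : ℤ) : ℝ)) * (kC (fat χ) * NF * B) := fun n => by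
      refine (distLpNorm_mulBdd_le ⟨_, hS _⟩ ⟨_, hz.repf _⟩).trans ?_
      rw [distLpNorm_eq le_top (hS _), distLpNorm_eq le_top (hz.repf _)]
      refine (mul_le_mul' (hSle _) (hzB _ (by omega))).trans (le_of_eq ?_)
      ring
    refine ((ENNReal.tsum_le_tsum h1).trans_lt ?_).ne
    rw [ENNReal.tsum_mul_right]
    exact ENNReal.mul_lt_top tsum_two_neg_ne_top.lt_top
      (ENNReal.mul_lt_top (ENNReal.mul_lt_top hχ.isTest_fat.kC_lt_top hF) hB)
  -- high frequencies
  have hKf : C * NF * NG < ∞ := ENNReal.mul_lt_top (ENNReal.mul_lt_top hC hF) hG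
  have hWhigh : Summable fun n : ℕ => W n := by
    -- The term `i` has no frequencies seen by the cutoff at level `i - 5`, and its `L²` norm is
    -- `O(2^(-si))`.
    have h1 := hχ.summable_tdist 5 (b := fun n => fm (esym fun _ => a) (b n))
      (C := (C * NF * NG).toReal) (s := -s) (fun j => by
        rw [fm_comm (hχ.isTest.memLp_symb _) (memLp_esym _), hlow _ _ le_rfl, map_zero])
      (fun j => by
        refine (norm_fm_le (memLp_esym _) (norm_esym_le _) _).trans ?_
        have h2 := ENNReal.toReal_mono hKf.ne ((hbs j).trans (mul_le_mul_right (hz.term_le hp1 _ j) _))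
        rw [ENNReal.toReal_mul, ENNReal.toReal_ofReal (by positivity), toReal_enorm] at h2
        calc 1 * ‖b j‖ = 2 ^ (((j : ℤ) : ℝ) * s) * ‖b j‖ * 2 ^ (-s * j) := by
              rw [mul_right_comm, ← Real.rpow_add two_pos]
              simp [mul_comm s]
          _ ≤ _ := by gcongr)
    exact h1.congr fun n => (hW n).symm
  obtain ⟨h, hh⟩ := summable_of_low hWlow hWhigh
  have hlowW : ∀ i j, j ≤ i - 5 → lowCut χ j (W i) = 0 := fun i j hj => by
    simp only [hWdef]
    rw [hW i, lowCut, hχ.isTest.dyadic_tdist, fm_comm (hχ.isTest.memLp_symb _) (memLp_esym _),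
      hlow i j hj, map_zero, tdist_congr (Lp.coeFn_zero _ _ _), tdist_zero]
  -- The majorant for the indices `n ≥ 0` is `0`: all these terms are killed by `Ṡ_J` as soon as `J
  -- ≤ -5`.
  have hsh : IsSh χ h := hχ.isSh_of_low hh hWlow (y := 0) (by simp)
    (eventually_atBot.2 ⟨-5, fun J hJ n => by
      rw [hlowW n J (by omega), distLpNorm_zero]; exact zero_le⟩)
    fun i => isSh_of_eventually_eq_zero (eventually_atBot.2 ⟨i - 5, fun J hJ => hlowW i J hJ⟩)
  have h1 : ∀ i : ℤ, ∑' j : ℤ, ENNReal.ofReal (2 ^ ((j : ℝ) * s)) * ‖fm (symb (annulus χ) j) (b i)‖ₑ ≤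
      K * (ENNReal.ofReal (2 ^ ((i : ℝ) * s)) * ‖b i‖ₑ) := fun i => by
    rw [tsum_eq_sum (s := Finset.Icc (i - 5) (i + 5)) fun j hj => by rw [hann i j hj]; simp]
    refine (Finset.sum_le_card_nsmul _ _
      (ENNReal.ofReal (2 ^ (5 * |s|)) * kC (annulus χ) *
        (ENNReal.ofReal (2 ^ ((i : ℝ) * s)) * ‖b i‖ₑ)) fun j hj => ?_).trans (le_of_eq ?_)
    · have h2 : ENNReal.ofReal (2 ^ ((j : ℝ) * s)) ≤
          ENNReal.ofReal (2 ^ (5 * |s|)) * ENNReal.ofReal (2 ^ ((i : ℝ) * s)) := by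
        rw [two_rpow_mul]
        refine two_rpow_mono ?_
        rw [Finset.mem_Icc] at hj
        have h3 : |((j : ℝ) - i)| ≤ 5 := by
          rw [abs_le]
          constructor
          · have : ((i : ℝ) - 5) ≤ j := by exact_mod_cast hj.1
            linarith
          · have : (j : ℝ) ≤ i + 5 := by exact_mod_cast hj.2
            linarith
        have h4 := (le_abs_self (((j : ℝ) - i) * s)).trans (abs_mul _ _).le
        have h5 := mul_le_mul_of_nonneg_right h3 (abs_nonneg s)
        linarith
      calc _ ≤ ENNReal.ofReal (2 ^ (5 * |s|)) * ENNReal.ofReal (2 ^ ((i : ℝ) * s)) *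
            (kC (annulus χ) * ‖b i‖ₑ) := mul_le_mul' h2 (hχ.isTest_annulus.enorm_fm_symb_le j _)
        _ = _ := by ring
    · rw [Int.card_Icc, show (i + 5 + 1 - (i - 5)).toNat = 11 by omega, hK, nsmul_eq_mul]
      push_cast
      ring
  have hsum : ∑' (i : ℤ) (j : ℤ), ENNReal.ofReal (2 ^ ((j : ℝ) * s)) *
      ‖fm (symb (annulus χ) j) (b i)‖ₑ ≤ K * C * (NF * NG) := by
    refine (ENNReal.tsum_le_tsum fun i => (h1 i).trans (mul_le_mul_right (hbs i) _)).trans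
      (le_of_eq ?_)
    rw [ENNReal.tsum_mul_left, ENNReal.tsum_mul_left, ← hz.besovNorm_eq hp1]
    ring
  obtain ⟨H, hH, hHle⟩ := hχ.exists_isExp_of_hasSum hsh hh
    (c := fun i j => fm (symb (annulus χ) j) (b i)) (s := s) (M := K * C * (NF * NG)) (a := a)
    (fun i j => by
      simp only [hWdef]
      rw [hW i, block, hχ.isTest_annulus.dyadic_tdist,
        fm_comm (hχ.isTest_annulus.memLp_symb _) (memLp_esym _)])
    (ENNReal.mul_lt_top (ENNReal.mul_lt_top hKt hC) (ENNReal.mul_lt_top hF hG)) hsum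
  exact ⟨h, H, hh, hH, hHle⟩

/-! ### The remainder -/

theorem sum_Icc_near {M : Type*} [AddCommMonoid M] (x : ℤ → M) (k : ℤ) :
    ∑ i ∈ Finset.Icc (k - 1) (k + 1), x i = x (k - 1) + (x k + x (k + 1)) := by
  have hI : Finset.Icc (k - 1) (k + 1) = {k - 1, k, k + 1} := by
    ext x; simp only [Finset.mem_Icc, Finset.mem_insert, Finset.mem_singleton]; omega
  rw [hI, Finset.sum_insert (by simp; omega), Finset.sum_insert (by simp), Finset.sum_singleton]

theorem sum_near_le (s : ℝ) (x : ℤ → ℝ≥0∞) (k : ℤ) :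
    ENNReal.ofReal (2 ^ ((k : ℝ) * s)) * ∑ i ∈ Finset.Icc (k - 1) (k + 1), x i ≤
      ENNReal.ofReal (2 ^ |s|) * ∑' i : ℤ, ENNReal.ofReal (2 ^ ((i : ℝ) * s)) * x i := by
  calc _ = ∑ i ∈ Finset.Icc (k - 1) (k + 1), ENNReal.ofReal (2 ^ ((k : ℝ) * s)) * x i :=
        Finset.mul_sum _ _ _
    _ ≤ ∑ i ∈ Finset.Icc (k - 1) (k + 1),
        ENNReal.ofReal (2 ^ |s|) * (ENNReal.ofReal (2 ^ ((i : ℝ) * s)) * x i) := by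
        refine Finset.sum_le_sum fun i hi => ?_
        rw [← mul_assoc, two_rpow_mul]
        gcongr
        · exact one_le_two
        · rw [Finset.mem_Icc] at hi
          have h3 : |((k : ℝ) - i)| ≤ 1 := by
            rw [abs_le]
            constructor
            · have : (i : ℝ) ≤ k + 1 := by exact_mod_cast hi.2
              linarith
            · have : (k : ℝ) - 1 ≤ i := by exact_mod_cast hi.1
              linarith
          have h4 := (le_abs_self (((k : ℝ) - i) * s)).trans (abs_mul _ _).le
          have h5 := mul_le_mul_of_nonneg_right h3 (abs_nonneg s)
          linarith
    _ ≤ _ := by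
        rw [← Finset.mul_sum]
        gcongr
        exact ENNReal.sum_le_tsum _

/-- The sum of `2^{jτ}` over `j ≤ 3`. -/
def geom (τ : ℝ) : ℝ≥0∞ := ∑' j : ℤ, if j ≤ 3 then ENNReal.ofReal (2 ^ ((j : ℝ) * τ)) else 0

theorem tsum_ite_le (τ : ℝ) (k : ℤ) :
    (∑' j : ℤ, if j ≤ k + 3 then ENNReal.ofReal (2 ^ ((j : ℝ) * τ)) else 0) =
      ENNReal.ofReal (2 ^ ((k : ℝ) * τ)) * geom τ := by
  rw [geom, ← ENNReal.tsum_mul_left, ← (Equiv.addRight k).tsum_eq]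
  refine tsum_congr fun j => ?_
  simp only [Equiv.coe_addRight, mul_ite, mul_zero, two_rpow_mul]
  refine if_congr (by omega) ?_ rfl
  push_cast
  ring_nf

theorem geom_lt_top {τ : ℝ} (hτ : 0 < τ) : geom τ < ∞ := by
  have hinj : Function.Injective fun n : ℕ => (3 : ℤ) - n := fun m n h => by simpa using h
  rw [geom, ← hinj.tsum_eq (by
    intro j hj
    by_cases h : j ≤ 3
    · exact ⟨(3 - j).toNat, by simp only; omega⟩
    · simp [h] at hj)]
  have e : ∀ n : ℕ, (if (3 : ℤ) - n ≤ 3 then ENNReal.ofReal (2 ^ ((((3 : ℤ) - n : ℤ) : ℝ) * τ)) else 0)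
      = ENNReal.ofReal (2 ^ (3 * τ) * (2 ^ (-τ)) ^ n) := fun n => by
    rw [if_pos (by omega), ← Real.rpow_mul_natCast zero_le_two, ← Real.rpow_add two_pos]
    push_cast
    ring_nf
  simp_rw [e]
  exact (Summable.tsum_ofReal_ne_top ((summable_geometric_of_lt_one (by positivity)
    (Real.rpow_lt_one_of_one_lt_of_neg one_lt_two (by linarith))).mul_left _)).lt_top

/-- The terms of the remainder. -/
def remTerm (χ : Sp d → ℝ) (f g : TDist d) (k : ℤ) : TDist d :=
  ∑ i ∈ Finset.Icc (k - 1) (k + 1), mulBdd (block χ k f) (block χ i g)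

theorem Blocks.rep_remTerm {χ : Sp d → ℝ} {a : NNReal} {p : ℝ} {f F g G : TDist d}
    {w z : ℤ → Sp d → ℂ} (hw : Blocks χ a p f F w) (hz : Blocks χ a p g G z) (k : ℤ) :
    Rep ∞ (∑ i ∈ Finset.Icc (k - 1) (k + 1), ps a (w k) * ps a (z i)) (remTerm χ f g k) := by
  have hm : ∀ i ∈ Finset.Icc (k - 1) (k + 1), MemLp (ps a (w k) * ps a (z i)) ∞ volume :=
    fun i _ => memLp_mul_top (hw.repf k).1 (hz.repf i).1
  have e : remTerm χ f g k = tdist (∑ i ∈ Finset.Icc (k - 1) (k + 1), ps a (w k) * ps a (z i)) := by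
    rw [tdist_sum _ le_top hm]
    exact Finset.sum_congr rfl fun i _ => mulBdd_eq (hw.repf k) (hz.repf i)
  rw [e]
  exact rep_tdist le_top (memLp_finsetSum' _ hm)

theorem Blocks.rep_half_remTerm {χ : Sp d → ℝ} {a : NNReal} {p : ℝ} (hp : 2 ≤ p) {f F g G : TDist d}
    {w z : ℤ → Sp d → ℂ} (hw : Blocks χ a p f F w) (hz : Blocks χ a p g G z) (k : ℤ) :
    Rep (ENNReal.ofReal p / 2) (∑ i ∈ Finset.Icc (k - 1) (k + 1), ps a (w k) * ps a (z i))
      (remTerm χ f g k) :=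
  ⟨memLp_finsetSum' _ fun i _ => memLp_mul_half (hw.memLp_ps (by linarith) k)
    (hz.memLp_ps (by linarith) i), (hw.rep_remTerm hz k).2⟩

theorem Blocks.eLpNorm_half_le {χ : Sp d → ℝ} {a : NNReal} {p : ℝ} (hp : 2 ≤ p) {f F g G : TDist d}
    {w z : ℤ → Sp d → ℂ} (hw : Blocks χ a p f F w) (hz : Blocks χ a p g G z) (k : ℤ) :
    eLpNorm (∑ i ∈ Finset.Icc (k - 1) (k + 1), ps a (w k) * ps a (z i)) (ENNReal.ofReal p / 2)
      volume ≤ eLpNorm (w k) (ENNReal.ofReal p) volume *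
        ∑ i ∈ Finset.Icc (k - 1) (k + 1), eLpNorm (z i) (ENNReal.ofReal p) volume := by
  have hp2 : 2 ≤ ENNReal.ofReal p := by simpa using hp
  have hp1 : 1 ≤ ENNReal.ofReal p := le_trans (by norm_num) hp2
  have hm : ∀ i, MemLp (ps a (w k) * ps a (z i)) (ENNReal.ofReal p / 2) volume := fun i =>
    memLp_mul_half (hw.memLp_ps (by linarith) k) (hz.memLp_ps (by linarith) i)
  refine (eLpNorm_sum_le (fun i _ => (hm i).1) (one_le_half hp2)).trans ?_
  rw [Finset.mul_sum]
  refine Finset.sum_le_sum fun i _ => (eLpNorm_mul_half_le (hw.memLp_ps (by linarith) k)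
    (hz.memLp_ps (by linarith) i)).trans ?_
  exact mul_le_mul' (eLpNorm_ps_le a hp1 (hw.memLp k).1) (eLpNorm_ps_le a hp1 (hz.memLp i).1)

/-- The `k`-th term has its frequencies in a ball of size `2^k`, not in an annulus, so all the
output blocks `j ≤ k + 3` may be present, each with the Bernstein loss at its own frequency. -/
theorem Blocks.exists_rem_term {χ : Sp d → ℝ} (hχ : IsCutoff χ) {a : NNReal} {p : ℝ} (hp : 2 ≤ p)
    {f F g G : TDist d} {w z : ℤ → Sp d → ℂ}
    (hw : Blocks χ a p f F w) (hz : Blocks χ a p g G z)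
    {C : ℝ≥0∞} (hmul : ∀ (j k : ℤ) (w₁ w₂ : Sp d → ℂ),
      MemLp w₁ (ENNReal.ofReal p) volume → MemLp w₂ (ENNReal.ofReal p) volume →
      dop (fat χ) k w₁ =ᵐ[volume] w₁ →
      ∃ b : L2 d, tdist (fm (esym fun _ => a) b) = block χ j (tdist (ps a w₁ * ps a w₂)) ∧
        ‖b‖ₑ ≤ C * ENNReal.ofReal (2 ^ ((j : ℝ) * (d * (2 / p - 1 / 2)))) *
          (eLpNorm w₁ (ENNReal.ofReal p) volume * eLpNorm w₂ (ENNReal.ofReal p) volume)) (k j : ℤ) :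
    ∃ c : L2 d, tdist (fm (esym fun _ => a) c) = block χ j (remTerm χ f g k) ∧
      ‖c‖ₑ ≤ if j ≤ k + 3 then C * ENNReal.ofReal (2 ^ ((j : ℝ) * (d * (2 / p - 1 / 2)))) *
        (eLpNorm (w k) (ENNReal.ofReal p) volume *
          ∑ i ∈ Finset.Icc (k - 1) (k + 1), eLpNorm (z i) (ENNReal.ofReal p) volume) else 0 := by
  have e : ∀ i, mulBdd (block χ k f) (block χ i g) = tdist (ps a (w k) * ps a (z i)) := fun i =>
    mulBdd_eq (hw.repf k) (hz.repf i)
  have hs : block χ j (remTerm χ f g k) = ∑ i ∈ Finset.Icc (k - 1) (k + 1),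
      block χ j (tdist (ps a (w k) * ps a (z i))) := by
    simp only [remTerm, block, dyadic_eq] at e ⊢
    rw [map_sum]
    simp only [e]
  by_cases hj : j ≤ k + 3
  · choose c hc hcle using fun i => hmul j k (w k) (z i) (hw.memLp k) (hz.memLp i) (hw.dop_fat hχ k)
    refine ⟨∑ i ∈ Finset.Icc (k - 1) (k + 1), c i, ?_, ?_⟩
    · rw [map_sum, tdist_finset_sum, hs]
      exact Finset.sum_congr rfl fun i _ => hc i
    · rw [if_pos hj, Finset.mul_sum, Finset.mul_sum]
      exact (enorm_sum_le _ _).trans (Finset.sum_le_sum fun i _ => hcle i)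
  · refine ⟨0, ?_, by simp⟩
    rw [hs, map_zero, tdist_congr (Lp.coeFn_zero _ _ _), tdist_zero]
    refine (Finset.sum_eq_zero fun i hi => ?_).symm
    rw [Finset.mem_Icc] at hi
    exact hw.md_mul_eq_zero hχ hp hz hχ.isTest_annulus
      fun ξ η => hχ.rem_annulus (by omega) (by omega) ξ η

/-- The remainder estimate. -/
theorem IsCutoff.exists_remainder_le {χ : Sp d → ℝ} (hχ : IsCutoff χ) {p : ℝ} (hp : 2 ≤ p)
    (hp4 : p ≤ 4) {s₁ s₂ : ℝ} (hs : (d : ℝ) * (1 / 2 - 2 / p) < s₁ + s₂) :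
    ∃ C : ℝ≥0∞, C < ∞ ∧ ∀ (a : NNReal) (f g F G : TDist d), IsExp χ a f F → IsExp χ a g G →
      besovNorm χ (s₁ + d * (2 / p - 1 / 2)) p F < ∞ → besovNorm χ s₂ p G < ∞ →
      ∀ h, IsSh χ h → IsRemainder χ f g h →
      ∃ H : TDist d, IsExp χ a h H ∧ besovNorm χ (s₁ + s₂) 2 H ≤
        C * (besovNorm χ (s₁ + d * (2 / p - 1 / 2)) p F * besovNorm χ s₂ p G) := by
  obtain ⟨C, hC, hmul⟩ := hχ.exists_block_mul_L2 hp hp4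
  have hp1 : 1 ≤ p := by linarith
  set e : ℝ := d * (2 / p - 1 / 2) with he
  -- The hypothesis on `s₁ + s₂` says exactly that `τ > 0`, so that the sum of `2^(jτ)` over `j ≤ k
  -- + 3` is a multiple of `2^(kτ)`.
  set τ : ℝ := s₁ + e + s₂ with hτ
  have hτ0 : 0 < τ := by rw [hτ, he]; linarith
  refine ⟨C * (geom τ * ENNReal.ofReal (2 ^ |s₂|)), ENNReal.mul_lt_top hC
    (ENNReal.mul_lt_top (geom_lt_top hτ0) ENNReal.ofReal_lt_top),
    fun a f g F G hfF hgG hF hG h hh hR => ?_⟩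
  obtain ⟨w, hw⟩ := hfF.exists_blocks hp1 hF
  obtain ⟨z, hz⟩ := hgG.exists_blocks hp1 hG
  choose c hc hcle using hw.exists_rem_term hχ hp hz (fun j k w₁ w₂ => hmul a j k w₁ w₂)
  refine hχ.exists_isExp_of_hasSum (W := remTerm χ f g) hh hR hc (ENNReal.mul_lt_top
    (ENNReal.mul_lt_top hC (ENNReal.mul_lt_top (geom_lt_top hτ0) ENNReal.ofReal_lt_top))
    (ENNReal.mul_lt_top hF hG)) ?_
  calc ∑' (k : ℤ) (j : ℤ), ENNReal.ofReal (2 ^ ((j : ℝ) * (s₁ + s₂))) * ‖c k j‖ₑ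
      ≤ ∑' (k : ℤ) (j : ℤ), (if j ≤ k + 3 then ENNReal.ofReal (2 ^ ((j : ℝ) * τ)) else 0) *
          (C * (eLpNorm (w k) (ENNReal.ofReal p) volume *
            ∑ i ∈ Finset.Icc (k - 1) (k + 1), eLpNorm (z i) (ENNReal.ofReal p) volume)) := by
        refine ENNReal.tsum_le_tsum fun k => ENNReal.tsum_le_tsum fun j =>
          (mul_le_mul_right (hcle k j) _).trans ?_
        split_ifs
        · rw [show (j : ℝ) * τ = j * (s₁ + s₂) + j * e by rw [hτ]; ring, ← two_rpow_mul]
          exact le_of_eq (by ring)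
        · simp
    _ = ∑' k : ℤ, C * geom τ * (ENNReal.ofReal (2 ^ ((k : ℝ) * (s₁ + e))) *
          eLpNorm (w k) (ENNReal.ofReal p) volume) * (ENNReal.ofReal (2 ^ ((k : ℝ) * s₂)) *
            ∑ i ∈ Finset.Icc (k - 1) (k + 1), eLpNorm (z i) (ENNReal.ofReal p) volume) := by
        refine tsum_congr fun k => ?_
        rw [ENNReal.tsum_mul_right, tsum_ite_le, hτ,
          show (k : ℝ) * (s₁ + e + s₂) = k * (s₁ + e) + k * s₂ by ring, ← two_rpow_mul]
        ring
    _ ≤ ∑' k : ℤ, C * geom τ * (ENNReal.ofReal (2 ^ ((k : ℝ) * (s₁ + e))) *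
          eLpNorm (w k) (ENNReal.ofReal p) volume) * (ENNReal.ofReal (2 ^ |s₂|) *
            besovNorm χ s₂ p G) := by
        refine ENNReal.tsum_le_tsum fun k => mul_le_mul_right ?_ _
        rw [hz.besovNorm_eq hp1]
        exact sum_near_le s₂ _ k
    _ = _ := by
        rw [ENNReal.tsum_mul_right, ENNReal.tsum_mul_left, ← hw.besovNorm_eq hp1]
        ring

/-! ### Convergence of the remainder -/

theorem IsTest.distLpNorm_top_dyadic_le {m : Sp d → ℝ} (hm : IsTest m) (j : ℤ) {q : ℝ≥0∞}
    (hq : 1 ≤ q) {w : Sp d → ℂ} {u : TDist d} (h : Rep q w u) :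
    distLpNorm ∞ (dyadic m j u) ≤
      kC m * ENNReal.ofReal (2 ^ ((j : ℝ) * (d * (1 / q.toReal)))) * eLpNorm w q volume := by
  refine (distLpNorm_le ⟨hm.memLp_dop_of_le j hq le_top h.1, (hm.rep_dyadic j hq h).2⟩).trans ?_
  have := hm.bernstein j h.1.1 hq (r := ∞) le_top
  rwa [scl_rpow, ENNReal.toReal_top, div_zero, sub_zero] at this

theorem tendsto_two_rpow_atBot {s : ℝ} (hs : 0 < s) :
    Tendsto (fun j : ℤ => ENNReal.ofReal (2 ^ ((j : ℝ) * s))) atBot (𝓝 0) := by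
  have h1 : Tendsto (fun j : ℤ => (2 : ℝ) ^ ((j : ℝ) * s)) atBot (𝓝 0) :=
    (tendsto_rpow_atBot_of_base_gt_one 2 one_lt_two).comp
      (((tendsto_intCast_atBot_iff (R := ℝ)).2 tendsto_id).atBot_mul_const hs)
  simpa using ENNReal.tendsto_ofReal h1

/-- An `L^q` function belongs to `𝓢'_h`, for `q` finite. -/
theorem IsCutoff.isSh_of_rep {χ : Sp d → ℝ} (hχ : IsCutoff χ) (hd : 0 < d) {q : ℝ≥0∞} (hq : 1 ≤ q)
    (hqt : q ≠ ∞) {w : Sp d → ℂ} {u : TDist d} (h : Rep q w u) : IsSh χ u := by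
  have h0 : 0 < (d : ℝ) * (1 / q.toReal) := by
    have : 0 < q.toReal := ENNReal.toReal_pos (one_pos.trans_le hq).ne' hqt
    positivity
  have h1 := ENNReal.Tendsto.mul_const (ENNReal.Tendsto.const_mul (a := kC χ)
    (tendsto_two_rpow_atBot h0) (Or.inr hχ.isTest.kC_lt_top.ne)) (b := eLpNorm w q volume)
    (Or.inr h.1.2.ne)
  rw [mul_zero, zero_mul] at h1
  exact tendsto_of_tendsto_of_tendsto_of_le_of_le tendsto_const_nhds h1 (fun _ => zero_le)
    fun j => hχ.isTest.distLpNorm_top_dyadic_le j hq h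

theorem tsum_neg_le (x : ℤ → ℝ≥0∞) : ∑' n : ℕ, x (-(n + 1 : ℤ)) ≤ ∑' i, x i :=
  ENNReal.tsum_comp_le_tsum_of_injective (fun m n h => by simpa using h) x

/-- The remainder is absolutely convergent in `L^∞` for low frequencies. -/
theorem Blocks.tsum_remTerm_low {χ : Sp d → ℝ} (hχ : IsCutoff χ) {a : NNReal} {p : ℝ} (hp : 1 ≤ p)
    {f F g G : TDist d} {w z : ℤ → Sp d → ℂ} (hw : Blocks χ a p f F w) (hz : Blocks χ a p g G z)
    {σ s : ℝ} (hF : besovNorm χ σ p F < ∞) (hG : besovNorm χ s p G < ∞)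
    (h : σ ≤ d / p ∨ s ≤ d / p) :
    ∑' n : ℕ, distLpNorm ∞ (remTerm χ f g (-(n + 1 : ℤ))) ≠ ∞ := by
  set x : ℤ → ℝ≥0∞ := fun i => eLpNorm (ps a (w i)) ∞ volume with hx
  set y : ℤ → ℝ≥0∞ := fun i => eLpNorm (ps a (z i)) ∞ volume with hy
  have h1 : ∀ k, distLpNorm ∞ (remTerm χ f g k) ≤ x k * (y (k - 1) + (y k + y (k + 1))) := fun k => by
    refine (distLpNorm_le (hw.rep_remTerm hz k)).trans ((eLpNorm_sum_le
      (fun i _ => (memLp_mul_top (hw.repf k).1 (hz.repf i).1).1) le_top).trans ?_)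
    rw [← sum_Icc_near, Finset.mul_sum]
    exact Finset.sum_le_sum fun i _ => eLpNorm_mul_top_le (hw.repf k).1 (hz.repf i).1
  -- For `i ≤ 0` and `σ ≤ d/p` the Bernstein factor `2^(id/p)` is at most `2^(iσ)`, so the low
  -- blocks of that function are summable in `L^∞`. For the other function, uniform boundedness of
  -- the low blocks suffices, which membership in `𝓢'_h` provides.
  have key : ∀ {f F : TDist d} {w : ℤ → Sp d → ℂ} (_ : Blocks χ a p f F w) {σ : ℝ}
      (_ : besovNorm χ σ p F < ∞) (_ : σ ≤ d / p),
      ∑' i : ℤ, (if i ≤ 0 then eLpNorm (ps a (w i)) ∞ volume else 0) < ∞ :=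
    fun {f F w} hw {σ} hF hσ => by
      refine (ENNReal.tsum_le_tsum (g := fun i : ℤ => kC (fat χ) *
        (ENNReal.ofReal (2 ^ ((i : ℝ) * σ)) * eLpNorm (w i) (ENNReal.ofReal p) volume))
        fun i => ?_).trans_lt ?_
      · split_ifs with hi
        · refine (hw.eLpNorm_top_le hχ hp i).trans ?_
          rw [mul_assoc]
          have hi' : (i : ℝ) ≤ 0 := by exact_mod_cast hi
          gcongr kC (fat χ) * (ENNReal.ofReal (?_) * _)
          exact Real.rpow_le_rpow_of_exponent_le one_le_two (mul_le_mul_of_nonpos_left hσ hi')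
        · exact zero_le
      · rw [ENNReal.tsum_mul_left, ← hw.besovNorm_eq hp]
        exact ENNReal.mul_lt_top hχ.isTest_fat.kC_lt_top hF
  obtain ⟨A, hA, hxA⟩ := hw.exists_bound hχ 0
  obtain ⟨B, hB, hyB⟩ := hz.exists_bound hχ 0
  rcases h with h | h
  · refine ((ENNReal.tsum_le_tsum (g := fun n : ℕ => (if (-(n + 1 : ℤ)) ≤ 0 then x (-(n + 1 : ℤ))
      else 0) * (B + (B + B))) fun n => (h1 _).trans ?_).trans_lt ?_).ne
    · rw [if_pos (by omega)]
      exact mul_le_mul_right (add_le_add (hyB _ (by omega)) (add_le_add (hyB _ (by omega))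
        (hyB _ (by omega)))) _
    · rw [ENNReal.tsum_mul_right]
      exact ENNReal.mul_lt_top ((tsum_neg_le fun i => if i ≤ 0 then x i else 0).trans_lt
        (key hw hF h)) (by finiteness)
  · set Y : ℤ → ℝ≥0∞ := fun i => if i ≤ 0 then y i else 0 with hY
    have hYt : ∑' i, Y i < ∞ := key hz hG h
    have hsh : ∀ m : ℤ, ∑' i, Y (i + m) = ∑' i, Y i := fun m => (Equiv.addRight m).tsum_eq Y
    refine ((ENNReal.tsum_le_tsum (g := fun n : ℕ => A * (Y (-(n + 1 : ℤ) + -1) +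
      (Y (-(n + 1 : ℤ) + 0) + Y (-(n + 1 : ℤ) + 1)))) fun n => (h1 _).trans ?_).trans_lt ?_).ne
    · simp only [hY]
      rw [if_pos (by omega), if_pos (by omega), if_pos (by omega), add_zero]
      exact mul_le_mul_left (hxA _ (by omega)) _
    · rw [ENNReal.tsum_mul_left]
      refine ENNReal.mul_lt_top hA ((tsum_neg_le fun i => Y (i + -1) + (Y (i + 0) + Y (i + 1))).trans_lt
        ?_)
      rw [ENNReal.tsum_add, ENNReal.tsum_add, hsh, hsh, hsh]
      finiteness

/-- The remainder is absolutely convergent in `L^{p/2}` for high frequencies. -/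
theorem Blocks.tsum_remTerm_high {χ : Sp d → ℝ} {a : NNReal} {p : ℝ} (hp : 2 ≤ p)
    {f F g G : TDist d} {w z : ℤ → Sp d → ℂ} (hw : Blocks χ a p f F w) (hz : Blocks χ a p g G z)
    {σ s : ℝ} (hσ : 0 ≤ σ + s) (hF : besovNorm χ σ p F < ∞) (hG : besovNorm χ s p G < ∞) :
    ∑' n : ℕ, eLpNorm (w n) (ENNReal.ofReal p) volume *
        ∑ i ∈ Finset.Icc ((n : ℤ) - 1) (n + 1), eLpNorm (z i) (ENNReal.ofReal p) volume ≠ ∞ := by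
  have hp1 : 1 ≤ p := by linarith
  refine ((ENNReal.tsum_le_tsum (g := fun n : ℕ => (ENNReal.ofReal (2 ^ (((n : ℤ) : ℝ) * σ)) *
    eLpNorm (w n) (ENNReal.ofReal p) volume) * (ENNReal.ofReal (2 ^ |s|) * besovNorm χ s p G))
    fun n => ?_).trans_lt ?_).ne
  · have h1 := sum_near_le s (fun i => eLpNorm (z i) (ENNReal.ofReal p) volume) n
    rw [← hz.besovNorm_eq hp1] at h1
    refine le_trans ?_ (mul_le_mul_right h1 _)
    rw [mul_mul_mul_comm, two_rpow_mul]
    -- The weights multiply to `2^(n(σ+s)) ≥ 1`.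
    refine le_mul_of_one_le_left zero_le ?_
    rw [← ENNReal.ofReal_one]
    refine ENNReal.ofReal_le_ofReal (Real.one_le_rpow one_le_two ?_)
    rw [← mul_add]
    exact mul_nonneg (by simp) hσ
  · rw [ENNReal.tsum_mul_right]
    refine ENNReal.mul_lt_top (lt_of_le_of_lt ?_ hF) (ENNReal.mul_lt_top ENNReal.ofReal_lt_top hG)
    rw [hw.besovNorm_eq hp1]
    exact ENNReal.tsum_comp_le_tsum_of_injective (f := fun n : ℕ => (n : ℤ)) Nat.cast_injective
      (fun j : ℤ => ENNReal.ofReal (2 ^ ((j : ℝ) * σ)) * eLpNorm (w j) (ENNReal.ofReal p) volume)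

/-- The series of the remainder converges. -/
theorem IsCutoff.exists_remainder {χ : Sp d → ℝ} (hχ : IsCutoff χ) (hd : 0 < d) {p : ℝ} (hp : 2 ≤ p)
    {a : NNReal} {f g F G : TDist d} (hfF : IsExp χ a f F) (hgG : IsExp χ a g G)
    {σ s : ℝ} (hσ : 0 ≤ σ + s) (hF : besovNorm χ σ p F < ∞) (hG : besovNorm χ s p G < ∞)
    (h : σ ≤ d / p ∨ s ≤ d / p) : ∃ h, IsSh χ h ∧ IsRemainder χ f g h := by
  have hp1 : 1 ≤ p := by linarith
  obtain ⟨w, hw⟩ := hfF.exists_blocks hp1 hF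
  obtain ⟨z, hz⟩ := hgG.exists_blocks hp1 hG
  have hlow := hw.tsum_remTerm_low hχ hp1 hz hF hG h
  have hhigh := hw.tsum_remTerm_high hp hz hσ hF hG
  have hq : 1 ≤ ENNReal.ofReal p / 2 := one_le_half (by simpa using hp)
  have hqt : ENNReal.ofReal p / 2 ≠ ∞ := ENNReal.div_ne_top (by simp) (by simp)
  obtain ⟨h, hh⟩ := summable_of_low hlow (summable_of_distLpNorm hq
    (ne_top_of_le_ne_top hhigh (ENNReal.tsum_le_tsum fun n =>
      (distLpNorm_le (hw.rep_half_remTerm hp hz n)).trans (hw.eLpNorm_half_le hp hz n))))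
  refine ⟨h, hχ.isSh_of_low hh hlow (y := fun n => kC χ * (eLpNorm (w n) (ENNReal.ofReal p) volume *
    ∑ i ∈ Finset.Icc ((n : ℤ) - 1) (n + 1), eLpNorm (z i) (ENNReal.ofReal p) volume)) ?_
    (eventually_atBot.2 ⟨0, fun J hJ n => ?_⟩)
    fun i => hχ.isSh_of_rep hd hq hqt (hw.rep_half_remTerm hp hz i), hh⟩
  · rw [ENNReal.tsum_mul_left]
    exact ENNReal.mul_ne_top hχ.isTest.kC_lt_top.ne hhigh
  -- Bernstein from `L^{p/2}` to `L^∞` at a level `J ≤ 0` has a factor at most `1`, so the majorant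
  -- does not depend on `J`.
  · refine (hχ.isTest.distLpNorm_top_dyadic_le J hq (hw.rep_half_remTerm hp hz n)).trans ?_
    refine mul_le_mul' (mul_le_of_le_one_right zero_le ?_) (hw.eLpNorm_half_le hp hz n)
    rw [← ENNReal.ofReal_one]
    refine ENNReal.ofReal_le_ofReal (Real.rpow_le_one_of_one_le_of_nonpos one_le_two ?_)
    exact mul_nonpos_of_nonpos_of_nonneg (by exact_mod_cast hJ) (by positivity)

/-! ### Products -/

theorem IsCutoff.lowCut_add_one {χ : Sp d → ℝ} (hχ : IsCutoff χ) (n : ℤ) (u : TDist d) :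
    lowCut χ (n + 1) u = lowCut χ n u + block χ n u := by
  rw [block, lowCut, lowCut, dyadic_eq, dyadic_eq, dyadic_eq, symb_annulus,
    md_sub (hχ.isTest.temperate _) (hχ.isTest.temperate _)]
  abel

/-- For `j` near `-∞` the function `Ṡ_j f` is bounded by definition of `𝓢'_h`, and each further
block adds a bounded function. -/
theorem IsCutoff.isBdd_lowCut {χ : Sp d → ℝ} (hχ : IsCutoff χ) {f : TDist d} (hf : IsSh χ f)
    (hb : ∀ j, IsBdd (block χ j f)) (n : ℤ) : IsBdd (lowCut χ n f) := by
  obtain ⟨M, hM⟩ := eventually_atBot.1 ((tendsto_order.1 hf).2 ∞ ENNReal.zero_lt_top)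
  have h0 : ∀ j ≤ M, IsBdd (lowCut χ j f) := fun j hj => exists_rep_of_distLpNorm_lt (hM j hj)
  rcases le_total n M with h | h
  · exact h0 n h
  · induction n, h using Int.leInduction with
    | base => exact h0 M le_rfl
    | succ n _ ih => rw [hχ.lowCut_add_one]; exact ih.add (hb n)

/-- The increment of `Ṡ_i f · Ṡ_i g` produces `Δ̇_{i-1}f Δ̇_i g` at step `i`, while the remainder
lists it at index `i - 1`. Adding this product to `Ṡ_i f · Ṡ_i g` corrects the shift and makes the
three series telescope together. -/
theorem IsCutoff.mulBdd_lowCut_add_one {χ : Sp d → ℝ} (hχ : IsCutoff χ) {f g : TDist d}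
    (hf : IsSh χ f) (hg : IsSh χ g) (hfb : ∀ j, IsBdd (block χ j f)) (hgb : ∀ j, IsBdd (block χ j g))
    (i : ℤ) : mulBdd (lowCut χ (i - 1) f) (block χ i g) + mulBdd (lowCut χ (i - 1) g) (block χ i f) +
      remTerm χ f g i =
      (mulBdd (lowCut χ (i + 1) f) (lowCut χ (i + 1) g) +
        mulBdd (block χ (i + 1 - 1) f) (block χ (i + 1) g)) -
      (mulBdd (lowCut χ i f) (lowCut χ i g) + mulBdd (block χ (i - 1) f) (block χ i g)) := by
  have hfl := hχ.isBdd_lowCut hf hfb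
  have hgl := hχ.isBdd_lowCut hg hgb
  have ef : lowCut χ i f = lowCut χ (i - 1) f + block χ (i - 1) f := by
    rw [← hχ.lowCut_add_one, sub_add_cancel]
  have eg : lowCut χ i g = lowCut χ (i - 1) g + block χ (i - 1) g := by
    rw [← hχ.lowCut_add_one, sub_add_cancel]
  rw [remTerm, sum_Icc_near, hχ.lowCut_add_one i f, hχ.lowCut_add_one i g, add_sub_cancel_right,
    mulBdd_add_left (hfl i) (hfb i) ((hgl i).add (hgb i)),
    mulBdd_add_right (hfl i) (hgl i) (hgb i), mulBdd_add_right (hfb i) (hgl i) (hgb i)]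
  have e1 : mulBdd (lowCut χ i f) (block χ i g) = mulBdd (lowCut χ (i - 1) f) (block χ i g) +
      mulBdd (block χ (i - 1) f) (block χ i g) := by
    rw [ef, mulBdd_add_left (hfl _) (hfb _) (hgb _)]
  have e2 : mulBdd (block χ i f) (lowCut χ i g) = mulBdd (lowCut χ (i - 1) g) (block χ i f) +
      mulBdd (block χ i f) (block χ (i - 1) g) := by
    rw [eg, mulBdd_add_right (hfb _) (hgl _) (hgb _), mulBdd_comm (hfb i) (hgl (i - 1))]
  rw [e1, e2]
  abel

theorem sum_Ico_sub_int {M : Type*} [AddCommGroup M] (X : ℤ → M) {m n : ℤ} (h : m ≤ n) :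
    ∑ i ∈ Finset.Ico m n, (X (i + 1) - X i) = X n - X m := by
  induction n, h using Int.leInduction with
  | base => simp
  | succ n hn ih =>
    have e : Finset.Ico m (n + 1) = insert n (Finset.Ico m n) := by
      ext x; simp only [Finset.mem_Ico, Finset.mem_insert]; omega
    rw [e, Finset.sum_insert (by simp), ih]
    abel

/-- Bony's decomposition of the product. -/
theorem Blocks.isProduct {χ : Sp d → ℝ} (hχ : IsCutoff χ) {a : NNReal} {p : ℝ} (hp : 2 ≤ p)
    {f F g G : TDist d} {w z : ℤ → Sp d → ℂ} (hw : Blocks χ a p f F w) (hz : Blocks χ a p g G z)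
    {σ s : ℝ} (hσ : 0 ≤ σ + s) (hF : besovNorm χ σ p F < ∞) (hG : besovNorm χ s p G < ∞)
    {h₁ h₂ h₃ : TDist d} (h1 : IsParaproduct χ f g h₁) (h2 : IsParaproduct χ g f h₂)
    (h3 : IsRemainder χ f g h₃) : IsProduct χ f g (h₁ + h₂ + h₃) := by
  have hfb : ∀ j, IsBdd (block χ j f) := fun j => ⟨_, hw.repf j⟩
  have hgb : ∀ j, IsBdd (block χ j g) := fun j => ⟨_, hz.repf j⟩
  have hfl := hχ.isBdd_lowCut hw.sh hfb
  have hgl := hχ.isBdd_lowCut hz.sh hgb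
  set P : ℤ → TDist d := fun i => mulBdd (lowCut χ i f) (lowCut χ i g) with hP
  set E : ℤ → TDist d := fun i => mulBdd (block χ (i - 1) f) (block χ i g) with hE
  have hlim : Tendsto (fun n : ℕ => (P n + E n) - (P (-n) + E (-n))) atTop (𝓝 (h₁ + h₂ + h₃)) := by
    refine ((HasSum.add (HasSum.add h1 h2) h3).comp
      (Finset.tendsto_Ico_neg_atTop_atTop.comp tendsto_natCast_atTop_atTop)).congr fun n => ?_
    rw [← sum_Ico_sub_int (fun i => P i + E i) (by omega : -(n : ℤ) ≤ n)]
    exact Finset.sum_congr rfl fun i _ => hχ.mulBdd_lowCut_add_one hw.sh hz.sh hfb hgb i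
  have hbot : Tendsto (fun n : ℕ => -(n : ℤ)) atTop atBot :=
    tendsto_neg_atTop_atBot.comp tendsto_natCast_atTop_atTop
  have hmul : ∀ {u v : ℤ → TDist d} (_ : ∀ i, IsBdd (u i)) (_ : ∀ i, IsBdd (v i))
      (_ : Tendsto (fun i => distLpNorm ∞ (u i)) atBot (𝓝 0))
      (_ : Tendsto (fun i => distLpNorm ∞ (v i)) atBot (𝓝 0)),
      Tendsto (fun i => mulBdd (u i) (v i)) atBot (𝓝 0) := fun {u v} hu hv hu0 hv0 => by
    refine tendsto_zero_of_distLpNorm le_top ?_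
    have h := ENNReal.Tendsto.mul hu0 (Or.inr ENNReal.zero_ne_top) hv0 (Or.inr ENNReal.zero_ne_top)
    rw [mul_zero] at h
    exact tendsto_of_tendsto_of_tendsto_of_le_of_le tendsto_const_nhds h (fun _ => zero_le)
      fun i => distLpNorm_mulBdd_le (hu i) (hv i)
  -- At `-∞` both parts of the boundary term vanish in `L^∞`, since `f` and `g` lie in `𝓢'_h`.
  have hPl : Tendsto (fun n : ℕ => P (-n)) atTop (𝓝 0) := (hmul hfl hgl hw.sh hz.sh).comp hbot
  have hEl : Tendsto (fun n : ℕ => E (-n)) atTop (𝓝 0) :=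
    (hmul (fun i => hfb (i - 1)) hgb ((hχ.tendsto_block hw.sh).comp
      (tendsto_atBot_add_const_right atBot (-1 : ℤ) tendsto_id)) (hχ.tendsto_block hz.sh)).comp hbot
  -- At `+∞` the correction vanishes in `L^{p/2}`, being dominated by the terms of a convergent
  -- series; only `Ṡ_n f · Ṡ_n g` survives.
  have hEh : Tendsto (fun n : ℕ => E n) atTop (𝓝 0) := by
    have hq2 : 2 ≤ ENNReal.ofReal p := by simpa using hp
    have hq1 : 1 ≤ ENNReal.ofReal p := le_trans (by norm_num) hq2
    rw [← tendsto_add_atTop_iff_nat 1]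
    refine tendsto_zero_of_distLpNorm (one_le_half hq2) ?_
    have h := ENNReal.tendsto_atTop_zero_of_tsum_ne_top (hw.tsum_remTerm_high hp hz hσ hF hG)
    refine tendsto_of_tendsto_of_tendsto_of_le_of_le tendsto_const_nhds h (fun _ => zero_le)
      fun n => ?_
    have hm := memLp_mul_half (hw.memLp_ps (by linarith) n) (hz.memLp_ps (by linarith) (n + 1))
    have e : E ((n + 1 : ℕ) : ℤ) = tdist (ps a (w n) * ps a (z (n + 1))) := by
      simp only [hE]
      push_cast
      rw [add_sub_cancel_right]
      exact mulBdd_eq (hw.repf n) (hz.repf (n + 1))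
    simp only [e]
    refine (distLpNorm_le (rep_tdist (one_le_half hq2) hm)).trans ((eLpNorm_mul_half_le
      (hw.memLp_ps (by linarith) n) (hz.memLp_ps (by linarith) (n + 1))).trans ?_)
    refine mul_le_mul' (eLpNorm_ps_le a hq1 (hw.memLp n).1)
      ((eLpNorm_ps_le a hq1 (hz.memLp _).1).trans ?_)
    exact Finset.single_le_sum (f := fun i => eLpNorm (z i) (ENNReal.ofReal p) volume)
      (fun _ _ => zero_le) (Finset.mem_Icc.2 ⟨by omega, le_rfl⟩)
  have h := (hlim.add (hPl.add hEl)).sub hEh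
  rw [add_zero, add_zero, sub_zero] at h
  exact h.congr fun n => by simp only [hP]; abel

/-! ### Sums, and low-frequency norms -/

theorem IsExp.add {χ : Sp d → ℝ} {a : NNReal} {f F g G : TDist d} (hf : IsExp χ a f F)
    (hg : IsExp χ a g G) : IsExp χ a (f + g) (F + G) := by
  refine ⟨hf.1.add hg.1, hf.2.1.add hg.2.1, fun j => ?_⟩
  obtain ⟨w, hw, hwF, hwf⟩ := hf.2.2 j
  obtain ⟨z, hz, hzG, hzg⟩ := hg.2.2 j
  have e : ∀ u v : TDist d, block χ j (u + v) = block χ j u + block χ j v := fun u v =>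
    map_add (md (symb (annulus χ) j)) u v
  refine ⟨w + z, hw.add hz, ?_, ?_⟩
  · rw [e, ← hwF.tdist_eq, ← hzG.tdist_eq, ← tdist_add le_top le_top hw hz]
    exact (rep_tdist le_top (hw.add hz)).2
  · have h1 := (isExpNeg_iff le_top hw _).1 hwf
    have h2 := (isExpNeg_iff le_top hz _).1 hzg
    have h3 := cv_add_ae (isKer_poisson fun _ : Fin d => a).meas (isKer_poisson fun _ => a).int
      le_top hw hz
    rw [isExpNeg_iff le_top (hw.add hz), e, ← h1.2.tdist_eq, ← h2.2.tdist_eq,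
      ← tdist_add le_top le_top h1.1 h2.1]
    exact (rep_tdist le_top (h1.1.add h2.1)).congr h3.symm

theorem besovNormLow_add_le {χ : Sp d → ℝ} {k₀ : ℤ} {s p : ℝ} (hp : 1 ≤ p) (u v : TDist d) :
    besovNormLow χ k₀ s p (u + v) ≤ besovNormLow χ k₀ s p u + besovNormLow χ k₀ s p v := by
  rw [besovNormLow, besovNormLow, besovNormLow, ← ENNReal.tsum_add]
  refine ENNReal.tsum_le_tsum fun j => ?_
  rw [← mul_add]
  have e : block χ j (u + v) = block χ j u + block χ j v := map_add (md (symb (annulus χ) j)) u v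
  rw [e]
  exact mul_le_mul_right (distLpNorm_add_le (by simpa using hp) _ _) _

theorem besovNormLow_le (χ : Sp d → ℝ) (k₀ : ℤ) (s p : ℝ) (u : TDist d) :
    besovNormLow χ k₀ s p u ≤ besovNorm χ s p u :=
  ENNReal.tsum_comp_le_tsum_of_injective Subtype.val_injective (fun j : ℤ =>
    ENNReal.ofReal (2 ^ ((j : ℝ) * s)) * distLpNorm (ENNReal.ofReal p) (block χ j u))

/-- For `j ≤ k₀` an additional derivative costs at most `2^(k₀)`. In the last product estimate this
recovers the derivative lost by a paraproduct. -/
theorem besovNormLow_add_one_le (χ : Sp d → ℝ) (k₀ : ℤ) (s p : ℝ) (u : TDist d) :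
    besovNormLow χ k₀ (s + 1) p u ≤ ENNReal.ofReal (2 ^ (k₀ : ℝ)) * besovNorm χ s p u := by
  refine le_trans ?_ (mul_le_mul_right (besovNormLow_le χ k₀ s p u) _)
  rw [besovNormLow, besovNormLow, ← ENNReal.tsum_mul_left]
  refine ENNReal.tsum_le_tsum fun j => ?_
  rw [← mul_assoc, two_rpow_mul]
  gcongr
  · exact one_le_two
  · have : ((j : ℤ) : ℝ) ≤ k₀ := by exact_mod_cast j.2
    linarith

/-- The low frequencies of the product. -/
theorem IsCutoff.exists_product {χ : Sp d → ℝ} (hχ : IsCutoff χ) (hd : 0 < d) {p : ℝ} (hp : 2 ≤ p)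
    (hp4 : p ≤ 4) (hpd : p * ((d : ℝ) - 2) ≤ 2 * d) (r : ℝ) {σ s ρ : ℝ}
    (hρ : ρ = σ + s - d * (2 / p - 1 / 2)) (hσs : 0 < σ + s) (hσ : σ ≤ d / p ∨ s ≤ d / p) (r' : ℝ) :
    ∃ C : ℝ≥0∞, C < ∞ ∧ ∀ (a : NNReal) (f g F G : TDist d), IsExp χ a f F → IsExp χ a g G →
      besovNorm χ (d / p - 1) p F < ∞ → besovNorm χ (d / p - 1) p G < ∞ →
      besovNorm χ (r + 1 - d / 2 + d / p) p G < ∞ → besovNorm χ (r' + 1 - d / 2 + d / p) p F < ∞ →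
      besovNorm χ σ p F < ∞ → besovNorm χ s p G < ∞ →
      ∃ h H H₁ H₂ H₃ : TDist d, IsProduct χ f g h ∧ IsExp χ a h H ∧
        (∀ k₀ t, besovNormLow χ k₀ t 2 H ≤ besovNormLow χ k₀ t 2 H₁ + besovNormLow χ k₀ t 2 H₂ +
          besovNormLow χ k₀ t 2 H₃) ∧
        besovNorm χ r 2 H₁ ≤
          C * (besovNorm χ (d / p - 1) p F * besovNorm χ (r + 1 - d / 2 + d / p) p G) ∧
        besovNorm χ r' 2 H₂ ≤
          C * (besovNorm χ (r' + 1 - d / 2 + d / p) p F * besovNorm χ (d / p - 1) p G) ∧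
        besovNorm χ ρ 2 H₃ ≤ C * (besovNorm χ σ p F * besovNorm χ s p G) := by
  have hp1 : 1 ≤ p := by linarith
  obtain ⟨C₁, hC₁, h₁⟩ := hχ.exists_paraproduct hp hp4 hpd r
  obtain ⟨C₂, hC₂, h₂⟩ := hχ.exists_paraproduct hp hp4 hpd r'
  -- The remainder estimate measures `F` with regularity `s₁ + d(2/p - 1/2)`; the shift makes this
  -- equal to `σ`.
  have e1 : σ - d * (2 / p - 1 / 2) + d * (2 / p - 1 / 2) = σ := by ring
  have e2 : σ - d * (2 / p - 1 / 2) + s = ρ := by rw [hρ]; ring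
  obtain ⟨C₃, hC₃, h₃⟩ := hχ.exists_remainder_le hp hp4 (s₁ := σ - d * (2 / p - 1 / 2)) (s₂ := s)
    (by linarith)
  rw [e1, e2] at h₃
  refine ⟨C₁ + C₂ + C₃, by finiteness, fun a f g F G hfF hgG hF hG hG' hF' hFσ hGs => ?_⟩
  obtain ⟨w, hw⟩ := hfF.exists_blocks hp1 hF
  obtain ⟨z, hz⟩ := hgG.exists_blocks hp1 hG
  obtain ⟨k₁, H₁, hk₁, hH₁, hle₁⟩ := h₁ a f g F G hfF hgG hF hG'
  obtain ⟨k₂, H₂, hk₂, hH₂, hle₂⟩ := h₂ a g f G F hgG hfF hG hF'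
  obtain ⟨k₃, hsh, hk₃⟩ := hχ.exists_remainder hd hp hfF hgG hσs.le hFσ hGs hσ
  obtain ⟨H₃, hH₃, hle₃⟩ := h₃ a f g F G hfF hgG hFσ hGs k₃ hsh hk₃
  refine ⟨k₁ + k₂ + k₃, H₁ + H₂ + H₃, H₁, H₂, H₃,
    hw.isProduct hχ hp hz hσs.le hFσ hGs hk₁ hk₂ hk₃, (hH₁.add hH₂).add hH₃, fun k₀ t => ?_,
    hle₁.trans ?_, hle₂.trans ?_, hle₃.trans ?_⟩
  · exact (besovNormLow_add_le one_le_two _ _).trans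
      (add_le_add_left (besovNormLow_add_le one_le_two _ _) _)
  · gcongr
    exact le_self_add.trans le_self_add
  · rw [mul_comm (besovNorm χ _ p G)]
    gcongr
    exact le_add_self.trans le_self_add
  · gcongr
    exact le_add_self

/-- Turns a finite constant into a real one; the added `1` ensures that it is positive. -/
theorem le_ofReal_toReal_add_one {C : ℝ≥0∞} (hC : C < ∞) : C ≤ ENNReal.ofReal (C.toReal + 1) := by
  rw [ENNReal.ofReal_add ENNReal.toReal_nonneg zero_le_one, ENNReal.ofReal_toReal hC.ne]
  exact le_self_add

end GevreyBesov

end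

/-! ### The three estimates -/

open GevreyBesov
theorem proposition3p3 (d : ℕ) (hd : 2 ≤ d) (χ : Sp d → ℝ) (hχ : IsCutoff χ)
    (p : ℝ) (hp : 2 ≤ p) (hp4 : p ≤ 4) :
    -- paraproduct; `p * (d - 2) ≤ 2 * d` means `p ≤ 2d/(d-2)` (no condition if `d = 2`)
    (p * ((d : ℝ) - 2) ≤ 2 * d → ∀ s : ℝ, ∃ C : ℝ, 0 < C ∧
      ∀ c₀ t : ℝ, 0 < c₀ → 0 ≤ t → ∀ f g F G : TDist d,
        IsExp χ √(c₀ * t) f F → IsExp χ √(c₀ * t) g G →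
        MemBesov χ (d / p - 1) p F → MemBesov χ (s + 1 - d / 2 + d / p) p G →
        ∃ h H : TDist d, IsParaproduct χ f g h ∧ IsExp χ √(c₀ * t) h H ∧
          besovNorm χ s 2 H ≤ ENNReal.ofReal C *
            (besovNorm χ (d / p - 1) p F * besovNorm χ (s + 1 - d / 2 + d / p) p G)) ∧
    -- remainder
    (∀ s₁ s₂ : ℝ, (d : ℝ) * (1 / 2 - 2 / p) < s₁ + s₂ → ∃ C : ℝ, 0 < C ∧
      ∀ c₀ t : ℝ, 0 < c₀ → 0 ≤ t → ∀ f g F G : TDist d,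
        IsExp χ √(c₀ * t) f F → IsExp χ √(c₀ * t) g G →
        MemBesov χ (s₁ + d * (2 / p - 1 / 2)) p F → MemBesov χ s₂ p G →
        (s₁ + d * (2 / p - 1 / 2) ≤ d / p ∨ s₂ ≤ d / p →
          ∃ h : TDist d, IsSh χ h ∧ IsRemainder χ f g h) ∧
        ∀ h : TDist d, IsSh χ h → IsRemainder χ f g h →
          ∃ H : TDist d, IsExp χ √(c₀ * t) h H ∧
            besovNorm χ (s₁ + s₂) 2 H ≤ ENNReal.ofReal C *
              (besovNorm χ (s₁ + d * (2 / p - 1 / 2)) p F * besovNorm χ s₂ p G)) ∧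
    -- low frequencies of the product
    (p * ((d : ℝ) - 2) ≤ 2 * d → p < 2 * d → ∀ k₀ : ℤ, ∃ C : ℝ, 0 < C ∧
      ∀ c₀ t : ℝ, 0 < c₀ → 0 ≤ t → ∀ f g F G : TDist d,
        IsExp χ √(c₀ * t) f F → IsExp χ √(c₀ * t) g G →
        (MemBesov χ (d / p - 1) p F → MemBesov χ (d / p + 1) p F →
          MemBesov χ (d / p - 1) p G → MemBesov χ (d / p + 1) p G →
          ∃ h H : TDist d, IsProduct χ f g h ∧ IsExp χ √(c₀ * t) h H ∧
            besovNormLow χ k₀ (d / 2) 2 H ≤ ENNReal.ofReal C *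
              (besovNorm χ (d / p - 1) p F * besovNorm χ (d / p + 1) p G +
                besovNorm χ (d / p + 1) p F * besovNorm χ (d / p - 1) p G)) ∧
        (MemBesov χ (d / p - 1) p F → MemBesov χ (d / p) p F →
          MemBesov χ (d / p - 1) p G → MemBesov χ (d / p) p G →
          ∃ h H : TDist d, IsProduct χ f g h ∧ IsExp χ √(c₀ * t) h H ∧
            besovNormLow χ k₀ (d / 2 - 1) 2 H ≤ ENNReal.ofReal C *
              (besovNorm χ (d / p - 1) p F * besovNorm χ (d / p) p G +
                besovNorm χ (d / p) p F * besovNorm χ (d / p - 1) p G)) ∧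
        (MemBesov χ (d / p - 1) p F → MemBesov χ (d / p) p F →
          MemBesov χ (d / p - 1) p G →
          ∃ h H : TDist d, IsProduct χ f g h ∧ IsExp χ √(c₀ * t) h H ∧
            besovNormLow χ k₀ (d / 2 - 1) 2 H ≤ ENNReal.ofReal C *
              ((besovNorm χ (d / p - 1) p F + besovNorm χ (d / p) p F) *
                besovNorm χ (d / p - 1) p G))) := by
  have hp1 : 1 ≤ p := by linarith
  have hp0 : 0 < p := by linarith
  have hd0 : 0 < d := by omega
  have hdr : (0 : ℝ) < d := by exact_mod_cast hd0
  refine ⟨fun hpd s => ?_, fun s₁ s₂ hs => ?_, fun hpd hp2d k₀ => ?_⟩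
  · obtain ⟨C, hC, h⟩ := hχ.exists_paraproduct hp hp4 hpd s
    refine ⟨C.toReal + 1, by positivity, fun c₀ t _ _ f g F G hf hg hF hG => ?_⟩
    obtain ⟨k, H, hk, hH, hle⟩ := h ⟨√(c₀ * t), Real.sqrt_nonneg _⟩ f g F G hf hg hF.2 hG.2
    exact ⟨k, H, hk, hH, hle.trans (mul_le_mul_left (le_ofReal_toReal_add_one hC) _)⟩
  · obtain ⟨C, hC, h⟩ := hχ.exists_remainder_le hp hp4 hs
    refine ⟨C.toReal + 1, by positivity, fun c₀ t _ _ f g F G hf hg hF hG =>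
      ⟨fun hs' => hχ.exists_remainder (a := ⟨√(c₀ * t), Real.sqrt_nonneg _⟩) hd0 hp hf hg
        (by linarith) hF.2 hG.2 hs', fun k hsh hk => ?_⟩⟩
    obtain ⟨H, hH, hle⟩ := h ⟨√(c₀ * t), Real.sqrt_nonneg _⟩ f g F G hf hg hF.2 hG.2 k hsh hk
    exact ⟨H, hH, hle.trans (mul_le_mul_left (le_ofReal_toReal_add_one hC) _)⟩
  · have hdp : 0 < (d : ℝ) / p := div_pos hdr hp0
    -- The condition `p < 2d` is equivalent to this positivity, which the remainder needs when one
    -- factor has regularity `d/p` and the other `d/p - 1`.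
    have hdp2 : 0 < (d : ℝ) / p - 1 + d / p := by
      have : 1 < 2 * (d : ℝ) / p := by rw [lt_div_iff₀ hp0]; linarith
      have e : 2 * (d : ℝ) / p = d / p + d / p := by ring
      linarith
    have e0 : (d : ℝ) / 2 + 1 - d / 2 + d / p = d / p + 1 := by ring
    have e1 : (d : ℝ) / 2 - 1 + 1 - d / 2 + d / p = d / p := by ring
    have e2 : (d : ℝ) / 2 - 1 - 1 + 1 - d / 2 + d / p = d / p - 1 := by ring
    obtain ⟨C₁, hC₁, h₁⟩ := hχ.exists_product hd0 hp hp4 hpd (d / 2) (σ := d / p - 1)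
      (s := d / p + 1) (ρ := d / 2) (by ring) (by linarith) (Or.inl (by linarith)) (d / 2)
    obtain ⟨C₂, hC₂, h₂⟩ := hχ.exists_product hd0 hp hp4 hpd (d / 2 - 1) (σ := d / p - 1)
      (s := d / p) (ρ := d / 2 - 1) (by ring) hdp2 (Or.inr le_rfl) (d / 2 - 1)
    -- Here `G` has only regularity `d/p - 1`, which places the paraproduct with `G` as its
    -- high-frequency factor in regularity `d/2 - 2`, one derivative short; the restriction to `j ≤
    -- k₀` makes up for it. The other paraproduct and the remainder put regularity `d/p` on `F`.
    obtain ⟨C₃, hC₃, h₃⟩ := hχ.exists_product hd0 hp hp4 hpd (d / 2 - 1 - 1) (σ := d / p)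
      (s := d / p - 1) (ρ := d / 2 - 1) (by ring) (by linarith) (Or.inl le_rfl) (d / 2 - 1)
    rw [e0] at h₁
    rw [e1] at h₂
    rw [e1, e2] at h₃
    set K : ℝ≥0∞ := ENNReal.ofReal (2 ^ (k₀ : ℝ))
    have hK : K < ∞ := ENNReal.ofReal_lt_top
    set C : ℝ≥0∞ := 2 * C₁ + 2 * C₂ + (K * C₃ + 2 * C₃) with hCdef
    have hC : C < ∞ := by finiteness
    have hCle := le_ofReal_toReal_add_one hC
    refine ⟨C.toReal + 1, by positivity, fun c₀ t _ _ f g F G hf hg => ⟨fun hF hF' hG hG' => ?_,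
      fun hF hF' hG hG' => ?_, fun hF hF' hG => ?_⟩⟩
    · obtain ⟨k, H, H₁, H₂, H₃, hk, hH, hle, l₁, l₂, l₃⟩ := h₁ ⟨√(c₀ * t), Real.sqrt_nonneg _⟩
        f g F G hf hg hF.2 hG.2 hG'.2 hF'.2 hF.2 hG'.2
      refine ⟨k, H, hk, hH, (hle k₀ _).trans ?_⟩
      set A := besovNorm χ (d / p - 1) p F * besovNorm χ (d / p + 1) p G
      set B := besovNorm χ (d / p + 1) p F * besovNorm χ (d / p - 1) p G
      calc _ ≤ C₁ * A + C₁ * B + C₁ * A := add_le_add (add_le_add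
            ((besovNormLow_le _ _ _ _ _).trans l₁) ((besovNormLow_le _ _ _ _ _).trans l₂))
            ((besovNormLow_le _ _ _ _ _).trans l₃)
        _ ≤ C₁ * A + C₁ * B + C₁ * A + C₁ * B := le_self_add
        _ = 2 * C₁ * (A + B) := by ring
        _ ≤ _ := by
          gcongr
          exact (le_self_add.trans le_self_add).trans hCle
    · obtain ⟨k, H, H₁, H₂, H₃, hk, hH, hle, l₁, l₂, l₃⟩ := h₂ ⟨√(c₀ * t), Real.sqrt_nonneg _⟩
        f g F G hf hg hF.2 hG.2 hG'.2 hF'.2 hF.2 hG'.2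
      refine ⟨k, H, hk, hH, (hle k₀ _).trans ?_⟩
      set A := besovNorm χ (d / p - 1) p F * besovNorm χ (d / p) p G
      set B := besovNorm χ (d / p) p F * besovNorm χ (d / p - 1) p G
      calc _ ≤ C₂ * A + C₂ * B + C₂ * A := add_le_add (add_le_add
            ((besovNormLow_le _ _ _ _ _).trans l₁) ((besovNormLow_le _ _ _ _ _).trans l₂))
            ((besovNormLow_le _ _ _ _ _).trans l₃)
        _ ≤ C₂ * A + C₂ * B + C₂ * A + C₂ * B := le_self_add
        _ = 2 * C₂ * (A + B) := by ring
        _ ≤ _ := by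
          gcongr
          exact (le_add_self.trans le_self_add).trans hCle
    · obtain ⟨k, H, H₁, H₂, H₃, hk, hH, hle, l₁, l₂, l₃⟩ := h₃ ⟨√(c₀ * t), Real.sqrt_nonneg _⟩
        f g F G hf hg hF.2 hG.2 hG.2 hF'.2 hF'.2 hG.2
      refine ⟨k, H, hk, hH, (hle k₀ _).trans ?_⟩
      have l₁' : besovNormLow χ k₀ (d / 2 - 1) 2 H₁ ≤ K * besovNorm χ (d / 2 - 1 - 1) 2 H₁ := by
        have := besovNormLow_add_one_le χ k₀ (d / 2 - 1 - 1) 2 H₁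
        rwa [sub_add_cancel] at this
      set A := besovNorm χ (d / p - 1) p F
      set A' := besovNorm χ (d / p) p F
      set B := besovNorm χ (d / p - 1) p G
      calc _ ≤ K * (C₃ * (A * B)) + C₃ * (A' * B) + C₃ * (A' * B) := add_le_add (add_le_add
            (l₁'.trans (mul_le_mul_right l₁ _)) ((besovNormLow_le _ _ _ _ _).trans l₂))
            ((besovNormLow_le _ _ _ _ _).trans l₃)
        _ ≤ K * (C₃ * (A * B)) + C₃ * (A' * B) + C₃ * (A' * B) +
            (K * (C₃ * (A' * B)) + 2 * (C₃ * (A * B))) := le_self_add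
        _ = (K * C₃ + 2 * C₃) * ((A + A') * B) := by ring
        _ ≤ _ := by
          gcongr
          exact le_add_self.trans hCle
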